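/- Let $p$ be a prime, $k=\overline{\mathbb F}_p$, $R=W(k)$ the ring of Witt vectors of $k$, and $R_1=W_2(k)$ the ring of Witt vectors of length two. A subscript $0$ denotes the central fibre, i.e. the base change along $R\to k$. Let $U_1,U_2\subset\mathbb P^1_R$ be open subsets containing the generic point of the central fibre $\mathbb P^1_k$, and let $\psi_i\colon U_i\to U_i$ ($i=1,2$) be $R$-morphisms of degree $p^2$ (as rational maps $\mathbb P^1_R\dashrightarrow\mathbb P^1_R$) such that the differential of $(\psi_i)_0\colon (U_i)_0\to (U_i)_0$ over $k$ is zero. Put $U=U_1\times_R U_2$ and $\psi=\psi_1\times\psi_2\colon U\to U$. Assume that $\psi_0$ has bidegree $(pd,pe)$, i.e. that $(\psi_1)_0$ and $(\psi_2)_0$ have degrees $pd$ and $pe$ (a constant map having degree $0$), where $d,e\ge 0$ are integers that are not both zero. Let $\Delta\subset\mathbb P^1_R\times_R\mathbb P^1_R$ be the diagonal, let $Y_0$ be the closed subset $\psi_0^{-1}(\Delta_0)$ of $U_0$ with its reduced scheme structure, and assume that $Y_0$ is nonsingular. Let $N$ be the number of points of $$\mathrm{im}\bigl(\psi(U(R_1))\cap(\Delta\cap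 U)(R_1)\longrightarrow\Delta_0(k)\bigr),$$ where $U(R_1)$ denotes the set of $R$-morphisms $\mathrm{Spec}\,R_1\to U$ and the arrow is reduction along $R_1\to k$. If $N$ is finite, then $$N\le (d+e)\,p^2 .$$ -/

import Mathlib

open CategoryTheory CategoryTheory.Limits AlgebraicGeometry

noncomputable section

namespace WittLine

/-- The field `k`, an algebraic closure of `𝔽_p`. -/
abbrev BaseField (p : ℕ) [Fact p.Prime] : Type := AlgebraicClosure (ZMod p)

/-- The ring `R = W(k)` of Witt vectors of `k`. -/
abbrev W (p : ℕ) [Fact p.Prime] : Type := WittVector p (BaseField p)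

/-- The ring `R₁ = W₂(k)` of Witt vectors of length two. -/
abbrev W₂ (p : ℕ) [Fact p.Prime] : Type := TruncatedWittVector p 2 (BaseField p)

/-- The reduction map `R₁ → k`, `(a₀, a₁) ↦ a₀`. -/
def residueW₂ (p : ℕ) [Fact p.Prime] : W₂ p →+* BaseField p where
  toFun a := a.coeff 0
  map_one' := by
    rw [← map_one (WittVector.truncate (p := p) 2), WittVector.coeff_truncate]
    exact WittVector.one_coeff_zero p _
  map_zero' := TruncatedWittVector.coeff_zero p 2 (BaseField p) 0
  map_add' a b := by
    obtain ⟨x, rfl⟩ := WittVector.truncate_surjective p 2 _ a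
    obtain ⟨y, rfl⟩ := WittVector.truncate_surjective p 2 _ b
    rw [← map_add, WittVector.coeff_truncate, WittVector.coeff_truncate,
      WittVector.coeff_truncate]
    exact WittVector.add_coeff_zero x y
  map_mul' a b := by
    obtain ⟨x, rfl⟩ := WittVector.truncate_surjective p 2 _ a
    obtain ⟨y, rfl⟩ := WittVector.truncate_surjective p 2 _ b
    rw [← map_mul, WittVector.coeff_truncate, WittVector.coeff_truncate,
      WittVector.coeff_truncate]
    exact WittVector.mul_coeff_zero x y

/-- `Spec R`. -/
abbrev specW (p : ℕ) [Fact p.Prime] : Scheme.{0} := Spec (CommRingCat.of (W p))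

/-- `Spec R₁`. -/
abbrev specW₂ (p : ℕ) [Fact p.Prime] : Scheme.{0} := Spec (CommRingCat.of (W₂ p))

/-- `Spec k`. -/
abbrev specK (p : ℕ) [Fact p.Prime] : Scheme.{0} := Spec (CommRingCat.of (BaseField p))

/-- The closed immersion `Spec k ⟶ Spec R` given by `(a₀, a₁, …) ↦ a₀`. -/
def specKToSpecW (p : ℕ) [Fact p.Prime] : specK p ⟶ specW p :=
  Spec.map (CommRingCat.ofHom WittVector.constantCoeff)

/-- The closed immersion `Spec R₁ ⟶ Spec R` given by truncation. -/
def specW₂ToSpecW (p : ℕ) [Fact p.Prime] : specW₂ p ⟶ specW p :=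
  Spec.map (CommRingCat.ofHom (WittVector.truncate 2))

/-- The closed immersion `Spec k ⟶ Spec R₁` given by reduction. -/
def specKToSpecW₂ (p : ℕ) [Fact p.Prime] : specK p ⟶ specW₂ p :=
  Spec.map (CommRingCat.ofHom (residueW₂ p))

section ProjectiveLine

attribute [local instance] MvPolynomial.gradedAlgebra

/-- The projective line `ℙ¹_A = Proj A[X₀, X₁]`. -/
abbrev P1 (A : Type) [CommRing A] : Scheme.{0} :=
  Proj (MvPolynomial.homogeneousSubmodule (Fin 2) A)

/-- The structure morphism `ℙ¹_A ⟶ Spec A`. -/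
def P1.str (A : Type) [CommRing A] : P1 A ⟶ Spec (CommRingCat.of A) :=
  Proj.toSpecZero (MvPolynomial.homogeneousSubmodule (Fin 2) A) ≫
    Spec.map (CommRingCat.ofHom
      (algebraMap A (MvPolynomial.homogeneousSubmodule (Fin 2) A 0)))

instance (A : Type) [CommRing A] : IsSeparated (P1.str A) := by
  have : IsSeparated (Proj.toSpecZero (MvPolynomial.homogeneousSubmodule (Fin 2) A)) :=
    inferInstance
  have : IsSeparated (Spec.map (CommRingCat.ofHom
      (algebraMap A (MvPolynomial.homogeneousSubmodule (Fin 2) A 0)))) := inferInstance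
  unfold P1.str
  exact MorphismProperty.comp_mem _ _ _ ‹_› ‹_›

end ProjectiveLine

section General

/-- `f` has degree `n`: if `f` is dominant, `n` is the degree of the extension of residue fields
at the generic point of the irreducible scheme `X` (for integral schemes, the degree of the
extension of function fields); if `f` is not dominant, `n = 0`. -/
def HasDegree {X Y : Scheme.{0}} (f : X ⟶ Y) (n : ℕ) : Prop :=
  ∃ η : X, IsGenericPoint η Set.univ ∧
    ((IsDominant f ∧ f.residueDegree η = n) ∨ (¬ IsDominant f ∧ n = 0))

/-- For `f : X ⟶ Y` over `S`, where `s : X ⟶ S` is the structure morphism of `X`: the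
differential `f^*Ω_{Y/S} → Ω_{X/S}` is zero. On stalks it sends `da` to `d(f^# a)`. -/
def HasZeroDifferential {X Y S : Scheme.{0}} (s : X ⟶ S) (f : X ⟶ Y) : Prop :=
  ∀ (x : X) (a : Y.presheaf.stalk (f x)),
    letI : Algebra (S.presheaf.stalk (s x)) (X.presheaf.stalk x) := (s.stalkMap x).hom.toAlgebra
    KaehlerDifferential.D (S.presheaf.stalk (s x)) (X.presheaf.stalk x) ((f.stalkMap x).hom a) = 0

/-- A scheme is nonsingular if all its local rings are regular. -/
def IsNonsingular (X : Scheme.{0}) : Prop :=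
  ∀ x : X, IsRegularLocalRing (X.presheaf.stalk x)

end General

section CentralFibre

variable {p : ℕ} [Fact p.Prime]

/-- The central fibre `X₀ = X ×_{Spec R} Spec k` of an `R`-scheme `s : X ⟶ Spec R`. -/
abbrev centralFibre {X : Scheme.{0}} (s : X ⟶ specW p) : Scheme.{0} :=
  pullback s (specKToSpecW p)

/-- The inclusion `X₀ ⟶ X`. -/
abbrev centralFibreι {X : Scheme.{0}} (s : X ⟶ specW p) : centralFibre s ⟶ X :=
  pullback.fst s (specKToSpecW p)

/-- The structure morphism `X₀ ⟶ Spec k`. -/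
abbrev centralFibreStr {X : Scheme.{0}} (s : X ⟶ specW p) : centralFibre s ⟶ specK p :=
  pullback.snd s (specKToSpecW p)

/-- The morphism `f₀ : X₀ ⟶ Y₀` induced by a morphism `f : X ⟶ Y` of `R`-schemes. -/
abbrev centralFibreMap {X Y : Scheme.{0}} (s : X ⟶ specW p) (t : Y ⟶ specW p) (f : X ⟶ Y)
    (hf : f ≫ t = s) : centralFibre s ⟶ centralFibre t :=
  pullback.map s (specKToSpecW p) t (specKToSpecW p) f (𝟙 _) (𝟙 _) (by simp [hf]) (by simp)

/-- The structure morphism `U ⟶ Spec R` of an open subscheme `U ⊆ ℙ¹_R`. -/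
abbrev openStr (U : (P1 (W p)).Opens) : U.toScheme ⟶ specW p :=
  U.ι ≫ P1.str (W p)

/-- `U` contains the generic point of the central fibre of `ℙ¹_R`. -/
def ContainsCentralGenericPoint (U : (P1 (W p)).Opens) : Prop :=
  ∃ η : centralFibre (P1.str (W p)), IsGenericPoint η Set.univ ∧
    centralFibreι (P1.str (W p)) η ∈ U

end CentralFibre

section Product

variable {p : ℕ} [Fact p.Prime]

/-- `ℙ¹_R ×_R ℙ¹_R`. -/
abbrev P1xP1 (p : ℕ) [Fact p.Prime] : Scheme.{0} := pullback (P1.str (W p)) (P1.str (W p))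

/-- The diagonal `Δ : ℙ¹_R ⟶ ℙ¹_R ×_R ℙ¹_R`. -/
abbrev diag (p : ℕ) [Fact p.Prime] : P1 (W p) ⟶ P1xP1 p := pullback.diagonal (P1.str (W p))

/-- `U = U₁ ×_R U₂`. -/
abbrev prodOpen (U₁ U₂ : (P1 (W p)).Opens) : Scheme.{0} := pullback (openStr U₁) (openStr U₂)

/-- The structure morphism `U₁ ×_R U₂ ⟶ Spec R`. -/
abbrev prodStr (U₁ U₂ : (P1 (W p)).Opens) : prodOpen U₁ U₂ ⟶ specW p :=
  pullback.fst (openStr U₁) (openStr U₂) ≫ openStr U₁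

/-- The inclusion `U₁ ×_R U₂ ⟶ ℙ¹_R ×_R ℙ¹_R`. -/
abbrev prodι (U₁ U₂ : (P1 (W p)).Opens) : prodOpen U₁ U₂ ⟶ P1xP1 p :=
  pullback.map (openStr U₁) (openStr U₂) (P1.str (W p)) (P1.str (W p)) U₁.ι U₂.ι (𝟙 _)
    (by simp [openStr]) (by simp [openStr])

/-- `ψ = ψ₁ × ψ₂ : U ⟶ U`. -/
abbrev prodMap {U₁ U₂ : (P1 (W p)).Opens}
    (ψ₁ : U₁.toScheme ⟶ U₁.toScheme) (h₁ : ψ₁ ≫ openStr U₁ = openStr U₁)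
    (ψ₂ : U₂.toScheme ⟶ U₂.toScheme) (h₂ : ψ₂ ≫ openStr U₂ = openStr U₂) :
    prodOpen U₁ U₂ ⟶ prodOpen U₁ U₂ :=
  pullback.map (openStr U₁) (openStr U₂) (openStr U₁) (openStr U₂) ψ₁ ψ₂ (𝟙 _)
    (by simp [h₁]) (by simp [h₂])

lemma prodMap_str {U₁ U₂ : (P1 (W p)).Opens}
    (ψ₁ : U₁.toScheme ⟶ U₁.toScheme) (h₁ : ψ₁ ≫ openStr U₁ = openStr U₁)
    (ψ₂ : U₂.toScheme ⟶ U₂.toScheme) (h₂ : ψ₂ ≫ openStr U₂ = openStr U₂) :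
    prodMap ψ₁ h₁ ψ₂ h₂ ≫ prodStr U₁ U₂ = prodStr U₁ U₂ := by
  have h : prodMap ψ₁ h₁ ψ₂ h₂ ≫ pullback.fst (openStr U₁) (openStr U₂) =
      pullback.fst (openStr U₁) (openStr U₂) ≫ ψ₁ := pullback.lift_fst _ _ _
  rw [prodStr, reassoc_of% h, h₁]

/-- The closed subset `ψ₀⁻¹(Δ₀)` of the central fibre `U₀` of `U`, where `ψ₀ : U₀ ⟶ U₀` is
induced by `ψ`. -/
def diagPreimage {U₁ U₂ : (P1 (W p)).Opens}
    (ψ₁ : U₁.toScheme ⟶ U₁.toScheme) (h₁ : ψ₁ ≫ openStr U₁ = openStr U₁)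
    (ψ₂ : U₂.toScheme ⟶ U₂.toScheme) (h₂ : ψ₂ ≫ openStr U₂ = openStr U₂) :
    TopologicalSpace.Closeds (centralFibre (prodStr U₁ U₂)) where
  carrier :=
    (centralFibreMap (prodStr U₁ U₂) (prodStr U₁ U₂) (prodMap ψ₁ h₁ ψ₂ h₂)
      (prodMap_str ψ₁ h₁ ψ₂ h₂) ≫ centralFibreι (prodStr U₁ U₂) ≫ prodι U₁ U₂) ⁻¹'
      Set.range (diag p)
  isClosed' := (diag p).isClosedEmbedding.isClosed_range.preimage (Scheme.Hom.continuous _)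

/-- `Y₀`: the closed subset `ψ₀⁻¹(Δ₀)` with its reduced scheme structure. -/
def reducedDiagPreimage {U₁ U₂ : (P1 (W p)).Opens}
    (ψ₁ : U₁.toScheme ⟶ U₁.toScheme) (h₁ : ψ₁ ≫ openStr U₁ = openStr U₁)
    (ψ₂ : U₂.toScheme ⟶ U₂.toScheme) (h₂ : ψ₂ ≫ openStr U₂ = openStr U₂) : Scheme.{0} :=
  (Scheme.IdealSheafData.vanishingIdeal (diagPreimage ψ₁ h₁ ψ₂ h₂)).subscheme

/-- The image of `ψ(U(R₁)) ∩ (Δ ∩ U)(R₁)` in `Δ₀(k)`, as a set of `k`-points of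
`ℙ¹_R ×_R ℙ¹_R`: the reductions `c` of those `R₁`-points `ψ(a)`, with `a ∈ U(R₁)`, that
factor through the diagonal. -/
def diagonalImage {U₁ U₂ : (P1 (W p)).Opens}
    (ψ₁ : U₁.toScheme ⟶ U₁.toScheme) (h₁ : ψ₁ ≫ openStr U₁ = openStr U₁)
    (ψ₂ : U₂.toScheme ⟶ U₂.toScheme) (h₂ : ψ₂ ≫ openStr U₂ = openStr U₂) :
    Set (specK p ⟶ P1xP1 p) :=
  {c | ∃ a : specW₂ p ⟶ prodOpen U₁ U₂, a ≫ prodStr U₁ U₂ = specW₂ToSpecW p ∧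
    (∃ b : specW₂ p ⟶ P1 (W p), a ≫ prodMap ψ₁ h₁ ψ₂ h₂ ≫ prodι U₁ U₂ = b ≫ diag p) ∧
    c = specKToSpecW₂ p ≫ a ≫ prodMap ψ₁ h₁ ψ₂ h₂ ≫ prodι U₁ U₂}

end Product

end WittLine

end

/-!
In homogeneous coordinates, a degree-`p²` endomorphism `ψ₁` of an open subset of `ℙ¹_R` is given
by a pair `(F : G)` of coprime forms of degree `p²` over `R = W(k)`, and this describes `ψ₁` on all
points with values in local rings (`exists_forms`, `hasCoords_of_generic`): the stalks of `ℙ¹_R` are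
localizations of the factorial ring `R[T]`, so a coprime pair that describes a morphism at the
generic point is unimodular on every stalk where the morphism is defined. On the central fibre a
common factor `H` may appear, and what remains has derivative zero, hence is a `p`-th power: `F = H P^p` and `G = H Q^p` modulo `p`, with
`P` and `Q` coprime of degree at most `d` (`exists_special_forms`). Write `F = H P^p + p F₂` and
`G = H Q^p + p G₂`, and similarly `F' = H' P'^p + p F₂'`, `G' = H' Q'^p + p G₂'` for `ψ₂`.

Since `p`-th powers in `W₂(k)` only depend on residues, two `W₂(k)`-points with reductions `x` and
`y` satisfy `ψ₁ = ψ₂` if and only if (`IsFrobeniusExpansion.proportional_iff`)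
* `P(x) Q'(y) = Q(x) P'(y)`, and
* `F(x) G₂'(y) + F₂(x) G'(y) = G(x) F₂'(y) + G₂(x) F'(y)`.

These are two conditions on `ℙ¹_k × ℙ¹_k`, of bidegrees `(δ, ε)` and `(p², p²)` with `δ ≤ d` and
`ε ≤ e`. If they have no common component, their intersection number is
`(δ + ε) p² ≤ (d + e) p²`. The bound is read off from the resultant in the second variable, a form of
degree `(δ + ε) p²` that vanishes at the first coordinate of each solution (`eliminant`,
`ncard_diagonalImage_le_of_eliminant_ne_zero`). If the resultant is zero, then almost every `x`
has a solution `y` that lifts to `W₂(k)`, and `x ↦ (P(x)^p : Q(x)^p)` takes infinitely many values,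
contrary to the finiteness of the image (`infinite_diagonalImage_of_eliminant_eq_zero`). If
`δ = 0` or `ε = 0`, then `ψ₁` or `ψ₂` is constant on the central fibre, and there is at most one
point.
-/

namespace WittLine

open Polynomial

/-! ### Values of binary forms -/

section BinaryForms

variable {R S T : Type*} [CommRing R] [CommRing S] [CommRing T]

/-- The value at `v = (v₀, v₁)` of the binary form `∑ fᵢ X₀ⁱ X₁ⁿ⁻ⁱ` of degree `n` with
dehomogenization `f`, whose coefficients are transported along `ρ`. -/
noncomputable def formEval (ρ : R →+* S) (n : ℕ) (f : R[X]) (v : Fin 2 → S) : S :=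
  MvPolynomial.eval₂ ρ v (f.homogenize n)

lemma formEval_add (ρ : R →+* S) (n : ℕ) (f g : R[X]) (v : Fin 2 → S) :
    formEval ρ n (f + g) v = formEval ρ n f v + formEval ρ n g v := by
  simp [formEval]

lemma formEval_sub (ρ : R →+* S) (n : ℕ) (f g : R[X]) (v : Fin 2 → S) :
    formEval ρ n (f - g) v = formEval ρ n f v - formEval ρ n g v := by
  simp only [formEval, homogenize_sub]
  exact map_sub (MvPolynomial.eval₂Hom ρ v) _ _

lemma formEval_zero (ρ : R →+* S) (n : ℕ) (v : Fin 2 → S) :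
    formEval ρ n 0 v = 0 := by
  simp [formEval]

lemma formEval_C_mul (ρ : R →+* S) (n : ℕ) (c : R) (f : R[X]) (v : Fin 2 → S) :
    formEval ρ n (C c * f) v = ρ c * formEval ρ n f v := by
  simp [formEval]

lemma formEval_mul (ρ : R →+* S) {m n : ℕ} {f g : R[X]} (hf : f.natDegree ≤ m)
    (hg : g.natDegree ≤ n) (v : Fin 2 → S) :
    formEval ρ (m + n) (f * g) v = formEval ρ m f v * formEval ρ n g v := by
  simp [formEval, homogenize_mul _ _ hf hg]

lemma formEval_pow (ρ : R →+* S) {m : ℕ} {f : R[X]} (hf : f.natDegree ≤ m) (k : ℕ)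
    (v : Fin 2 → S) :
    formEval ρ (k * m) (f ^ k) v = formEval ρ m f v ^ k := by
  induction k with
  | zero => simp [formEval]
  | succ k ih =>
    rw [pow_succ, pow_succ, Nat.succ_mul, formEval_mul ρ (natDegree_pow_le_of_le k hf) hf, ih]

lemma map_formEval (ρ : R →+* S) (g : S →+* T) (n : ℕ) (f : R[X]) (v : Fin 2 → S) :
    g (formEval ρ n f v) = formEval (g.comp ρ) n f (g ∘ v) := by
  simp only [formEval]
  rw [MvPolynomial.hom_eval₂]
  rfl

lemma formEval_map (ρ : R →+* S) (g : S →+* T) (n : ℕ) (f : R[X]) (v : Fin 2 → T) :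
    formEval g n (f.map ρ) v = formEval (g.comp ρ) n f v := by
  simp only [formEval, homogenize_map, MvPolynomial.eval₂_map]

lemma formEval_smul (ρ : R →+* S) (n : ℕ) (f : R[X]) (c : S) (v : Fin 2 → S) :
    formEval ρ n f (c • v) = c ^ n * formEval ρ n f v := by
  simp only [formEval, homogenize, MvPolynomial.eval₂_sum, MvPolynomial.eval₂_monomial,
    Finset.mul_sum]
  refine Finset.sum_congr rfl fun kl hkl => ?_
  rw [Finset.HasAntidiagonal.mem_antidiagonal] at hkl
  simp only [Finsupp.prod_fintype, pow_zero, implies_true, Fin.prod_univ_two, Pi.smul_apply,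
    smul_eq_mul]
  simp [mul_pow, ← hkl, pow_add]
  ring

lemma formEval_of_eq_one (ρ : R →+* S) {n : ℕ} {f : R[X]} (hf : f.natDegree ≤ n)
    {v : Fin 2 → S} (hv : v 1 = 1) : formEval ρ n f v = f.eval₂ ρ (v 0) :=
  eval₂_homogenize_of_eq_one hf ρ v hv

lemma formEval_of_eq_zero (ρ : R →+* S) {n : ℕ} {f : R[X]}
    {v : Fin 2 → S} (hv : v 1 = 0) : formEval ρ n f v = ρ (f.coeff n) * v 0 ^ n := by
  simp only [formEval, homogenize, MvPolynomial.eval₂_sum, MvPolynomial.eval₂_monomial]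
  rw [Finset.sum_eq_single (n, 0)]
  · simp [Finsupp.prod_fintype, Fin.prod_univ_two]
  · rintro ⟨a, b⟩ hab hne
    rw [Finset.HasAntidiagonal.mem_antidiagonal] at hab
    have : b ≠ 0 := by
      rintro rfl
      exact hne (by simpa using hab)
    simp [Finsupp.prod_fintype, Fin.prod_univ_two, hv, this]
  · simp

end BinaryForms

/-! ### Resultants and elimination on `ℙ¹ × ℙ¹` -/

section Determinant

variable {R : Type*} [CommRing R]

lemma natDegree_prod_le_sum {ι : Type*} (s : Finset ι) (f : ι → R[X]) (b : ι → ℕ)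
    (h : ∀ i ∈ s, (f i).natDegree ≤ b i) : (∏ i ∈ s, f i).natDegree ≤ ∑ i ∈ s, b i :=
  (natDegree_prod_le _ _).trans (Finset.sum_le_sum h)

lemma coeff_prod_sum {ι : Type*} (s : Finset ι) (f : ι → R[X]) (b : ι → ℕ)
    (h : ∀ i ∈ s, (f i).natDegree ≤ b i) :
    (∏ i ∈ s, f i).coeff (∑ i ∈ s, b i) = ∏ i ∈ s, (f i).coeff (b i) := by
  classical
  induction s using Finset.induction_on with
  | empty => simp
  | insert i s hi ih =>
    rw [Finset.prod_insert hi, Finset.sum_insert hi, Finset.prod_insert hi,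
      coeff_mul_add_eq_of_natDegree_le (h i (by simp))
        (natDegree_prod_le_sum s f b fun j hj => h j (by simp [hj])),
      ih fun j hj => h j (by simp [hj])]

lemma natDegree_det_le_sum {ι : Type*} [Fintype ι] [DecidableEq ι] (A : Matrix ι ι R[X])
    (b : ι → ℕ) (h : ∀ i j, (A i j).natDegree ≤ b j) : A.det.natDegree ≤ ∑ j, b j := by
  rw [Matrix.det_apply]
  refine natDegree_sum_le_of_forall_le _ _ fun σ _ => ?_
  refine (natDegree_smul_le _ _).trans ?_
  exact natDegree_prod_le_sum _ _ _ fun i _ => h _ _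

/-- The top coefficient of a determinant with column-wise degree bounds is the determinant of the
top coefficients. -/
lemma coeff_det_sum {ι : Type*} [Fintype ι] [DecidableEq ι] (A : Matrix ι ι R[X])
    (b : ι → ℕ) (h : ∀ i j, (A i j).natDegree ≤ b j) :
    A.det.coeff (∑ j, b j) = (Matrix.of fun i j => (A i j).coeff (b j)).det := by
  rw [Matrix.det_apply, Matrix.det_apply, finsetSum_coeff]
  refine Finset.sum_congr rfl fun σ _ => ?_
  rw [coeff_smul, coeff_prod_sum _ _ _ fun i _ => h _ _]
  rfl

end Determinant

section Resultant

variable {K : Type*} [Field K]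

/-- Two binary forms with a common zero on the projective line have vanishing resultant. -/
lemma resultant_eq_zero_of_formEval {f g : K[X]} {m n : ℕ} (hf : f.natDegree ≤ m)
    (hg : g.natDegree ≤ n) (hn : 0 < n) {y : Fin 2 → K} (hy : y ≠ 0)
    (hfy : formEval (RingHom.id K) m f y = 0) (hgy : formEval (RingHom.id K) n g y = 0) :
    resultant f g m n = 0 := by
  -- at a common zero at infinity both leading coefficients vanish
  by_cases h1 : y 1 = 0
  · have h0 : y 0 ≠ 0 := fun h0 => hy (by ext i; fin_cases i <;> simp [h0, h1])
    rw [formEval_of_eq_zero _ h1] at hfy hgy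
    have hfm : f.coeff m = 0 := by simpa [h0] using hfy
    have hgn : g.coeff n = 0 := by simpa [h0] using hgy
    rcases Nat.eq_zero_or_pos m with rfl | hm
    · simp [hfm, hn.ne']
    · refine resultant_eq_zero_of_lt_lt _ _ _ _ ?_ ?_
      · exact lt_of_le_of_ne hf fun h => hm.ne' (by
          have : f = 0 := by rw [← leadingCoeff_eq_zero, leadingCoeff, h, hfm]
          rw [← h, this, natDegree_zero])
      · exact lt_of_le_of_ne hg fun h => hn.ne' (by
          have : g = 0 := by rw [← leadingCoeff_eq_zero, leadingCoeff, h, hgn]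
          rw [← h, this, natDegree_zero])
  · have key : ∀ (f : K[X]) (m : ℕ), f.natDegree ≤ m → formEval (RingHom.id K) m f y = 0 →
        f.eval (y 0 / y 1) = 0 := by
      intro f m hf h
      have := eval_homogenize hf y h1
      rw [formEval, ← MvPolynomial.eval₂_id] at *
      rw [h] at this
      simpa [h1] using this.symm
    obtain ⟨a, b, -, -, h⟩ := exists_mul_add_mul_eq_C_resultant f g hf hg (Or.inr hn.ne')
    have := congrArg (eval (y 0 / y 1)) h
    simpa [key f m hf hfy, key g n hg hgy] using this.symm

/-- Conversely, a vanishing resultant with nonvanishing leading coefficient gives a common root. -/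
lemma exists_common_root_of_resultant_eq_zero [IsAlgClosed K] {f g : K[X]} {m n : ℕ}
    (hf : f.natDegree ≤ m) (hfm : f.coeff m ≠ 0) (hg : g.natDegree ≤ n)
    (h : resultant f g m n = 0) : ∃ y, f.eval y = 0 ∧ g.eval y = 0 := by
  obtain rfl : f.natDegree = m := le_antisymm hf (le_natDegree_of_ne_zero hfm)
  rw [resultant_eq_prod_eval f g n hg (IsAlgClosed.splits f)] at h
  rcases mul_eq_zero.mp h with h | h
  · exact absurd (eq_zero_of_pow_eq_zero h) hfm
  · obtain ⟨y, hy, hy'⟩ := Multiset.mem_map.mp (Multiset.prod_eq_zero_iff.mp h)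
    exact ⟨y, (mem_roots'.mp hy).2, hy'⟩

end Resultant

section Elimination

variable {K : Type*} [Field K] {δ ε n : ℕ} {F G P Q : K[X]} {ι : Type*} [Fintype ι]
  {a b : ι → K[X]}

variable (ε n F G P Q a b) in
/-- The resultant with respect to `Y` of `F(X)Q(Y) - G(X)P(Y)` and `∑ aᵢ(X)bᵢ(Y)`, as forms of
degrees `ε` and `n` in `Y`. -/
noncomputable def eliminant : K[X] :=
  resultant (C F * Q.map C - C G * P.map C) (∑ i, C (a i) * (b i).map C) ε n

lemma natDegree_coeff_sylvester_le (hF : F.natDegree ≤ δ) (hG : G.natDegree ≤ δ)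
    (ha : ∀ i, (a i).natDegree ≤ n) (i j : Fin (ε + n)) :
    (sylvester (C F * Q.map C - C G * P.map C) (∑ i, C (a i) * (b i).map C) ε n i j).natDegree ≤
      Fin.addCases (fun _ => n) (fun _ => δ) j := by
  induction j using Fin.addCases with
  | left j =>
    simp only [sylvester, Matrix.of_apply, Fin.addCases_left]
    split_ifs
    · simp only [finsetSum_coeff, coeff_C_mul, coeff_map]
      exact natDegree_sum_le_of_forall_le _ _ fun i _ =>
        (natDegree_mul_C_le _ _).trans (ha i)
    · simp
  | right j =>
    simp only [sylvester, Matrix.of_apply, Fin.addCases_right]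
    split_ifs
    · simp only [coeff_sub, coeff_C_mul, coeff_map]
      exact (natDegree_sub_le_of_le ((natDegree_mul_C_le _ _).trans hF)
        ((natDegree_mul_C_le _ _).trans hG)).trans_eq (max_self δ)
    · simp

lemma sum_addCases_const (ε n δ : ℕ) :
    ∑ j : Fin (ε + n), (Fin.addCases (fun _ => n) (fun _ => δ) j : ℕ) = ε * n + n * δ := by
  simp [Fin.sum_univ_add]

lemma natDegree_eliminant_le (hF : F.natDegree ≤ δ) (hG : G.natDegree ≤ δ)
    (ha : ∀ i, (a i).natDegree ≤ n) :
    (eliminant ε n F G P Q a b).natDegree ≤ ε * n + n * δ := by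
  rw [← sum_addCases_const]
  exact natDegree_det_le_sum _ _ (natDegree_coeff_sylvester_le hF hG ha)

lemma coeff_eliminant (hF : F.natDegree ≤ δ) (hG : G.natDegree ≤ δ)
    (ha : ∀ i, (a i).natDegree ≤ n) :
    (eliminant ε n F G P Q a b).coeff (ε * n + n * δ) =
      resultant (C (F.coeff δ) * Q - C (G.coeff δ) * P) (∑ i, C ((a i).coeff n) * b i) ε n := by
  rw [← sum_addCases_const]
  refine (coeff_det_sum _ _ (natDegree_coeff_sylvester_le hF hG ha)).trans ?_
  rw [resultant]
  congr 1
  ext i j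
  induction j using Fin.addCases with
  | left j =>
    simp only [sylvester, Matrix.of_apply, Fin.addCases_left]
    split_ifs <;> simp
  | right j =>
    simp only [sylvester, Matrix.of_apply, Fin.addCases_right]
    split_ifs <;> simp

lemma eval_eliminant (x : K) :
    (eliminant ε n F G P Q a b).eval x =
      resultant (C (F.eval x) * Q - C (G.eval x) * P) (∑ i, C ((a i).eval x) * b i) ε n := by
  rw [← coe_evalRingHom, eliminant, ← resultant_map_map]
  congr 1
  · simp [Polynomial.map_map, Polynomial.map_sub, Polynomial.map_mul]
    have : (evalRingHom x).comp C = RingHom.id K := by ext; simp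
    simp [this]
  · simp [Polynomial.map_sum, Polynomial.map_map]
    have : (evalRingHom x).comp C = RingHom.id K := by ext; simp
    simp [this]

/-- The eliminant, as a form of degree `ε * n + n * δ`, vanishes at the first coordinate of
each common zero in `ℙ¹ × ℙ¹`. -/
lemma formEval_eliminant_eq_zero (hF : F.natDegree ≤ δ) (hG : G.natDegree ≤ δ)
    (hP : P.natDegree ≤ ε) (hQ : Q.natDegree ≤ ε)
    (ha : ∀ i, (a i).natDegree ≤ n) (hb : ∀ i, (b i).natDegree ≤ n) (hn : 0 < n)
    {x y : Fin 2 → K} (hx : x ≠ 0) (hy : y ≠ 0)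
    (h₁ : formEval (RingHom.id K) δ F x * formEval (RingHom.id K) ε Q y =
      formEval (RingHom.id K) δ G x * formEval (RingHom.id K) ε P y)
    (h₂ : ∑ i, formEval (RingHom.id K) n (a i) x * formEval (RingHom.id K) n (b i) y = 0) :
    formEval (RingHom.id K) (ε * n + n * δ) (eliminant ε n F G P Q a b) x = 0 := by
  have key : ∀ (s t : K) (c : ι → K), s * formEval (RingHom.id K) ε Q y =
      t * formEval (RingHom.id K) ε P y → ∑ i, c i * formEval (RingHom.id K) n (b i) y = 0 →
      resultant (C s * Q - C t * P) (∑ i, C (c i) * b i) ε n = 0 := by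
    intro s t c h h'
    refine resultant_eq_zero_of_formEval ?_ ?_ hn hy ?_ ?_
    · exact (natDegree_sub_le_of_le ((natDegree_C_mul_le _ _).trans hQ)
        ((natDegree_C_mul_le _ _).trans hP)).trans_eq (max_self ε)
    · exact natDegree_sum_le_of_forall_le _ _ fun i _ => (natDegree_C_mul_le _ _).trans (hb i)
    · rw [formEval_sub, formEval_C_mul, formEval_C_mul]
      exact sub_eq_zero.mpr h
    · rw [← h']
      simp [formEval]
  by_cases h1 : x 1 = 0
  · have h0 : x 0 ≠ 0 := fun h0 => hx (by ext i; fin_cases i <;> simp [h0, h1])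
    rw [formEval_of_eq_zero _ h1, coeff_eliminant hF hG ha, key, map_zero, zero_mul]
    · simp only [formEval_of_eq_zero _ h1, RingHom.id_apply] at h₁
      refine mul_left_cancel₀ (pow_ne_zero δ h0) ?_
      linear_combination h₁
    · simp only [formEval_of_eq_zero _ h1, RingHom.id_apply] at h₂
      refine mul_left_cancel₀ (pow_ne_zero n h0) ?_
      rw [mul_zero, ← h₂, Finset.mul_sum]
      exact Finset.sum_congr rfl fun i _ => by ring
  · have hfe : ∀ {m : ℕ} {f : K[X]}, f.natDegree ≤ m →
        formEval (RingHom.id K) m f x = f.eval (x 0 / x 1) * x 1 ^ m := by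
      intro m f hf
      rw [← eval_homogenize hf x h1, formEval, MvPolynomial.eval₂_id]
    rw [hfe (natDegree_eliminant_le hF hG ha), eval_eliminant, key, zero_mul]
    · rw [hfe hF, hfe hG] at h₁
      refine mul_left_cancel₀ (pow_ne_zero δ h1) ?_
      linear_combination h₁
    · simp only [hfe (ha _)] at h₂
      refine mul_left_cancel₀ (pow_ne_zero n h1) ?_
      rw [mul_zero, ← h₂, Finset.mul_sum]
      exact Finset.sum_congr rfl fun i _ => by ring

/-- If the eliminant is zero, then all `x` for which `F(x)Q(Y) - G(x)P(Y)` has degree exactly `ε`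
occur as first coordinates of common zeros. -/
lemma exists_common_zero_of_eliminant_eq_zero [IsAlgClosed K]
    (hP : P.natDegree ≤ ε) (hQ : Q.natDegree ≤ ε) (hb : ∀ i, (b i).natDegree ≤ n)
    (h : eliminant ε n F G P Q a b = 0) (x : K)
    (hx : F.eval x * Q.coeff ε - G.eval x * P.coeff ε ≠ 0) :
    ∃ y, F.eval x * Q.eval y = G.eval x * P.eval y ∧ ∑ i, (a i).eval x * (b i).eval y = 0 := by
  have h0 := eval_eliminant (ε := ε) (n := n) (F := F) (G := G) (P := P) (Q := Q) (a := a)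
    (b := b) x
  rw [h, eval_zero] at h0
  obtain ⟨y, hy, hy'⟩ := exists_common_root_of_resultant_eq_zero
    ((natDegree_sub_le_of_le ((natDegree_C_mul_le _ _).trans hQ)
        ((natDegree_C_mul_le _ _).trans hP)).trans_eq (max_self ε)) (by simpa using hx)
    (natDegree_sum_le_of_forall_le _ _ fun i _ => (natDegree_C_mul_le _ _).trans (hb i)) h0.symm
  refine ⟨y, ?_, ?_⟩
  · simpa [sub_eq_zero] using hy
  · simpa [eval_finsetSum] using hy'

/-- A nonzero binary form of degree `M` has at most `M` zeros on the projective line. The zeros are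
indexed by `s`, with pairwise non-proportional coordinate vectors. -/
lemma card_le_of_formEval_eq_zero {α : Type*} (s : Finset α) (x : α → Fin 2 → K)
    (hx : ∀ i ∈ s, x i ≠ 0)
    (hprop : ∀ i ∈ s, ∀ j ∈ s, x i 0 * x j 1 = x i 1 * x j 0 → i = j)
    {M : ℕ} {f : K[X]} (hf : f.natDegree ≤ M) (hf0 : f ≠ 0)
    (h : ∀ i ∈ s, formEval (RingHom.id K) M f (x i) = 0) : s.card ≤ M := by
  classical
  -- the point at infinity and the affine points
  let s₀ := s.filter fun i => x i 1 = 0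
  let s₁ := s.filter fun i => ¬ x i 1 = 0
  have hs : s₀.card + s₁.card = s.card := s.card_filter_add_card_filter_not _
  have hs₀ : s₀.card ≤ 1 := by
    refine Finset.card_le_one.mpr fun i hi j hj => ?_
    rw [Finset.mem_filter] at hi hj
    exact hprop i hi.1 j hj.1 (by rw [hi.2, hj.2]; simp)
  have hs₁ : s₁.card ≤ f.natDegree := by
    have hinj : Set.InjOn (fun i => x i 0 / x i 1) s₁ := by
      intro i hi j hj hij
      rw [Finset.mem_coe, Finset.mem_filter] at hi hj
      refine hprop i hi.1 j hj.1 ?_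
      have := (div_eq_div_iff hi.2 hj.2).mp hij
      rw [this, mul_comm]
    rw [← Finset.card_image_of_injOn hinj]
    refine (Finset.card_le_card (t := f.roots.toFinset) ?_).trans
      ((Multiset.toFinset_card_le _).trans (card_roots' f))
    intro t ht
    obtain ⟨i, hi, rfl⟩ := Finset.mem_image.mp ht
    rw [Finset.mem_filter] at hi
    have h' := eval_homogenize hf (x i) hi.2
    have h'' := h i hi.1
    rw [formEval, MvPolynomial.eval₂_id, h'] at h''
    rw [Multiset.mem_toFinset, mem_roots hf0]
    simpa [hi.2] using h''
  rcases Nat.eq_zero_or_pos s₀.card with h0 | h0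
  · omega
  · -- a zero at infinity lowers the degree of the dehomogenization
    obtain ⟨i, hi⟩ := Finset.card_pos.mp h0
    rw [Finset.mem_filter] at hi
    have h' := h i hi.1
    rw [formEval_of_eq_zero _ hi.2] at h'
    have hi0 : x i 0 ≠ 0 := fun h0 => hx i hi.1 (by ext j; fin_cases j <;> simp [h0, hi.2])
    have hM : f.coeff M = 0 := by simpa [hi0] using h'
    have : f.natDegree ≠ M := fun hM' => hf0 (by
      rw [← leadingCoeff_eq_zero, leadingCoeff, hM', hM])
    omega

end Elimination

/-! ### Homogeneous coordinates of points of `ℙ¹` -/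

lemma one_sub_eq_of_ne {i k : Fin 2} (h : k ≠ i) : 1 - i = k := by decide +revert

lemma one_sub_ne (i : Fin 2) : 1 - i ≠ i := by decide +revert

lemma eq_of_ne_of_ne {i j k : Fin 2} (hj : j ≠ i) (hk : k ≠ i) : k = j := by decide +revert

section Points

attribute [local instance] MvPolynomial.gradedAlgebra

open HomogeneousLocalization

variable {A B B' : Type} [CommRing A] [CommRing B] [CommRing B']

/-- Evaluation of degree-zero fractions `a / f ^ n` at a vector `v` at which `f` is a unit. -/
noncomputable def awayEval (ρ : A →+* B) (v : Fin 2 → B) (f : MvPolynomial (Fin 2) A)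
    (h : IsUnit (MvPolynomial.eval₂Hom ρ v f)) :
    Away (MvPolynomial.homogeneousSubmodule (Fin 2) A) f →+* B :=
  (IsLocalization.Away.lift (S := Localization.Away f) (g := MvPolynomial.eval₂Hom ρ v) f h).comp
    (algebraMap (Away (MvPolynomial.homogeneousSubmodule (Fin 2) A) f) (Localization.Away f))

lemma awayEval_mul_pow (ρ : A →+* B) (v : Fin 2 → B) (f : MvPolynomial (Fin 2) A)
    (h : IsUnit (MvPolynomial.eval₂Hom ρ v f))
    (z : Away (MvPolynomial.homogeneousSubmodule (Fin 2) A) f) (n : ℕ) (a : MvPolynomial (Fin 2) A)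
    (hz : z.val * algebraMap _ (Localization.Away f) f ^ n = algebraMap _ (Localization.Away f) a) :
    awayEval ρ v f h z * f.eval₂ ρ v ^ n = a.eval₂ ρ v := by
  have h2 := congrArg (IsLocalization.Away.lift (S := Localization.Away f)
    (g := MvPolynomial.eval₂Hom ρ v) f h) hz
  rw [map_mul, map_pow, IsLocalization.Away.lift_eq, IsLocalization.Away.lift_eq] at h2
  exact h2

lemma mk_mul_algebraMap_pow (f a : MvPolynomial (Fin 2) A) (n : ℕ)
    (hn : f ^ n ∈ Submonoid.powers f) :
    Localization.mk a ⟨f ^ n, hn⟩ * algebraMap _ (Localization.Away f) f ^ n =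
      algebraMap _ (Localization.Away f) a := by
  rw [Localization.mk_eq_mk', ← map_pow]
  exact IsLocalization.mk'_spec _ _ (⟨f ^ n, hn⟩ : Submonoid.powers f)

lemma homogeneousX (i : Fin 2) :
    (MvPolynomial.X i : MvPolynomial (Fin 2) A) ∈ MvPolynomial.homogeneousSubmodule (Fin 2) A 1 :=
  MvPolynomial.isHomogeneous_X A i

variable (A) in
/-- The standard open immersion `Spec A[X₀, X₁]_(Xᵢ) ⟶ ℙ¹_A`. -/
noncomputable abbrev standardι (i : Fin 2) :
    Spec (.of (Away (MvPolynomial.homogeneousSubmodule (Fin 2) A) (MvPolynomial.X i))) ⟶ P1 A :=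
  Proj.awayι (MvPolynomial.homogeneousSubmodule (Fin 2) A) (MvPolynomial.X i)
    (homogeneousX i) one_pos

lemma isUnit_eval₂_X {ρ : A →+* B} {v : Fin 2 → B} {i : Fin 2} (h : IsUnit (v i)) :
    IsUnit (MvPolynomial.eval₂Hom ρ v (MvPolynomial.X i : MvPolynomial (Fin 2) A)) := by
  simpa using h

/-- The `B`-point of `ℙ¹_A` with homogeneous coordinates `v`, where `vᵢ` is a unit. -/
noncomputable def point (ρ : A →+* B) (v : Fin 2 → B) (i : Fin 2) (h : IsUnit (v i)) :
    Spec (.of B) ⟶ P1 A :=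
  Spec.map (CommRingCat.ofHom (awayEval ρ v (MvPolynomial.X i) (isUnit_eval₂_X h))) ≫ standardι A i

lemma comp_awayEval (ρ : A →+* B) (v : Fin 2 → B) (f : MvPolynomial (Fin 2) A)
    (h : IsUnit (MvPolynomial.eval₂Hom ρ v f)) (g : B →+* B')
    (h' : IsUnit (MvPolynomial.eval₂Hom (g.comp ρ) (g ∘ v) f)) :
    g.comp (awayEval ρ v f h) = awayEval (g.comp ρ) (g ∘ v) f h' := by
  rw [awayEval, awayEval, ← RingHom.comp_assoc]
  congr 1
  refine IsLocalization.ringHom_ext (Submonoid.powers f) (RingHom.ext fun a => ?_)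
  simp only [RingHom.comp_apply, IsLocalization.Away.lift_eq, MvPolynomial.coe_eval₂Hom]
  exact MvPolynomial.hom_eval₂ a _ _ _

lemma specMap_point (ρ : A →+* B) (v : Fin 2 → B) (i : Fin 2) (h : IsUnit (v i)) (g : B →+* B')
    (h' : IsUnit ((g ∘ v) i)) :
    Spec.map (CommRingCat.ofHom g) ≫ point ρ v i h = point (g.comp ρ) (g ∘ v) i h' := by
  rw [point, point, ← Spec.map_comp_assoc, ← CommRingCat.ofHom_comp, comp_awayEval]

lemma point_str (ρ : A →+* B) (v : Fin 2 → B) (i : Fin 2) (h : IsUnit (v i)) :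
    point ρ v i h ≫ P1.str A = Spec.map (CommRingCat.ofHom ρ) := by
  rw [point, P1.str, Category.assoc, Proj.awayι_toSpecZero_assoc, ← Spec.map_comp, ← Spec.map_comp,
    ← CommRingCat.ofHom_comp, ← CommRingCat.ofHom_comp]
  congr 2
  ext a
  have := awayEval_mul_pow ρ v (MvPolynomial.X i) (isUnit_eval₂_X h)
    (fromZeroRingHom _ _ (algebraMap A (MvPolynomial.homogeneousSubmodule (Fin 2) A 0) a)) 0
    (MvPolynomial.C a) (by rw [pow_zero, mul_one]; rfl)
  simpa using this

lemma awayEval_mk (ρ : A →+* B) (v : Fin 2 → B) (i : Fin 2) (h : IsUnit (v i)) (n : ℕ)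
    (a : MvPolynomial (Fin 2) A) (ha : a ∈ MvPolynomial.homogeneousSubmodule (Fin 2) A (n • 1)) :
    awayEval ρ v (MvPolynomial.X i) (isUnit_eval₂_X h) (Away.mk _ (homogeneousX i) n a ha) *
      v i ^ n = a.eval₂ ρ v := by
  have := awayEval_mul_pow ρ v (MvPolynomial.X i) (isUnit_eval₂_X h)
    (Away.mk _ (homogeneousX i) n a ha) n a (mk_mul_algebraMap_pow _ _ _ _)
  rwa [MvPolynomial.eval₂_X] at this

lemma awayEval_comp_awayMap (ρ : A →+* B) (v : Fin 2 → B) (i j : Fin 2)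
    (hi : IsUnit (v i)) (hj : IsUnit (v j)) {x : MvPolynomial (Fin 2) A}
    (hx : x = MvPolynomial.X i * MvPolynomial.X j) (hx' : IsUnit (MvPolynomial.eval₂Hom ρ v x)) :
    (awayEval ρ v x hx').comp
      (awayMap (MvPolynomial.homogeneousSubmodule (Fin 2) A) (homogeneousX j) hx) =
      awayEval ρ v (MvPolynomial.X i) (isUnit_eval₂_X hi) := by
  refine RingHom.ext fun z => ?_
  obtain ⟨n, a, ha, rfl⟩ := Away.mk_surjective _ (homogeneousX i) z
  have h1 := awayEval_mk ρ v i hi n a ha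
  have h2 := awayEval_mul_pow ρ v x hx'
    (awayMap _ (homogeneousX j) hx (Away.mk _ (homogeneousX i) n a ha)) n
    (a * MvPolynomial.X j ^ n) (by
      rw [Away.mk, val_awayMap_mk]
      exact mk_mul_algebraMap_pow _ _ _ _)
  rw [RingHom.comp_apply]
  have hxe : x.eval₂ ρ v = v i * v j := by rw [hx]; simp
  rw [MvPolynomial.eval₂_mul, MvPolynomial.eval₂_pow, ← h1, MvPolynomial.eval₂_X, hxe] at h2
  refine ((hi.mul hj).pow n).mul_right_cancel (h2.trans ?_)
  ring

/-- The point with given homogeneous coordinates does not depend on the chart used. -/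
lemma point_eq_point (ρ : A →+* B) (v : Fin 2 → B) (i j : Fin 2)
    (hi : IsUnit (v i)) (hj : IsUnit (v j)) : point ρ v i hi = point ρ v j hj := by
  have hij : IsUnit (MvPolynomial.eval₂Hom ρ v (MvPolynomial.X i * MvPolynomial.X j :
      MvPolynomial (Fin 2) A)) := by simpa using ⟨hi, hj⟩
  rw [point, point, ← awayEval_comp_awayMap ρ v i j hi hj rfl hij,
    ← awayEval_comp_awayMap ρ v j i hj hi (mul_comm _ _) hij,
    CommRingCat.ofHom_comp, CommRingCat.ofHom_comp, Spec.map_comp_assoc, Spec.map_comp_assoc,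
    Proj.SpecMap_awayMap_awayι, Proj.SpecMap_awayMap_awayι]

lemma eval₂_smul_of_isHomogeneous (ρ : A →+* B) (v : Fin 2 → B) (c : B) {n : ℕ}
    {a : MvPolynomial (Fin 2) A} (ha : a.IsHomogeneous n) :
    a.eval₂ ρ (c • v) = c ^ n * a.eval₂ ρ v := by
  rw [← homogenize_eq_of_isHomogeneous ha rfl]
  exact formEval_smul ρ n _ c v

lemma point_smul (ρ : A →+* B) (v : Fin 2 → B) (c : B) (i : Fin 2)
    (h : IsUnit (v i)) (h' : IsUnit ((c • v) i)) :
    point ρ (c • v) i h' = point ρ v i h := by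
  rw [point, point]
  congr 3
  ext z
  obtain ⟨n, a, ha, rfl⟩ := Away.mk_surjective _ (homogeneousX i) z
  have h1 := awayEval_mk ρ v i h n a ha
  have h2 := awayEval_mk ρ (c • v) i h' n a ha
  rw [eval₂_smul_of_isHomogeneous ρ v c (n := n) (a := a) (by simpa using ha), ← h1] at h2
  refine (h'.pow n).mul_right_cancel (h2.trans ?_)
  simp only [Pi.smul_apply, smul_eq_mul, mul_pow]
  ring

/-- The `B`-point `m` of `ℙ¹_A` lies over `ρ` and has homogeneous coordinates `v`, one of which is
a unit. -/
def HasCoords (ρ : A →+* B) (m : Spec (.of B) ⟶ P1 A) (v : Fin 2 → B) : Prop :=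
  ∃ (i : Fin 2) (h : IsUnit (v i)), m = point ρ v i h

lemma HasCoords.str {ρ : A →+* B} {m : Spec (.of B) ⟶ P1 A} {v : Fin 2 → B}
    (h : HasCoords ρ m v) : m ≫ P1.str A = Spec.map (CommRingCat.ofHom ρ) := by
  obtain ⟨i, hi, rfl⟩ := h
  exact point_str ρ v i hi

lemma HasCoords.specMap {ρ : A →+* B} {m : Spec (.of B) ⟶ P1 A} {v : Fin 2 → B}
    (h : HasCoords ρ m v) (g : B →+* B') :
    HasCoords (g.comp ρ) (Spec.map (CommRingCat.ofHom g) ≫ m) (g ∘ v) := by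
  obtain ⟨i, hi, rfl⟩ := h
  exact ⟨i, hi.map g, specMap_point ρ v i hi g _⟩

lemma HasCoords.eq_point {ρ : A →+* B} {m : Spec (.of B) ⟶ P1 A} {v : Fin 2 → B}
    (h : HasCoords ρ m v) (i : Fin 2) (hi : IsUnit (v i)) : m = point ρ v i hi := by
  obtain ⟨j, hj, rfl⟩ := h
  exact point_eq_point ρ v j i hj hi

lemma HasCoords.smul {ρ : A →+* B} {m : Spec (.of B) ⟶ P1 A} {v : Fin 2 → B}
    (h : HasCoords ρ m v) {c : B} (hc : IsUnit c) : HasCoords ρ m (c • v) := by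
  obtain ⟨i, hi, rfl⟩ := h
  exact ⟨i, hc.mul hi, (point_smul ρ v c i hi _).symm⟩

lemma isUnit_of_isUnit_of_proportional {v w : Fin 2 → B} {i j : Fin 2}
    (hvw : v 0 * w 1 = v 1 * w 0) (hi : IsUnit (v i)) (hj : IsUnit (w j)) : IsUnit (w i) := by
  by_cases hij : i = j
  · rwa [hij]
  · have : IsUnit (v i * w j) := hi.mul hj
    have h2 : v i * w j = v j * w i := by
      fin_cases i <;> fin_cases j <;> simp_all
    rw [h2] at this
    exact isUnit_of_mul_isUnit_right this

lemma eq_smul_of_proportional {v w : Fin 2 → B} {i : Fin 2}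
    (hvw : v 0 * w 1 = v 1 * w 0) (hi : IsUnit (v i)) :
    w = (w i * (hi.unit⁻¹ : Bˣ)) • v := by
  have h : ∀ j, w i * v j = w j * v i := by
    intro j
    fin_cases i <;> fin_cases j <;> simp_all [mul_comm]
  ext j
  rw [Pi.smul_apply, smul_eq_mul, mul_right_comm, h, mul_assoc, IsUnit.mul_val_inv, mul_one]

/-- Points with proportional homogeneous coordinates are equal. -/
lemma HasCoords.eq_of_proportional {ρ : A →+* B} {m m' : Spec (.of B) ⟶ P1 A} {v w : Fin 2 → B}
    (h : HasCoords ρ m v) (h' : HasCoords ρ m' w) (hvw : v 0 * w 1 = v 1 * w 0) : m = m' := by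
  obtain ⟨i, hi, rfl⟩ := h
  obtain ⟨j, hj, hj'⟩ := id h'
  have hwi := isUnit_of_isUnit_of_proportional hvw hi hj
  rw [h'.eq_point i hwi]
  have hw := eq_smul_of_proportional hvw hi
  generalize w i * (hi.unit⁻¹ : Bˣ) = c at hw
  subst hw
  exact (point_smul ρ v c i hi _).symm

lemma awayEval_isLocalizationElem (ρ : A →+* B) (v : Fin 2 → B) (i j : Fin 2) (h : IsUnit (v i)) :
    awayEval ρ v (MvPolynomial.X i) (isUnit_eval₂_X h)
      (Away.isLocalizationElem (𝒜 := MvPolynomial.homogeneousSubmodule (Fin 2) A)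
        (homogeneousX i) (homogeneousX j)) * v i = v j := by
  have := awayEval_mk ρ v i h 1 (MvPolynomial.X j ^ 1) (by
    simpa using MvPolynomial.isHomogeneous_X A j)
  rw [MvPolynomial.eval₂_pow, MvPolynomial.eval₂_X, pow_one (v i), pow_one (v j)] at this
  exact this

lemma point_eq_imp_isUnit {ρ ρ' : A →+* B} {v w : Fin 2 → B} {i j : Fin 2} (hi : IsUnit (v i))
    (hj : IsUnit (w j)) (h : point ρ v i hi = point ρ' w j hj) : IsUnit (w i) := by
  have h1 : (point ρ' w j hj) ⁻¹ᵁ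
      (Proj.basicOpen (MvPolynomial.homogeneousSubmodule (Fin 2) A) (MvPolynomial.X i)) = ⊤ := by
    rw [← h, ← Proj.opensRange_awayι _ _ (homogeneousX i) one_pos]
    ext x
    simp only [TopologicalSpace.Opens.map_coe, Scheme.Hom.coe_opensRange, Set.mem_preimage,
      TopologicalSpace.Opens.coe_top, Set.mem_univ, iff_true]
    exact ⟨_, rfl⟩
  rw [point, Scheme.Hom.comp_preimage,
    Proj.awayι_preimage_basicOpen _ (homogeneousX j) one_pos (homogeneousX i) one_pos] at h1
  have h3 : IsUnit (awayEval ρ' w (MvPolynomial.X j) (isUnit_eval₂_X hj)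
    (Away.isLocalizationElem (𝒜 := MvPolynomial.homogeneousSubmodule (Fin 2) A)
      (homogeneousX j) (homogeneousX i))) := by
    by_contra hne
    obtain ⟨M, hM, hmem⟩ := exists_max_ideal_of_mem_nonunits hne
    have : (⟨M, hM.isPrime⟩ : PrimeSpectrum B) ∈ (⊤ : (Spec (.of B)).Opens) := trivial
    rw [← h1] at this
    exact this hmem
  rw [← awayEval_isLocalizationElem ρ' w j i hj]
  exact h3.mul hj

/-- Homogeneous coordinates of a point are unique up to proportionality. -/
lemma HasCoords.proportional {ρ ρ' : A →+* B} {m : Spec (.of B) ⟶ P1 A} {v w : Fin 2 → B}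
    (h : HasCoords ρ m v) (h' : HasCoords ρ' m w) : v 0 * w 1 = v 1 * w 0 := by
  obtain ⟨i, hi, rfl⟩ := h
  obtain ⟨j, hj, hj'⟩ := id h'
  have hwi := point_eq_imp_isUnit hi hj hj'
  have h1 := h'.eq_point i hwi
  rw [point, point, cancel_mono] at h1
  have h2 := CommRingCat.hom_ext_iff.mp (Spec.map_injective h1)
  have h4 : ∀ k, v k * w i = w k * v i := by
    intro k
    rw [← awayEval_isLocalizationElem ρ v i k hi, ← awayEval_isLocalizationElem ρ' w i k hwi]
    have h5 := RingHom.congr_fun h2 (Away.isLocalizationElem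
      (𝒜 := MvPolynomial.homogeneousSubmodule (Fin 2) A) (homogeneousX i) (homogeneousX k))
    simp only [CommRingCat.hom_ofHom] at h5
    rw [h5]
    ring
  have h6 : ∀ i : Fin 2, (∀ k, v k * w i = w k * v i) → v 0 * w 1 = v 1 * w 0 := by
    intro i h
    fin_cases i
    · exact ((h 1).trans (mul_comm _ _)).symm
    · exact (h 0).trans (mul_comm _ _)
  exact h6 i h4

/-- The structure map of the chart ring `A[X₀, X₁]_(Xᵢ)`. -/
noncomputable def awayAlg (A : Type) [CommRing A] (i : Fin 2) :
    A →+* Away (MvPolynomial.homogeneousSubmodule (Fin 2) A) (MvPolynomial.X i) :=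
  (fromZeroRingHom _ _).comp (algebraMap A (MvPolynomial.homogeneousSubmodule (Fin 2) A 0))

/-- The coordinate functions `X₀ / Xᵢ` and `X₁ / Xᵢ`. -/
noncomputable def awayCoord (A : Type) [CommRing A] (i k : Fin 2) :
    Away (MvPolynomial.homogeneousSubmodule (Fin 2) A) (MvPolynomial.X i) :=
  Away.isLocalizationElem (𝒜 := MvPolynomial.homogeneousSubmodule (Fin 2) A)
    (homogeneousX i) (homogeneousX k)

lemma val_awayCoord (i k : Fin 2) :
    (awayCoord A i k).val * algebraMap (MvPolynomial (Fin 2) A)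
      (Localization.Away (MvPolynomial.X i : MvPolynomial (Fin 2) A)) (MvPolynomial.X i) =
      algebraMap (MvPolynomial (Fin 2) A) _ (MvPolynomial.X k) := by
  have := mk_mul_algebraMap_pow (MvPolynomial.X i : MvPolynomial (Fin 2) A) (MvPolynomial.X k ^ 1) 1
    ⟨1, rfl⟩
  rw [pow_one (algebraMap (MvPolynomial (Fin 2) A) (Localization.Away (MvPolynomial.X i)) _),
    pow_one (MvPolynomial.X k)] at this
  rw [← this, awayCoord, Away.isLocalizationElem, Away.val_mk]
  simp only [pow_one]

lemma awayCoord_self (i : Fin 2) : awayCoord A i i = 1 := by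
  refine HomogeneousLocalization.val_injective _ ?_
  have h := val_awayCoord (A := A) i i
  have hu := IsLocalization.Away.algebraMap_isUnit (S := Localization.Away
    (MvPolynomial.X i : MvPolynomial (Fin 2) A)) (MvPolynomial.X i : MvPolynomial (Fin 2) A)
  rw [HomogeneousLocalization.val_one]
  exact hu.mul_right_cancel (by rw [h, one_mul])

lemma mk_eq_eval₂_awayCoord (i : Fin 2) (n : ℕ) (a : MvPolynomial (Fin 2) A)
    (ha : a ∈ MvPolynomial.homogeneousSubmodule (Fin 2) A (n • 1)) :
    Away.mk _ (homogeneousX i) n a ha = a.eval₂ (awayAlg A i) (awayCoord A i) := by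
  refine HomogeneousLocalization.val_injective _ ?_
  have hu := IsLocalization.Away.algebraMap_isUnit (S := Localization.Away
    (MvPolynomial.X i : MvPolynomial (Fin 2) A)) (MvPolynomial.X i : MvPolynomial (Fin 2) A)
  refine (hu.pow n).mul_right_cancel ?_
  rw [Away.val_mk, mk_mul_algebraMap_pow]
  rw [← HomogeneousLocalization.algebraMap_apply,
    MvPolynomial.hom_eval₂, mul_comm,
    ← eval₂_smul_of_isHomogeneous _ _ _ (n := n) (a := a) (by simpa using ha)]
  have h1 : (algebraMap (MvPolynomial (Fin 2) A) (Localization.Away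
      (MvPolynomial.X i : MvPolynomial (Fin 2) A)) (MvPolynomial.X i)) •
      (algebraMap (Away (MvPolynomial.homogeneousSubmodule (Fin 2) A) (MvPolynomial.X i))
        (Localization.Away (MvPolynomial.X i : MvPolynomial (Fin 2) A)) ∘ awayCoord A i) =
      algebraMap (MvPolynomial (Fin 2) A) (Localization.Away
      (MvPolynomial.X i : MvPolynomial (Fin 2) A)) ∘ MvPolynomial.X := by
    ext k
    simp only [Pi.smul_apply, Function.comp_apply, smul_eq_mul]
    rw [mul_comm]
    exact val_awayCoord i k
  have h2 : (algebraMap (Away (MvPolynomial.homogeneousSubmodule (Fin 2) A) (MvPolynomial.X i))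
        (Localization.Away (MvPolynomial.X i : MvPolynomial (Fin 2) A))).comp (awayAlg A i) =
      (algebraMap (MvPolynomial (Fin 2) A) (Localization.Away
      (MvPolynomial.X i : MvPolynomial (Fin 2) A))).comp MvPolynomial.C := by
    ext x
    rfl
  refine Eq.trans ?_ (congrArg₂ (fun r w => MvPolynomial.eval₂ r w a) h2 h1).symm
  have := MvPolynomial.hom_eval₂ a (MvPolynomial.C) (algebraMap (MvPolynomial (Fin 2) A)
    (Localization.Away (MvPolynomial.X i : MvPolynomial (Fin 2) A))) MvPolynomial.X
  rw [MvPolynomial.eval₂_eta] at this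
  exact this

lemma eq_awayEval {i : Fin 2}
    (g : Away (MvPolynomial.homogeneousSubmodule (Fin 2) A) (MvPolynomial.X i) →+* B)
    (h : IsUnit ((g ∘ awayCoord A i) i)) :
    g = awayEval (g.comp (awayAlg A i)) (g ∘ awayCoord A i) (MvPolynomial.X i)
      (isUnit_eval₂_X h) := by
  refine RingHom.ext fun z => ?_
  obtain ⟨n, a, ha, rfl⟩ := Away.mk_surjective _ (homogeneousX i) z
  have h1 := awayEval_mk (g.comp (awayAlg A i)) (g ∘ awayCoord A i) i h n a ha
  refine (h.pow n).mul_right_cancel ?_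
  rw [h1, mk_eq_eval₂_awayCoord, MvPolynomial.hom_eval₂, Function.comp_apply, awayCoord_self,
    map_one, one_pow, mul_one]
  rfl

lemma comp_awayCoord_isUnit {i : Fin 2}
    (g : Away (MvPolynomial.homogeneousSubmodule (Fin 2) A) (MvPolynomial.X i) →+* B) :
    IsUnit ((g ∘ awayCoord A i) i) := by
  simp [awayCoord_self]

/-- A point of `ℙ¹_A` over a local ring has homogeneous coordinates. -/
lemma exists_hasCoords [IsLocalRing B] (ρ : A →+* B) (m : Spec (.of B) ⟶ P1 A)
    (hm : m ≫ P1.str A = Spec.map (CommRingCat.ofHom ρ)) : ∃ v, HasCoords ρ m v := by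
  -- the closed point lies in a standard chart, and then so does all of `Spec B`
  have hcov : ∃ i, m (IsLocalRing.closedPoint B) ∈
      Proj.basicOpen (MvPolynomial.homogeneousSubmodule (Fin 2) A) (MvPolynomial.X i) := by
    have h := Proj.iSup_basicOpen_eq_top' (MvPolynomial.homogeneousSubmodule (Fin 2) A)
      (fun i : Fin 2 => MvPolynomial.X i) (fun i => ⟨1, homogeneousX i⟩) ?_
    · have h' : m (IsLocalRing.closedPoint B) ∈ (⊤ : (P1 A).Opens) := trivial
      rw [← h] at h'
      simpa using h'
    · rw [← top_le_iff]
      intro f _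
      have hf : f ∈ Algebra.adjoin A
          (Set.range (MvPolynomial.X : Fin 2 → MvPolynomial (Fin 2) A)) := by
        rw [MvPolynomial.adjoin_range_X]; trivial
      induction hf using Algebra.adjoin_induction with
      | mem x hx => exact Algebra.subset_adjoin hx
      | algebraMap r =>
        exact Subalgebra.algebraMap_mem (Algebra.adjoin _ _)
          (algebraMap A (MvPolynomial.homogeneousSubmodule (Fin 2) A 0) r)
      | add x y _ _ hx hy => exact Subalgebra.add_mem _ (hx trivial) (hy trivial)
      | mul x y _ _ hx hy => exact Subalgebra.mul_mem _ (hx trivial) (hy trivial)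
  obtain ⟨i, hi⟩ := hcov
  rw [← Proj.opensRange_awayι _ _ (homogeneousX i) one_pos] at hi
  have h1 := Scheme.preimage_eq_top_of_closedPoint_mem m hi
  have h2 : Set.range m ⊆ Set.range (standardι A i) := by
    rintro _ ⟨x, rfl⟩
    have : x ∈ (⊤ : (Spec (.of B)).Opens) := trivial
    rw [← h1] at this
    exact this
  obtain ⟨g, hg⟩ := Spec.map_surjective (IsOpenImmersion.lift (standardι A i) m h2)
  have h3 : m = point (g.hom.comp (awayAlg A i)) (g.hom ∘ awayCoord A i) i
      (comp_awayCoord_isUnit g.hom) := by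
    rw [point, ← eq_awayEval g.hom (comp_awayCoord_isUnit g.hom), CommRingCat.ofHom_hom, hg,
      IsOpenImmersion.lift_fac]
  have h4 : g.hom.comp (awayAlg A i) = ρ := by
    have := hm
    rw [h3, point_str] at this
    exact CommRingCat.hom_ext_iff.mp (Spec.map_injective this)
  rw [h4] at h3
  exact ⟨_, i, _, h3⟩

/-- The affine coordinates on the chart `Xᵢ ≠ 0`: the `i`-th one is `1`, the other one is the
variable `T` of `A[T]`. -/
noncomputable def chartCoord (A : Type) [CommRing A] (i k : Fin 2) : A[X] :=
  if k = i then 1 else X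

lemma chartCoord_self (i : Fin 2) : chartCoord A i i = 1 := if_pos rfl

lemma isUnit_chartCoord (i : Fin 2) : IsUnit (chartCoord A i i) := by
  rw [chartCoord_self]; exact isUnit_one

/-- The chart `Spec A[T] ⟶ ℙ¹_A` onto the locus `Xᵢ ≠ 0`. -/
noncomputable def chart (A : Type) [CommRing A] (i : Fin 2) : Spec (.of A[X]) ⟶ P1 A :=
  point C (chartCoord A i) i (isUnit_chartCoord i)

lemma bijective_awayEval_chartCoord (i : Fin 2) :
    Function.Bijective (awayEval C (chartCoord A i) (MvPolynomial.X i)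
      (isUnit_eval₂_X (isUnit_chartCoord i))) := by
  let e := awayEval C (chartCoord A i) (MvPolynomial.X i)
      (isUnit_eval₂_X (isUnit_chartCoord i))
  let e' : A[X] →+* Away (MvPolynomial.homogeneousSubmodule (Fin 2) A) (MvPolynomial.X i) :=
    eval₂RingHom (awayAlg A i) (awayCoord A i (1 - i))
  have hcoord : ∀ k, e (awayCoord A i k) = chartCoord A i k := by
    intro k
    have := awayEval_isLocalizationElem C (chartCoord A i) i k (isUnit_chartCoord i)
    rwa [chartCoord_self, mul_one] at this
  have hcoord' : ∀ k, e' (chartCoord A i k) = awayCoord A i k := by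
    intro k
    by_cases hk : k = i
    · subst hk
      rw [chartCoord_self, awayCoord_self, map_one]
    · have : 1 - i = k := one_sub_eq_of_ne hk
      rw [chartCoord, if_neg hk]
      simp [e', this]
  have halg : ∀ a, e (awayAlg A i a) = C a := by
    intro a
    have := awayEval_mul_pow C (chartCoord A i) (MvPolynomial.X i)
      (isUnit_eval₂_X (isUnit_chartCoord i)) (awayAlg A i a) 0 (MvPolynomial.C a)
      (by rw [pow_zero, mul_one]; rfl)
    simpa using this
  have h1 : e'.comp e = RingHom.id _ := by
    have hu : IsUnit (((e'.comp e) ∘ awayCoord A i) i) := comp_awayCoord_isUnit _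
    have hu' := comp_awayCoord_isUnit (RingHom.id (Away (MvPolynomial.homogeneousSubmodule
      (Fin 2) A) (MvPolynomial.X i)))
    rw [eq_awayEval (e'.comp e) hu, eq_awayEval (RingHom.id _) hu']
    congr 1
    · ext a
      simp [halg, e']
    · ext k
      simp [hcoord, hcoord']
  have h2 : e.comp e' = RingHom.id _ := by
    refine Polynomial.ringHom_ext (fun a => ?_) ?_
    · simp [e', halg]
    · have hk : ¬ (1 - i = i) := one_sub_ne i
      simp [e', hcoord, chartCoord, hk]
  exact Function.bijective_iff_has_inverse.mpr ⟨e', fun x => RingHom.congr_fun h1 x,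
    fun x => RingHom.congr_fun h2 x⟩

instance (i : Fin 2) : IsOpenImmersion (chart A i) := by
  have : IsIso (CommRingCat.ofHom (awayEval C (chartCoord A i) (MvPolynomial.X i)
      (isUnit_eval₂_X (isUnit_chartCoord i)))) := by
    rw [ConcreteCategory.isIso_iff_bijective]
    exact bijective_awayEval_chartCoord i
  rw [chart, point]
  infer_instance

lemma point_eq_specMap_chart (ρ : A →+* B) (v : Fin 2 → B) (i j : Fin 2) (hij : j ≠ i)
    (hv : v i = 1) (h : IsUnit (v i)) :
    point ρ v i h = Spec.map (CommRingCat.ofHom (eval₂RingHom ρ (v j))) ≫ chart A i := by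
  have h1 : v = eval₂RingHom ρ (v j) ∘ chartCoord A i := by
    ext k
    by_cases hk : k = i
    · subst hk
      simp [chartCoord_self, hv]
    · have : k = j := eq_of_ne_of_ne hij hk
      subst this
      simp [chartCoord, hk]
  have h2 : ρ = (eval₂RingHom ρ (v j)).comp C := by ext; simp
  rw [chart, specMap_point]
  · congr 1
  · rw [← h1]; exact h

end Points

/-! ### Coordinates over the stalks of an open subscheme of `ℙ¹` -/

lemma eq_zero_or_eq_one (k : Fin 2) : k = 0 ∨ k = 1 := by decide +revert

section LocalizationMaps

/-- `g` exhibits `O` as a localization of `R`, at the elements that `g` makes invertible. -/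
def IsLocalizationMap {R O : Type*} [CommRing R] [CommRing O] (g : R →+* O) : Prop :=
  (∀ w, ∃ α β, IsUnit (g β) ∧ w * g β = g α) ∧ (∀ α, g α = 0 → ∃ β, IsUnit (g β) ∧ β * α = 0)

lemma IsLocalizationMap.injective {R O : Type*} [CommRing R] [CommRing O] [IsDomain R]
    [Nontrivial O] {g : R →+* O} (hg : IsLocalizationMap g) : Function.Injective g := by
  rw [injective_iff_map_eq_zero]
  intro α hα
  obtain ⟨β, hβ, h⟩ := hg.2 α hα
  rcases mul_eq_zero.mp h with rfl | h
  · exact absurd hβ (by simp)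
  · exact h

/-- A local morphism of open subschemes, seen on a stalk: if the canonical morphism from the
spectrum of the stalk at `x` is given by `g` in an affine chart, then `g` is a localization. -/
lemma isLocalizationMap_of_fromSpecStalk {X Y : Scheme.{0}} {R : CommRingCat.{0}} (j : Y ⟶ X)
    [IsOpenImmersion j] (c : Spec R ⟶ X) [IsOpenImmersion c] (x : Y)
    (g : R ⟶ Y.presheaf.stalk x) (h : Y.fromSpecStalk x ≫ j = Spec.map g ≫ c) :
    IsLocalizationMap g.hom := by
  -- the map induced by `Spec.map g` on the stalks at the closed point is an isomorphism
  have h1 : IsIso (Scheme.stalkClosedPointTo (Spec.map g ≫ c)) := by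
    rw [← h, Scheme.stalkClosedPointTo_comp, Scheme.stalkClosedPointTo_fromSpecStalk]
    have hj : ∀ y, IsIso (j.stalkMap y) := fun y => inferInstance
    exact IsIso.comp_isIso' (hj _) (Iso.isIso_hom _)
  rw [Scheme.stalkClosedPointTo_comp] at h1
  have h2 : IsIso (Scheme.stalkClosedPointTo (Spec.map g)) :=
    @IsIso.of_isIso_comp_left _ _ _ _ _
      (c.stalkMap (Spec.map g (IsLocalRing.closedPoint (Y.presheaf.stalk x)))) _ inferInstance h1
  have h3 := Scheme.germ_stalkClosedPointTo_Spec g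
  rw [← Iso.inv_comp_eq] at h3
  let q : PrimeSpectrum R := Spec.map g (IsLocalRing.closedPoint (Y.presheaf.stalk x))
  let e : (Spec R).presheaf.stalk q →+* Y.presheaf.stalk x :=
    (Scheme.stalkClosedPointTo (Spec.map g)).hom
  have he : Function.Bijective e := ConcreteCategory.bijective_of_isIso
    (Scheme.stalkClosedPointTo (Spec.map g))
  let _ : Algebra R ((Spec R).presheaf.stalk q) :=
    ((Scheme.ΓSpecIso R).inv ≫ (Spec R).presheaf.germ ⊤ q trivial).hom.toAlgebra
  have hloc : IsLocalization.AtPrime ((Spec R).presheaf.stalk q) q.asIdeal :=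
    inferInstanceAs (IsLocalization.AtPrime ((Spec.structureSheaf R).presheaf.stalk q) q.asIdeal)
  have hg : ∀ r, g.hom r = e (algebraMap R ((Spec R).presheaf.stalk q) r) := by
    intro r
    exact (RingHom.congr_fun (CommRingCat.hom_ext_iff.mp h3) r).symm
  refine ⟨fun w => ?_, fun α hα => ?_⟩
  · obtain ⟨z, rfl⟩ := he.2 w
    obtain ⟨⟨α, β⟩, h⟩ := IsLocalization.surj q.asIdeal.primeCompl z
    refine ⟨α, β, ?_, ?_⟩
    · rw [hg]
      exact (IsLocalization.map_units _ β).map e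
    · rw [hg, hg, ← h, map_mul]
  · rw [hg, map_eq_zero_iff e he.1, IsLocalization.map_eq_zero_iff q.asIdeal.primeCompl] at hα
    obtain ⟨β, hβ⟩ := hα
    refine ⟨β, ?_, hβ⟩
    rw [hg]
    exact (IsLocalization.map_units _ β).map e

end LocalizationMaps

section Reversal

variable {A : Type} [CommRing A]

lemma formEval_chartCoord_one {n : ℕ} {F : A[X]} (hF : F.natDegree ≤ n) :
    formEval C n F (chartCoord A 1) = F := by
  rw [formEval_of_eq_one C hF (chartCoord_self 1)]
  simp [chartCoord]

lemma formEval_chartCoord_zero {n : ℕ} {F : A[X]} (hF : F.natDegree ≤ n) :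
    formEval C n F (chartCoord A 0) = F.reflect n := by
  apply Polynomial.induction_with_natDegree_le
    (fun F => formEval C n F (chartCoord A 0) = F.reflect n) n
  · simp [formEval]
  · intro k r _ hk
    simp [formEval, hk, chartCoord, revAt_le hk]
  · intro f g _ _ hf hg
    rw [formEval_add, hf, hg, reflect_add]
  · exact hF

/-- Coprime polynomials stay coprime after homogenization and dehomogenization at infinity,
provided the degree used is attained. -/
lemma isRelPrime_reflect [IsDomain A] {n : ℕ} {F G : A[X]} (hF : F.natDegree ≤ n)
    (hG : G.natDegree ≤ n) (hn : F.coeff n ≠ 0 ∨ G.coeff n ≠ 0) (h : IsRelPrime F G) :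
    IsRelPrime (F.reflect n) (G.reflect n) := by
  intro q hqF hqG
  -- the variable does not divide both reversed polynomials, as the degree `n` is attained
  have hq0 : q.coeff 0 ≠ 0 := by
    intro h0
    have hX : (X : A[X]) ∣ q := X_dvd_iff.mpr h0
    have key : ∀ F : A[X], F.natDegree ≤ n → q ∣ F.reflect n → F.coeff n = 0 := by
      intro F hF hq
      have := X_dvd_iff.mp (hX.trans hq)
      rwa [coeff_reflect, revAt_le (Nat.zero_le n), Nat.sub_zero] at this
    rcases hn with hn | hn
    · exact hn (key F hF hqF)
    · exact hn (key G hG hqG)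
  have key : ∀ F : A[X], F.natDegree ≤ n → q ∣ F.reflect n → q.reverse ∣ F := by
    intro F hF ⟨r, hr⟩
    by_cases hF0 : F = 0
    · rw [hF0]; exact dvd_zero _
    have hqr : q * r ≠ 0 := by
      rw [← hr]
      simpa using hF0
    have hd : q.natDegree + r.natDegree ≤ n := by
      rw [← natDegree_mul (left_ne_zero_of_mul hqr) (right_ne_zero_of_mul hqr), ← hr]
      refine natDegree_le_iff_coeff_eq_zero.mpr fun m hm => ?_
      rw [coeff_reflect, revAt_eq_self_of_lt hm]
      exact coeff_eq_zero_of_natDegree_lt (hF.trans_lt hm)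
    have h2 : F = (q * r).reflect (q.natDegree + (n - q.natDegree)) := by
      rw [← hr, Nat.add_sub_cancel' ((Nat.le_add_right _ _).trans hd), reflect_reflect]
    rw [h2, reflect_mul q r le_rfl (by omega)]
    exact Dvd.intro _ rfl
  have hu := h (key F hF hqF) (key G hG hqG)
  have hdeg := natDegree_eq_zero_of_isUnit hu
  have ht : q.natTrailingDegree = 0 := natTrailingDegree_eq_zero.mpr (Or.inr hq0)
  have hqd : q.natDegree = 0 := by
    have := reverse_natDegree q
    omega
  rw [eq_C_of_natDegree_eq_zero hqd] at hu ⊢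
  simpa using hu

lemma isRelPrime_formEval_chartCoord [IsDomain A] {n : ℕ} {F G : A[X]} (hF : F.natDegree ≤ n)
    (hG : G.natDegree ≤ n) (hn : F.coeff n ≠ 0 ∨ G.coeff n ≠ 0) (h : IsRelPrime F G) (i : Fin 2) :
    IsRelPrime (formEval C n F (chartCoord A i)) (formEval C n G (chartCoord A i)) := by
  fin_cases i
  · simp only [Fin.zero_eta]
    rw [formEval_chartCoord_zero hF, formEval_chartCoord_zero hG]
    exact isRelPrime_reflect hF hG hn h
  · simp only [Fin.mk_one]
    rwa [formEval_chartCoord_one hF, formEval_chartCoord_one hG]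

end Reversal

section LocalCoordinates

/-- If the fraction `G / F` in lowest terms lies in a localization, then `F` is a unit there. -/
lemma isUnit_of_isRelPrime {R O : Type*} [CommRing R] [IsDomain R] [UniqueFactorizationMonoid R]
    [CommRing O] [Nontrivial O] {g : R →+* O} (hg : IsLocalizationMap g) {F G : R}
    (hFG : IsRelPrime F G) {w : O} (h : w * g F = g G) : IsUnit (g F) := by
  obtain ⟨α, β, hβ, hw⟩ := hg.1 w
  have h1 : α * F = G * β := by
    apply hg.injective
    rw [map_mul, map_mul, ← hw, ← h]
    ring
  have h2 : F ∣ β := hFG.dvd_of_dvd_mul_left (Dvd.intro_left α h1)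
  exact isUnit_of_dvd_unit (map_dvd g h2) hβ

variable {A : Type} [CommRing A]

/-- The coordinates can be scaled so that the `i`-th one is `1`; the other one is then the value of
the affine coordinate of the chart `Xᵢ ≠ 0`. -/
lemma HasCoords.exists_normalized {B : Type} [CommRing B] {ρ : A →+* B}
    {m : Spec (.of B) ⟶ P1 A} {u : Fin 2 → B} (h : HasCoords ρ m u) :
    ∃ (i : Fin 2) (c : B) (u' : Fin 2 → B), IsUnit c ∧ u = c • u' ∧ u' i = 1 ∧
      HasCoords ρ m u' ∧
      m = Spec.map (CommRingCat.ofHom (eval₂RingHom ρ (u' (1 - i)))) ≫ chart A i ∧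
      u' = eval₂RingHom ρ (u' (1 - i)) ∘ chartCoord A i := by
  obtain ⟨i, hi, rfl⟩ := id h
  obtain ⟨c, hc⟩ := hi
  have h1 : ((↑c⁻¹ : B) • u) i = 1 := by simp [← hc]
  have h2 := h.smul (c⁻¹).isUnit
  refine ⟨i, c, (↑c⁻¹ : B) • u, c.isUnit, ?_, h1, h2, ?_, ?_⟩
  · rw [smul_smul]; simp
  · rw [h2.eq_point i (by rw [h1]; exact isUnit_one)]
    exact point_eq_specMap_chart ρ _ i (1 - i) (one_sub_ne i) h1 _
  · ext k
    by_cases hk : k = i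
    · subst hk
      rw [h1, Function.comp_apply, chartCoord_self, map_one]
    · have hk' := one_sub_eq_of_ne hk
      simp [chartCoord, hk, hk']

/-- Let `u` be coordinates of the spectrum of a stalk of an open subscheme of `ℙ¹_A`, and let `m` be
a point with values in this stalk whose coordinates `v` are proportional to `(F(u), G(u))` for
coprime forms `F`, `G`. Then
`F(u)` or `G(u)` is a unit, so that they are coordinates of `m`: if `v₀`, say, is a unit, then `F`
divides the denominator of `v₁ / v₀ = G(u) / F(u)`. -/
lemma hasCoords_formEval_of_stalk [IsDomain A] [UniqueFactorizationMonoid A] {Y : Scheme.{0}}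
    (j : Y ⟶ P1 A) [IsOpenImmersion j] (x : Y)
    {ρ : A →+* Y.presheaf.stalk x} {u v : Fin 2 → Y.presheaf.stalk x}
    (hu : HasCoords ρ (Y.fromSpecStalk x ≫ j) u)
    {m : Spec (Y.presheaf.stalk x) ⟶ P1 A} (hv : HasCoords ρ m v)
    {n : ℕ} {F G : A[X]} (hF : F.natDegree ≤ n)
    (hG : G.natDegree ≤ n) (hn : F.coeff n ≠ 0 ∨ G.coeff n ≠ 0) (hFG : IsRelPrime F G)
    (h : v 0 * formEval ρ n G u = v 1 * formEval ρ n F u) :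
    HasCoords ρ m ![formEval ρ n F u, formEval ρ n G u] := by
  obtain ⟨i, c, u', hc, rfl, hu', -, hchart, hcomp⟩ := hu.exists_normalized
  have hloc : IsLocalizationMap (eval₂RingHom ρ (u' (1 - i))) :=
    isLocalizationMap_of_fromSpecStalk j (chart A i) x _ hchart
  set g := eval₂RingHom ρ (u' (1 - i)) with hg
  have hgC : g.comp C = ρ := by ext; simp [g]
  have hform : ∀ F : A[X], formEval ρ n F u' = g (formEval C n F (chartCoord A i)) := by
    intro F
    rw [map_formEval, hgC, ← hcomp]
  rw [formEval_smul, formEval_smul] at h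
  have h' : v 0 * formEval ρ n G u' = v 1 * formEval ρ n F u' := by
    refine (hc.pow n).mul_right_cancel ?_
    linear_combination h
  have hcop := isRelPrime_formEval_chartCoord hF hG hn hFG i
  suffices hs : HasCoords ρ m ![formEval ρ n F u', formEval ρ n G u'] by
    have := hs.smul (hc.pow n)
    rw [formEval_smul, formEval_smul]
    convert this using 1
    ext k
    fin_cases k <;> simp
  have hprop : v 0 * (![formEval ρ n F u', formEval ρ n G u'] : Fin 2 → _) 1 =
      v 1 * (![formEval ρ n F u', formEval ρ n G u'] : Fin 2 → _) 0 := by simpa using h'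
  have hunit : ∃ k, IsUnit ((![formEval ρ n F u', formEval ρ n G u'] : Fin 2 → _) k) := by
    obtain ⟨k, hk, -⟩ := hv
    have h0 : k = 0 ∨ k = 1 := eq_zero_or_eq_one k
    rcases h0 with rfl | rfl
    · refine ⟨0, ?_⟩
      simp only [Matrix.cons_val_zero]
      rw [hform]
      refine isUnit_of_isRelPrime hloc hcop (w := ↑hk.unit⁻¹ * v 1) ?_
      rw [← hform, ← hform, mul_assoc, ← h', ← mul_assoc, IsUnit.val_inv_mul, one_mul]
    · refine ⟨1, ?_⟩
      simp only [Matrix.cons_val_one]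
      rw [hform]
      refine isUnit_of_isRelPrime hloc hcop.symm (w := ↑hk.unit⁻¹ * v 0) ?_
      rw [← hform, ← hform, mul_assoc, h', ← mul_assoc, IsUnit.val_inv_mul, one_mul]
  obtain ⟨k, hk⟩ := hunit
  have hp : HasCoords ρ (point ρ _ k hk) ![formEval ρ n F u', formEval ρ n G u'] := ⟨k, hk, rfl⟩
  rwa [hv.eq_of_proportional hp hprop]

end LocalCoordinates

/-! ### From the generic point to all points in local rings -/

section GlobalCoordinates

variable {A : Type} [CommRing A]

lemma HasCoords.exists_smul {B : Type} [CommRing B] {ρ ρ' : A →+* B} {m : Spec (.of B) ⟶ P1 A}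
    {v w : Fin 2 → B} (h : HasCoords ρ m v) (h' : HasCoords ρ' m w) : ∃ c : B, w = c • v := by
  have hvw := h.proportional h'
  obtain ⟨i, hi, -⟩ := h
  exact ⟨_, eq_smul_of_proportional hvw hi⟩

/-- If `τ` is transcendental, then so is `τ⁻¹`. -/
lemma injective_eval₂_of_mul_eq_one {K : Type*} [Field K] [IsDomain A] {ρ : A →+* K} {τ τ' : K}
    (h : Function.Injective (eval₂RingHom ρ τ)) (hτ : τ * τ' = 1) :
    Function.Injective (eval₂RingHom ρ τ') := by
  rw [injective_iff_map_eq_zero] at h ⊢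
  intro F hF
  let _ : Invertible τ' := ⟨τ, hτ, by rw [mul_comm]; exact hτ⟩
  have h1 := (eval₂_reverse_eq_zero_iff ρ τ' F).mpr hF
  have h2 := h _ h1
  simpa using h2

/-- A morphism `m` from an open subscheme of `ℙ¹_A` to `ℙ¹_A` that is given by `(F : G)` at the
generic point, with `F` and `G` coprime, is given by `(F : G)` on all points in local rings. -/
theorem hasCoords_of_generic [IsDomain A] [UniqueFactorizationMonoid A] {Y : Scheme.{0}}
    (j : Y ⟶ P1 A) [IsOpenImmersion j] (m : Y ⟶ P1 A) (hm : m ≫ P1.str A = j ≫ P1.str A)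
    (η : Y) (hη : ∀ x, η ⤳ x) {ρη : A →+* Y.residueField η} {τ : Y.residueField η}
    (hu : HasCoords ρη (Y.fromSpecResidueField η ≫ j) ![τ, 1])
    (hinj : Function.Injective (eval₂RingHom ρη τ))
    {v : Fin 2 → Y.residueField η} (hv : HasCoords ρη (Y.fromSpecResidueField η ≫ m) v)
    {n : ℕ} {F G : A[X]} (hF : F.natDegree ≤ n) (hG : G.natDegree ≤ n)
    (hn : F.coeff n ≠ 0 ∨ G.coeff n ≠ 0) (hFG : IsRelPrime F G)
    (h : v 0 * formEval ρη n G ![τ, 1] = v 1 * formEval ρη n F ![τ, 1])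
    {B : Type} [CommRing B] [IsLocalRing B] (a : Spec (.of B) ⟶ Y) {ρ : A →+* B} {u : Fin 2 → B}
    (ha : HasCoords ρ (a ≫ j) u) :
    HasCoords ρ (a ≫ m) ![formEval ρ n F u, formEval ρ n G u] := by
  -- `a` factors through the spectrum of the stalk at the image of the closed point
  let x : Y := a (IsLocalRing.closedPoint B)
  let s : Y.presheaf.stalk x ⟶ CommRingCat.of B := Scheme.stalkClosedPointTo a
  have hs : Spec.map s ≫ Y.fromSpecStalk x = a := Scheme.Spec_stalkClosedPointTo_fromSpecStalk a
  let ρx : A →+* Y.presheaf.stalk x := (Spec.preimage (Y.fromSpecStalk x ≫ j ≫ P1.str A)).hom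
  have hρx : Spec.map (CommRingCat.ofHom ρx) = Y.fromSpecStalk x ≫ j ≫ P1.str A := by
    simp only [ρx, CommRingCat.ofHom_hom, Spec.map_preimage]
  obtain ⟨ux, hux⟩ := exists_hasCoords ρx (Y.fromSpecStalk x ≫ j)
    ((Category.assoc _ _ _).trans hρx.symm)
  obtain ⟨vx, hvx⟩ := exists_hasCoords ρx (Y.fromSpecStalk x ≫ m)
    (by rw [Category.assoc, hm, hρx])
  let g : Y.presheaf.stalk x ⟶ Y.residueField η :=
    Y.presheaf.stalkSpecializes (hη x) ≫ Y.residue η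
  have hg : Spec.map g ≫ Y.fromSpecStalk x = Y.fromSpecResidueField η := by
    simp only [g, Spec.map_comp, Category.assoc, Scheme.SpecMap_stalkSpecializes_fromSpecStalk]
    rfl
  have key : ∀ {m' : Y ⟶ P1 A} {w : Fin 2 → Y.presheaf.stalk x},
      HasCoords ρx (Y.fromSpecStalk x ≫ m') w →
      HasCoords (g.hom.comp ρx) (Y.fromSpecResidueField η ≫ m') (g.hom ∘ w) := by
    intro m' w hw
    have := hw.specMap g.hom
    rwa [CommRingCat.ofHom_hom, ← Category.assoc, hg] at this
  have hρ : g.hom.comp ρx = ρη := by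
    have := (key hux).str.symm.trans hu.str
    exact CommRingCat.hom_ext_iff.mp (Spec.map_injective this)
  have hux' := key hux
  have hvx' := key hvx
  rw [hρ] at hux' hvx'
  have hginj : Function.Injective g.hom := by
    obtain ⟨i, c, u', hc, rfl, hu'i, hu', hchart, hcomp⟩ := hux.exists_normalized
    have hloc : IsLocalizationMap (eval₂RingHom ρx (u' (1 - i))) :=
      isLocalizationMap_of_fromSpecStalk j (chart A i) x _ hchart
    have h1 : g.hom.comp (eval₂RingHom ρx (u' (1 - i))) = eval₂RingHom ρη (g.hom (u' (1 - i))) := by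
      rw [← hρ]
      ext <;> simp
    have h2 : Function.Injective (eval₂RingHom ρη (g.hom (u' (1 - i)))) := by
      have h3 := key hu'
      rw [hρ] at h3
      have h4 := hu.proportional h3
      rcases eq_zero_or_eq_one i with rfl | rfl
      · refine injective_eval₂_of_mul_eq_one hinj ?_
        simpa [hu'i] using h4
      · have : g.hom (u' (1 - 1)) = τ := by
          simp [hu'i] at h4
          exact h4.symm
        rwa [this]
    rw [injective_iff_map_eq_zero]
    intro w hw
    obtain ⟨α, β, hβ, hwβ⟩ := hloc.1 w
    have h3 : (g.hom.comp (eval₂RingHom ρx (u' (1 - i)))) α = 0 := by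
      rw [RingHom.comp_apply, ← hwβ, map_mul, hw, zero_mul]
    rw [h1, map_eq_zero_iff _ h2] at h3
    rw [h3, map_zero] at hwβ
    exact (hβ.mul_left_eq_zero).mp hwβ
  -- the relation at the generic point descends to the stalk
  have hrel : vx 0 * formEval ρx n G ux = vx 1 * formEval ρx n F ux := by
    apply hginj
    rw [map_mul, map_mul, map_formEval, map_formEval, hρ]
    obtain ⟨c, hc⟩ := hu.exists_smul hux'
    obtain ⟨c', hc'⟩ := hv.exists_smul hvx'
    have h0 : g.hom (vx 0) = c' * v 0 := congrFun hc' 0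
    have h1 : g.hom (vx 1) = c' * v 1 := congrFun hc' 1
    erw [hc, h0, h1]
    rw [formEval_smul, formEval_smul]
    linear_combination (c' * c ^ n) * h
  have hx := hasCoords_formEval_of_stalk j x hux hvx hF hG hn hFG hrel
  have hB := hx.specMap s.hom
  rw [CommRingCat.ofHom_hom, ← Category.assoc, hs] at hB
  have hB' := hux.specMap s.hom
  rw [CommRingCat.ofHom_hom, ← Category.assoc, hs] at hB'
  have hρB : s.hom.comp ρx = ρ := by
    have := hB'.str.symm.trans ha.str
    exact CommRingCat.hom_ext_iff.mp (Spec.map_injective this)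
  rw [hρB] at hB hB'
  obtain ⟨c, hc⟩ := hB'.exists_smul ha
  have hcu : IsUnit c := by
    obtain ⟨i, hi, -⟩ := ha
    rw [hc] at hi
    exact isUnit_of_mul_isUnit_left hi
  have := hB.smul (hcu.pow n)
  convert this using 1
  ext k
  rw [hc]
  fin_cases k
  · simp [formEval_smul, map_formEval, hρB]
  · simp [formEval_smul, map_formEval, hρB]

end GlobalCoordinates

/-! ### Residue fields and degrees of field extensions -/

section ResidueFields

variable {A : Type} [CommRing A]

/-- `κ` is the residue field of `A[T]` at the prime `q`, with `A → κ` given by `σ` and `T ↦ τ`: the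
kernel of `A[T] → κ` is `q`, and each element of `κ` is a fraction of elements of the image. -/
structure IsResidueData {A κ : Type*} [CommRing A] [Field κ] (σ : A →+* κ) (τ : κ)
    (q : Ideal A[X]) : Prop where
  ker_eq : RingHom.ker (eval₂RingHom σ τ) = q
  exists_frac : ∀ z : κ, ∃ α β : A[X], β.eval₂ σ τ ≠ 0 ∧ z * β.eval₂ σ τ = α.eval₂ σ τ

lemma IsResidueData.injective {A κ : Type*} [CommRing A] [Field κ] {σ : A →+* κ} {τ : κ}
    (h : IsResidueData σ τ (⊥ : Ideal A[X])) : Function.Injective (eval₂RingHom σ τ) :=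
  (RingHom.injective_iff_ker_eq_bot _).mpr h.ker_eq

/-- The residue field at a point of the chart `X₁ ≠ 0`. -/
lemma exists_isResidueData {Y : Scheme.{0}} (j : Y ⟶ P1 A) [IsOpenImmersion j] (x : Y)
    (q : PrimeSpectrum A[X]) (h : j x = chart A 1 q) :
    ∃ (σ : A →+* Y.residueField x) (τ : Y.residueField x),
      HasCoords σ (Y.fromSpecResidueField x ≫ j) ![τ, 1] ∧ IsResidueData σ τ q.asIdeal := by
  have hc : (Y.fromSpecStalk x ≫ j) (IsLocalRing.closedPoint (Y.presheaf.stalk x)) ∈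
      (chart A 1).opensRange := by
    exact ⟨q, (h.symm.trans (congrArg j Scheme.fromSpecStalk_closedPoint.symm)).trans
      (Scheme.Hom.comp_apply _ _ _).symm⟩
  have h1 := Scheme.preimage_eq_top_of_closedPoint_mem (Y.fromSpecStalk x ≫ j) hc
  have h2 : Set.range (Y.fromSpecStalk x ≫ j) ⊆ Set.range (chart A 1) := by
    rintro _ ⟨y, rfl⟩
    have : y ∈ (⊤ : (Spec (Y.presheaf.stalk x)).Opens) := trivial
    rw [← h1] at this
    exact this
  obtain ⟨g, hg⟩ := Spec.map_surjective
    (IsOpenImmersion.lift (chart A 1) (Y.fromSpecStalk x ≫ j) h2)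
  have hfac : Y.fromSpecStalk x ≫ j = Spec.map g ≫ chart A 1 := by
    rw [hg, IsOpenImmersion.lift_fac]
  have hloc := isLocalizationMap_of_fromSpecStalk j (chart A 1) x g hfac
  let γ : A[X] →+* Y.residueField x := (g ≫ Y.residue x).hom
  have hγ : Y.fromSpecResidueField x ≫ j = Spec.map (CommRingCat.ofHom γ) ≫ chart A 1 := by
    simp only [γ, CommRingCat.ofHom_hom, Spec.map_comp, Category.assoc, ← hfac]
    rfl
  have heval : eval₂RingHom (γ.comp C) (γ X) = γ := by ext <;> simp
  have heval' : ∀ α : A[X], α.eval₂ (γ.comp C) (γ X) = γ α := fun α => RingHom.congr_fun heval α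
  refine ⟨γ.comp C, γ X, ?_, ?_, ?_⟩
  · have h3 : HasCoords C (chart A 1) (chartCoord A 1) := ⟨1, isUnit_chartCoord 1, rfl⟩
    have h4 := h3.specMap γ
    rw [← hγ] at h4
    convert h4 using 1
    ext k
    rcases eq_zero_or_eq_one k with rfl | rfl <;> simp [chartCoord]
  · rw [heval]
    let pt : Spec (Y.residueField x) := IsLocalRing.closedPoint (Y.residueField x)
    have h5 : chart A 1 (Spec.map (CommRingCat.ofHom γ) pt) = chart A 1 q := by
      refine (Scheme.Hom.comp_apply _ _ pt).symm.trans ?_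
      rw [← hγ, ← h]
      exact (Scheme.Hom.comp_apply _ _ pt).trans
        (congrArg j (Scheme.fromSpecResidueField_apply x pt))
    have h6 := (chart A 1).isOpenEmbedding.injective h5
    rw [← h6]
    ext z
    change γ z = 0 ↔ γ z ∈ (IsLocalRing.closedPoint (Y.residueField x)).asIdeal
    rw [IsLocalRing.closedPoint]
    change γ z = 0 ↔ γ z ∈ IsLocalRing.maximalIdeal (Y.residueField x)
    rw [IsLocalRing.mem_maximalIdeal, mem_nonunits_iff, isUnit_iff_ne_zero, not_not]
  · intro z
    obtain ⟨w, rfl⟩ := Scheme.residue_surjective Y x z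
    obtain ⟨α, β, hβ, hw⟩ := hloc.1 w
    refine ⟨α, β, ?_, ?_⟩
    · rw [heval']
      exact (hβ.map (Y.residue x).hom).ne_zero
    · rw [heval', heval']
      exact ((map_mul (Y.residue x).hom _ _).symm.trans (congrArg _ hw))

end ResidueFields

section Gauss

variable {A : Type*} [CommRing A] [IsDomain A] [UniqueFactorizationMonoid A]

/-- Gauss's lemma for coprimality. -/
lemma IsRelPrime.isCoprime_map_fractionRing {F G : A[X]} (h : IsRelPrime F G) :
    IsCoprime (F.map (algebraMap A (FractionRing A))) (G.map (algebraMap A (FractionRing A))) := by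
  rw [← isRelPrime_iff_isCoprime]
  intro Q hQF hQG
  by_cases hQ0 : Q = 0
  · rw [hQ0, zero_dvd_iff, Polynomial.map_eq_zero_iff (IsFractionRing.injective A _)] at hQF hQG
    rw [hQF, hQG] at h
    exact absurd (h dvd_rfl dvd_rfl) (by simp)
  let _ : NormalizedGCDMonoid A := Nonempty.some inferInstance
  -- clear denominators in `Q` and take the primitive part: it divides `F` and `G` over `A`
  obtain ⟨b, hb, hbQ⟩ := IsLocalization.integerNormalization_spec (nonZeroDivisors A) Q
  set N := IsLocalization.integerNormalization (nonZeroDivisors A) Q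
  have hb0 : algebraMap A (FractionRing A) b ≠ 0 := by
    simpa using nonZeroDivisors.ne_zero hb
  have hN0 : N ≠ 0 := by
    intro h0
    rw [h0, Polynomial.map_zero, eq_comm, Algebra.smul_def] at hbQ
    refine mul_ne_zero ?_ hQ0 hbQ
    simpa [IsScalarTower.algebraMap_apply A (FractionRing A) (FractionRing A)[X]] using hb0
  have hc0 : algebraMap A (FractionRing A) N.content ≠ 0 := by
    simpa [content_eq_zero_iff] using hN0
  have hmap : C (algebraMap A (FractionRing A) N.content) *
      N.primPart.map (algebraMap A (FractionRing A)) =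
      C (algebraMap A (FractionRing A) b) * Q := by
    rw [← map_C, ← Polynomial.map_mul, ← N.eq_C_content_mul_primPart, hbQ, Algebra.smul_def]
    rfl
  have hassoc : N.primPart.map (algebraMap A (FractionRing A)) ∣ Q := by
    rw [← (isUnit_C.mpr (isUnit_iff_ne_zero.mpr hb0)).dvd_mul_left, ← hmap]
    exact Dvd.intro_left _ rfl
  have hdvd : ∀ F : A[X], Q ∣ F.map (algebraMap A (FractionRing A)) → N.primPart ∣ F := by
    intro F hF
    obtain ⟨g, hg⟩ := hassoc.trans hF
    have : g ∈ lifts (algebraMap A (FractionRing A)) := by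
      rw [← (N.isPrimitive_primPart).map_mul_mem_lifts_iff, ← hg]
      exact ⟨F, by simp⟩
    obtain ⟨g', rfl⟩ := this
    refine ⟨g', Polynomial.map_injective _ (IsFractionRing.injective A (FractionRing A)) ?_⟩
    rw [hg, Polynomial.map_mul]
    rfl
  have hu := h (hdvd F hQF) (hdvd G hQG)
  have h2 : IsUnit (C (algebraMap A (FractionRing A) b) * Q) := by
    rw [← hmap]
    exact (isUnit_C.mpr (isUnit_iff_ne_zero.mpr hc0)).mul (hu.map (mapRingHom _))
  exact isUnit_of_mul_isUnit_right h2

end Gauss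

section Degree

variable {E : Type*} [Field E] {κ₁ κ₂ : Type*} [Field κ₁] [Field κ₂]

lemma IsResidueData.isFractionRing {σ : E →+* κ₂} {τ : κ₂}
    (h : IsResidueData σ τ (⊥ : Ideal E[X])) :
    letI : Algebra E[X] κ₂ := (eval₂RingHom σ τ).toAlgebra
    IsFractionRing E[X] κ₂ := by
  let _ : Algebra E[X] κ₂ := (eval₂RingHom σ τ).toAlgebra
  have hinj := h.injective
  refine ⟨⟨fun y => ?_, fun z => ?_, fun {x y} hxy => ⟨1, ?_⟩⟩⟩
  · exact isUnit_iff_ne_zero.mpr (fun h0 => nonZeroDivisors.ne_zero y.2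
      ((map_eq_zero_iff (eval₂RingHom σ τ) hinj).mp h0))
  · obtain ⟨α, β, hβ, hz⟩ := h.exists_frac z
    refine ⟨(α, ⟨β, mem_nonZeroDivisors_of_ne_zero ?_⟩), hz⟩
    rintro rfl
    simp at hβ
  · simp [hinj hxy]

/-- For `κ₁ = E(τ₁)` and `κ₂ = E(τ₂)` rational function fields and `τ₁ ↦ F(τ₂) / G(τ₂)` in lowest
terms, the degree of `κ₂` over `κ₁` is `max (deg F) (deg G)`. -/
lemma finrank_eq_max_natDegree {σ₁ : E →+* κ₁} {τ₁ : κ₁} {σ₂ : E →+* κ₂} {τ₂ : κ₂}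
    (h₁ : IsResidueData σ₁ τ₁ (⊥ : Ideal E[X])) (h₂ : IsResidueData σ₂ τ₂ (⊥ : Ideal E[X]))
    (f : κ₁ →+* κ₂) (hf : f.comp σ₁ = σ₂) {F G : E[X]} (hFG : IsCoprime F G) (hG : G ≠ 0)
    (h : f τ₁ * G.eval₂ σ₂ τ₂ = F.eval₂ σ₂ τ₂) :
    @Module.finrank κ₁ κ₂ _ _ f.toAlgebra.toModule = max F.natDegree G.natDegree := by
  let _ : Algebra E[X] κ₂ := (eval₂RingHom σ₂ τ₂).toAlgebra
  have hfrac : IsFractionRing E[X] κ₂ := h₂.isFractionRing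
  let _ : Algebra κ₁ κ₂ := f.toAlgebra
  let e : κ₂ ≃+* RatFunc E :=
    (IsLocalization.algEquiv (nonZeroDivisors E[X]) κ₂ (RatFunc E)).toRingEquiv
  have he : ∀ P : E[X], e (P.eval₂ σ₂ τ₂) = algebraMap E[X] (RatFunc E) P := by
    intro P
    exact (IsLocalization.algEquiv (nonZeroDivisors E[X]) κ₂ (RatFunc E)).commutes P
  set φ : RatFunc E := algebraMap _ _ F / algebraMap _ _ G with hφ
  have hG' : algebraMap E[X] (RatFunc E) G ≠ 0 := RatFunc.algebraMap_ne_zero hG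
  have hτ : e (f τ₁) = φ := by
    rw [hφ, eq_div_iff hG', ← he, ← he, ← map_mul, h]
  have hev : ∀ P : E[X], e (f (P.eval₂ σ₁ τ₁)) = aeval φ P := by
    intro P
    have h1 : (e : κ₂ →+* RatFunc E) (f (P.eval₂ σ₁ τ₁)) =
        P.eval₂ (algebraMap E (RatFunc E)) φ := by
      rw [hom_eval₂, hom_eval₂, hf]
      congr 1
      ext c
      have := he (C c)
      rw [eval₂_C] at this
      simpa using this
    rw [aeval_def, ← h1]
    rfl
  -- the extension `κ₁ → κ₂` is isomorphic to `E(φ) ⊆ E(T)`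
  let i₀ : κ₁ →+* RatFunc E := (e : κ₂ →+* RatFunc E).comp f
  have hi₀ : ∀ z, i₀ z ∈ IntermediateField.adjoin E {φ} := by
    intro z
    obtain ⟨α, β, hβ, hz⟩ := h₁.exists_frac z
    rw [IntermediateField.mem_adjoin_simple_iff]
    refine ⟨α, β, ?_⟩
    rw [← hev, ← hev, eq_div_iff, ← hz]
    · simp [i₀]
    · simpa using hβ
  let i : κ₁ →+* IntermediateField.adjoin E {φ} :=
    RingHom.codRestrict i₀ (IntermediateField.adjoin E {φ}) hi₀
  have hi : Function.Bijective i := by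
    refine ⟨i.injective, fun ⟨w, hw⟩ => ?_⟩
    obtain ⟨r, s, hrs⟩ := (IntermediateField.mem_adjoin_simple_iff _ _).mp hw
    refine ⟨r.eval₂ σ₁ τ₁ / s.eval₂ σ₁ τ₁, Subtype.ext ?_⟩
    change e (f _) = w
    rw [hrs, ← hev, ← hev, ← map_div₀, ← map_div₀]
  have hfin := Algebra.finrank_eq_of_equiv_equiv (RingEquiv.ofBijective i hi) e (by
    ext z
    rfl)
  refine (hfin.trans (RatFunc.finrank_eq_max_natDegree φ)).trans ?_
  have h3 := (RatFunc.num_mul_eq_mul_denom_iff (x := φ) hG).mpr hφ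
  have hc := RatFunc.isCoprime_num_denom φ
  have hassocF : Associated φ.num F := by
    refine associated_of_dvd_dvd ?_ ?_
    · exact hc.dvd_of_dvd_mul_right (Dvd.intro _ h3)
    · exact hFG.dvd_of_dvd_mul_right (Dvd.intro _ h3.symm)
  have hassocG : Associated φ.denom G := by
    refine associated_of_dvd_dvd ?_ ?_
    · exact hc.symm.dvd_of_dvd_mul_left (Dvd.intro_left _ h3.symm)
    · exact hFG.symm.dvd_of_dvd_mul_left (Dvd.intro_left _ h3)
  rw [natDegree_eq_of_degree_eq (degree_eq_degree_of_associated hassocF),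
    natDegree_eq_of_degree_eq (degree_eq_degree_of_associated hassocG)]

end Degree

section BaseChange

variable {A : Type*} [CommRing A] {κ : Type*} [Field κ]

/-- The residue field at the generic point of `A[T]` is `Frac(A)(T)`. -/
lemma IsResidueData.exists_lift_fractionRing [IsDomain A] {σ : A →+* κ} {τ : κ}
    (h : IsResidueData σ τ (⊥ : Ideal A[X])) :
    ∃ σ' : FractionRing A →+* κ, σ'.comp (algebraMap A (FractionRing A)) = σ ∧
      IsResidueData σ' τ (⊥ : Ideal (FractionRing A)[X]) := by
  have hinj := h.injective
  have hσ : Function.Injective σ := by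
    have : σ = (eval₂RingHom σ τ).comp C := by ext; simp
    rw [this]
    exact hinj.comp C_injective
  refine ⟨IsFractionRing.lift hσ, ?_, ?_, ?_⟩
  · ext a
    simp
  · have hcomp : (IsFractionRing.lift hσ).comp (algebraMap A (FractionRing A)) = σ := by
      ext a; simp
    rw [← RingHom.injective_iff_ker_eq_bot, injective_iff_map_eq_zero]
    intro P hP
    obtain ⟨b, hb, hbP⟩ := IsLocalization.integerNormalization_spec (nonZeroDivisors A) P
    set N := IsLocalization.integerNormalization (nonZeroDivisors A) P
    have h1 : (N.map (algebraMap A (FractionRing A))).eval₂ (IsFractionRing.lift hσ) τ = 0 := by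
      rw [hbP, Algebra.smul_def, eval₂_mul]
      rw [coe_eval₂RingHom] at hP
      rw [hP, mul_zero]
    rw [eval₂_map, hcomp] at h1
    have h2 : N = 0 := (map_eq_zero_iff _ hinj).mp h1
    rw [h2, Polynomial.map_zero, eq_comm, Algebra.smul_def] at hbP
    refine (mul_eq_zero.mp hbP).resolve_left ?_
    have hb0 : algebraMap A (FractionRing A) b ≠ 0 := by
      simpa using nonZeroDivisors.ne_zero hb
    simpa [IsScalarTower.algebraMap_apply A (FractionRing A) (FractionRing A)[X]] using hb0
  · intro z
    obtain ⟨α, β, hβ, hz⟩ := h.exists_frac z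
    have hcomp : (IsFractionRing.lift hσ).comp (algebraMap A (FractionRing A)) = σ := by
      ext a; simp
    refine ⟨α.map (algebraMap _ _), β.map (algebraMap _ _), ?_, ?_⟩
    · rwa [eval₂_map, hcomp]
    · rwa [eval₂_map, eval₂_map, hcomp]

/-- The residue field at the generic point of the fibre of `A[T]` over `A → k` is `k(T)`. -/
lemma IsResidueData.exists_lift_of_surjective {k : Type*} [Field k] {π : A →+* k}
    (hπ : Function.Surjective π) {σ : A →+* κ} {τ : κ}
    (h : IsResidueData σ τ (RingHom.ker (mapRingHom π) : Ideal A[X])) :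
    ∃ σ' : k →+* κ, σ'.comp π = σ ∧ IsResidueData σ' τ (⊥ : Ideal k[X]) := by
  have hker : RingHom.ker π ≤ RingHom.ker σ := by
    intro a ha
    have : C a ∈ RingHom.ker (mapRingHom π) := by
      rw [RingHom.mem_ker] at ha ⊢
      simp [ha]
    rw [← h.ker_eq, RingHom.mem_ker] at this
    simpa using this
  let σ' := RingHom.liftOfSurjective π hπ ⟨σ, hker⟩
  have hcomp : σ'.comp π = σ := RingHom.liftOfRightInverse_comp π _ _ ⟨σ, hker⟩
  have hev : ∀ α : A[X], (α.map π).eval₂ σ' τ = α.eval₂ σ τ := by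
    intro α
    rw [eval₂_map, hcomp]
  refine ⟨σ', hcomp, ?_, ?_⟩
  · rw [← RingHom.injective_iff_ker_eq_bot, injective_iff_map_eq_zero]
    intro P hP
    obtain ⟨P, rfl⟩ := map_surjective π hπ P
    rw [coe_eval₂RingHom, hev] at hP
    have : P ∈ RingHom.ker (mapRingHom π) := by
      rw [← h.ker_eq]; exact hP
    exact this
  · intro z
    obtain ⟨α, β, hβ, hz⟩ := h.exists_frac z
    refine ⟨α.map π, β.map π, ?_, ?_⟩
    · rwa [hev]
    · rwa [hev, hev]

end BaseChange

/-! ### The generic points of `ℙ¹` over the Witt vectors and of its central fibre -/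

section GenericPoints

variable {p : ℕ} [Fact p.Prime]

lemma constantCoeff_surjective :
    Function.Surjective (WittVector.constantCoeff : W p →+* BaseField p) := fun a =>
  ⟨WittVector.teichmuller p a, WittVector.teichmuller_coeff_zero p a⟩

variable (p) in
/-- The prime ideal `p · W(k)[T]`, as the kernel of `W(k)[T] → k[T]`: the generic point of the
central fibre of the affine line. -/
noncomputable def centralPrime : PrimeSpectrum (W p)[X] :=
  ⟨RingHom.ker (mapRingHom (WittVector.constantCoeff : W p →+* BaseField p)),
    RingHom.ker_isPrime _⟩

variable (p) in
/-- The generic point of the affine line over `W(k)`. -/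
noncomputable def genericPrime : PrimeSpectrum (W p)[X] := ⟨⊥, Ideal.isPrime_bot⟩

lemma exists_chart_of_specializes {A : Type} [CommRing A] {x : P1 A} {q : PrimeSpectrum A[X]}
    {i : Fin 2} (h : x ⤳ chart A i q) : ∃ q' : PrimeSpectrum A[X], x = chart A i q' ∧ q' ≤ q := by
  obtain ⟨q', hq'⟩ := h.mem_open (chart A i).isOpenEmbedding.isOpen_range ⟨q, rfl⟩
  let q'' : PrimeSpectrum A[X] := q'
  refine ⟨q'', hq'.symm, ?_⟩
  rw [← hq'] at h
  exact (PrimeSpectrum.le_iff_specializes q'' q).mpr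
    ((chart A i).isOpenEmbedding.isInducing.specializes_iff.mp h)

lemma chart_comp_str {A : Type} [CommRing A] (i : Fin 2) :
    chart A i ≫ P1.str A = Spec.map (CommRingCat.ofHom C) := point_str _ _ _ _

lemma ker_constantCoeff_le_of_mem_range {y : PrimeSpectrum (W p)}
    (h : (y : specW p) ∈ Set.range (specKToSpecW p)) :
    y.asIdeal = RingHom.ker (WittVector.constantCoeff : W p →+* BaseField p) := by
  obtain ⟨z, rfl⟩ := h
  let z' : PrimeSpectrum (BaseField p) := z
  have hz : z'.asIdeal = ⊥ := by
    have := z'.isPrime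
    exact Ideal.eq_bot_of_prime z'.asIdeal
  change z'.asIdeal.comap WittVector.constantCoeff = _
  rw [hz]
  rfl

lemma str_chart_centralPrime_mem_range :
    P1.str (W p) (chart (W p) 1 (centralPrime p)) ∈ Set.range (specKToSpecW p) := by
  let z : PrimeSpectrum (BaseField p) := ⟨⊥, Ideal.isPrime_bot⟩
  refine ⟨z, ?_⟩
  have h1 : P1.str (W p) (chart (W p) 1 (centralPrime p)) =
      Spec.map (CommRingCat.ofHom (C : W p →+* (W p)[X])) (centralPrime p) := by
    rw [← chart_comp_str 1]
    exact (Scheme.Hom.comp_apply _ _ _).symm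
  rw [h1]
  refine PrimeSpectrum.ext ?_
  change z.asIdeal.comap WittVector.constantCoeff = (centralPrime p).asIdeal.comap C
  ext a
  simp [z, centralPrime]

/-- The generic point of the central fibre of an open subscheme of `ℙ¹`. -/
lemma eq_chart_centralPrime {Y : Scheme.{0}} {s : Y ⟶ specW p} (j : Y ⟶ P1 (W p))
    [IsOpenImmersion j] (hs : j ≫ P1.str (W p) = s) (y : Y)
    (hy : j y = chart (W p) 1 (centralPrime p))
    {η : centralFibre s} (hη : IsGenericPoint η Set.univ) :
    j (centralFibreι s η) = chart (W p) 1 (centralPrime p) := by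
  have hy' : y ∈ Set.range (centralFibreι s) := by
    rw [centralFibreι, Scheme.Pullback.range_fst, Set.mem_preimage, ← hs, Scheme.Hom.comp_apply, hy]
    exact str_chart_centralPrime_mem_range
  obtain ⟨z, rfl⟩ := hy'
  have hsp : j (centralFibreι s η) ⤳ chart (W p) 1 (centralPrime p) := by
    rw [← hy]
    exact ((hη.specializes (Set.mem_univ z)).map (Scheme.Hom.continuous _)).map
      (Scheme.Hom.continuous _)
  obtain ⟨q, hq, hle⟩ := exists_chart_of_specializes hsp
  rw [hq]
  have hmem : s (centralFibreι s η) ∈ Set.range (specKToSpecW p) := by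
    have : centralFibreι s η ∈ Set.range (centralFibreι s) := ⟨η, rfl⟩
    rwa [centralFibreι, Scheme.Pullback.range_fst] at this
  have hsj : ∀ w, s w = P1.str (W p) (j w) := fun w => by rw [← hs, Scheme.Hom.comp_apply]
  rw [hsj, hq] at hmem
  have h1 : P1.str (W p) (chart (W p) 1 q) =
      Spec.map (CommRingCat.ofHom (C : W p →+* (W p)[X])) q := by
    rw [← chart_comp_str 1]
    exact (Scheme.Hom.comp_apply _ _ _).symm
  rw [h1] at hmem
  have h2 := ker_constantCoeff_le_of_mem_range hmem
  have h3 : q.asIdeal.comap C = RingHom.ker (WittVector.constantCoeff : W p →+* BaseField p) := h2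
  congr 1
  refine PrimeSpectrum.ext (le_antisymm hle ?_)
  rw [centralPrime]
  change RingHom.ker (mapRingHom WittVector.constantCoeff) ≤ _
  rw [Polynomial.ker_mapRingHom, Ideal.map_le_iff_le_comap, h3]

lemma ContainsCentralGenericPoint.mem {U : (P1 (W p)).Opens} (hU : ContainsCentralGenericPoint U) :
    chart (W p) 1 (centralPrime p) ∈ U := by
  obtain ⟨η, hη, hmem⟩ := hU
  have := eq_chart_centralPrime (s := P1.str (W p)) (𝟙 _) (Category.id_comp _)
    (chart (W p) 1 (centralPrime p)) rfl hη
  rwa [← this]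

lemma eq_chart_genericPrime {Y : Scheme.{0}} (j : Y ⟶ P1 (W p))
    [IsOpenImmersion j] (y : Y) (hy : j y = chart (W p) 1 (genericPrime p))
    {η : Y} (hη : IsGenericPoint η Set.univ) : j η = chart (W p) 1 (genericPrime p) := by
  have hsp : j η ⤳ chart (W p) 1 (genericPrime p) := by
    rw [← hy]
    exact (hη.specializes (Set.mem_univ y)).map (Scheme.Hom.continuous _)
  obtain ⟨q, hq, hle⟩ := exists_chart_of_specializes hsp
  rw [hq]
  congr 1
  exact PrimeSpectrum.ext (le_antisymm hle bot_le)

lemma ContainsCentralGenericPoint.genericPrime_mem {U : (P1 (W p)).Opens}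
    (hU : ContainsCentralGenericPoint U) : chart (W p) 1 (genericPrime p) ∈ U := by
  have h1 : (genericPrime p) ⤳ (centralPrime p) :=
    (PrimeSpectrum.le_iff_specializes _ _).mp (show (⊥ : Ideal _) ≤ _ from bot_le)
  have h2 : chart (W p) 1 (genericPrime p) ⤳ chart (W p) 1 (centralPrime p) :=
    h1.map (chart (W p) 1).continuous
  exact h2.mem_open U.isOpen hU.mem

lemma isGenericPoint_map {X Y : Scheme.{0}} (f : X ⟶ Y) [IsDominant f] {η : X}
    (hη : IsGenericPoint η Set.univ) : IsGenericPoint (f η) Set.univ := by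
  have := hη.image (Scheme.Hom.continuous f)
  rwa [Set.image_univ, f.denseRange.closure_range] at this

lemma IsResidueData.map {A κ κ' : Type*} [CommRing A] [Field κ] [Field κ'] {σ : A →+* κ} {τ : κ}
    {q : Ideal A[X]} (h : IsResidueData σ τ q) (g : κ →+* κ') (hg : Function.Surjective g) :
    IsResidueData (g.comp σ) (g τ) q := by
  have hev : ∀ α : A[X], α.eval₂ (g.comp σ) (g τ) = g (α.eval₂ σ τ) := fun α =>
    (hom_eval₂ _ _ _ _).symm
  refine ⟨?_, fun z => ?_⟩
  · rw [← h.ker_eq]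
    ext α
    simp only [RingHom.mem_ker, coe_eval₂RingHom, hev, map_eq_zero]
  · obtain ⟨z, rfl⟩ := hg z
    obtain ⟨α, β, hβ, hz⟩ := h.exists_frac z
    refine ⟨α, β, ?_, ?_⟩
    · rw [hev]
      exact (map_ne_zero g).mpr hβ
    · rw [hev, hev, ← map_mul, hz]

instance : IsClosedImmersion (specKToSpecW p) := by
  unfold specKToSpecW
  exact IsClosedImmersion.spec_of_surjective _ constantCoeff_surjective

/-- The residue field at the generic point of the central fibre. It is the same in the central
fibre, a closed subscheme, as in `Y`. -/
lemma exists_isResidueData_centralFibre {Y : Scheme.{0}} {s : Y ⟶ specW p} (j : Y ⟶ P1 (W p))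
    [IsOpenImmersion j] {ξ : centralFibre s}
    (hξ : j (centralFibreι s ξ) = chart (W p) 1 (centralPrime p)) :
    ∃ (σ : W p →+* (centralFibre s).residueField ξ) (τ : (centralFibre s).residueField ξ),
      HasCoords σ ((centralFibre s).fromSpecResidueField ξ ≫ centralFibreι s ≫ j) ![τ, 1] ∧
      IsResidueData σ τ (centralPrime p).asIdeal := by
  obtain ⟨σ, τ, hc, hd⟩ := exists_isResidueData j _ _ hξ
  let g := ((centralFibreι s).residueFieldMap ξ).hom
  have hg : Function.Surjective g := by
    intro z
    obtain ⟨w, rfl⟩ := Scheme.residue_surjective _ ξ z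
    obtain ⟨w, rfl⟩ := (centralFibreι s).stalkMap_surjective ξ w
    refine ⟨Scheme.residue _ _ w, ?_⟩
    have := CommRingCat.hom_ext_iff.mp (Scheme.residue_residueFieldMap (centralFibreι s) ξ)
    exact RingHom.congr_fun this w
  refine ⟨g.comp σ, g τ, ?_, hd.map g hg⟩
  have := hc.specMap g
  rw [CommRingCat.ofHom_hom, Scheme.Hom.SpecMap_residueFieldMap_fromSpecResidueField_assoc] at this
  convert this using 1
  ext k
  fin_cases k <;> simp

end GenericPoints

/-! ### Endomorphisms as pairs of coprime forms -/

section ReducedFractions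

variable {p : ℕ} [Fact p.Prime]

lemma natDegree_map_fractionRing (F : (W p)[X]) :
    (F.map (algebraMap (W p) (FractionRing (W p)))).natDegree = F.natDegree :=
  natDegree_map_eq_of_injective (IsFractionRing.injective _ _) F

/-- In homogeneous coordinates, `ψ` is given by the forms of degree `n` with dehomogenizations `F`
and `G`, on all points with values in local rings. -/
def IsGivenBy {U : (P1 (W p)).Opens} (ψ : U.toScheme ⟶ U.toScheme) (n : ℕ) (F G : (W p)[X]) :
    Prop :=
  ∀ (B : Type) [CommRing B] [IsLocalRing B] (a : Spec (.of B) ⟶ U.toScheme) (ρ : W p →+* B)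
    (u : Fin 2 → B), HasCoords ρ (a ≫ U.ι) u →
      HasCoords ρ (a ≫ ψ ≫ U.ι) ![formEval ρ n F u, formEval ρ n G u]

/-- An endomorphism of degree `n` of an open subset of `ℙ¹_R` is given by a pair of coprime forms
of degree `n`. -/
theorem exists_forms {U : (P1 (W p)).Opens} (hU : ContainsCentralGenericPoint U)
    (ψ : U.toScheme ⟶ U.toScheme) (h : ψ ≫ openStr U = openStr U) {n : ℕ} (hn : 0 < n)
    (hdeg : HasDegree ψ n) :
    ∃ F G : (W p)[X], IsRelPrime F G ∧ F.natDegree ≤ n ∧ G.natDegree ≤ n ∧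
      IsGivenBy ψ n F G := by
  obtain ⟨η, hη, ⟨hdom, hres⟩ | ⟨-, h0⟩⟩ := hdeg
  swap
  · omega
  have hηc := eq_chart_genericPrime U.ι ⟨_, hU.genericPrime_mem⟩ rfl hη
  have hψηc := eq_chart_genericPrime U.ι ⟨_, hU.genericPrime_mem⟩ rfl (isGenericPoint_map ψ hη)
  obtain ⟨σ, τ, hc, hd⟩ := exists_isResidueData U.ι η _ hηc
  obtain ⟨σ', τ', hc', hd'⟩ := exists_isResidueData U.ι (ψ η) _ hψηc
  let f := (ψ.residueFieldMap η).hom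
  have hv := hc'.specMap f
  rw [CommRingCat.ofHom_hom, Scheme.Hom.SpecMap_residueFieldMap_fromSpecResidueField_assoc] at hv
  have hf : f.comp σ' = σ := by
    have h1 := hv.str
    rw [Category.assoc, Category.assoc, h] at h1
    have h2 := hc.str
    rw [Category.assoc] at h2
    exact CommRingCat.hom_ext_iff.mp (Spec.map_injective (h1.symm.trans h2))
  rw [hf] at hv
  -- the affine coordinate pulls back to the fraction `F / G`, in lowest terms
  obtain ⟨α, β, hβ, hαβ⟩ := hd.exists_frac (f τ')
  have hβ0 : β ≠ 0 := by
    rintro rfl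
    simp at hβ
  obtain ⟨F, G, c, hFG, hcF, hcG⟩ := UniqueFactorizationMonoid.exists_reduced_factors' α β hβ0
  have hrel : f τ' * G.eval₂ σ τ = F.eval₂ σ τ := by
    have hcne : c.eval₂ σ τ ≠ 0 := by
      rw [← hcG, eval₂_mul] at hβ
      exact left_ne_zero_of_mul hβ
    rw [← hcF, ← hcG, eval₂_mul, eval₂_mul] at hαβ
    exact mul_left_cancel₀ hcne (by linear_combination hαβ)
  have hG0 : G ≠ 0 := right_ne_zero_of_mul (hcG ▸ hβ0)
  obtain ⟨σE, hσE, hdE⟩ := hd.exists_lift_fractionRing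
  obtain ⟨σE', hσE', hdE'⟩ := hd'.exists_lift_fractionRing
  have hdegree : n = max F.natDegree G.natDegree := by
    rw [← natDegree_map_fractionRing F, ← natDegree_map_fractionRing G, ← hres]
    refine finrank_eq_max_natDegree hdE' hdE f ?_ (IsRelPrime.isCoprime_map_fractionRing hFG) ?_ ?_
    · refine IsLocalization.ringHom_ext (nonZeroDivisors (W p)) ?_
      rw [RingHom.comp_assoc, hσE, hσE', hf]
    · rwa [Ne, Polynomial.map_eq_zero_iff (IsFractionRing.injective _ _)]
    · rw [eval₂_map, eval₂_map, hσE, hrel]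
  have hFn : F.natDegree ≤ n := hdegree ▸ le_max_left _ _
  have hGn : G.natDegree ≤ n := hdegree ▸ le_max_right _ _
  have hcoeff : F.coeff n ≠ 0 ∨ G.coeff n ≠ 0 := by
    rcases max_choice F.natDegree G.natDegree with h1 | h1
    · left
      rw [hdegree, h1, coeff_natDegree, leadingCoeff_ne_zero]
      rintro rfl
      rw [hdegree, h1, natDegree_zero] at hn
      exact hn.false
    · right
      rw [hdegree, h1, coeff_natDegree, leadingCoeff_ne_zero]
      exact hG0
  refine ⟨F, G, hFG, hFn, hGn, fun B _ _ a ρ u ha => ?_⟩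
  refine hasCoords_of_generic U.ι (ψ ≫ U.ι) ((Category.assoc _ _ _).trans h) η
    (fun x => hη.specializes (Set.mem_univ x)) hc hd.injective hv hFn hGn hcoeff hFG ?_ a ha
  rw [formEval_of_eq_one σ hFn (by rfl), formEval_of_eq_one σ hGn (by rfl)]
  simpa using hrel

end ReducedFractions

/-! ### Vanishing differentials and `p`-th powers on the central fibre -/

section Differentials

/-- The derivation `d/dT` of `E(T)`. -/
lemma IsResidueData.exists_derivation {E κ : Type*} [Field E] [Field κ] {σ : E →+* κ} {τ : κ}
    (h : IsResidueData σ τ (⊥ : Ideal E[X])) :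
    ∃ D : Derivation ℤ κ κ, ∀ P : E[X], D (P.eval₂ σ τ) = (derivative P).eval₂ σ τ := by
  let _ : Algebra E[X] κ := (eval₂RingHom σ τ).toAlgebra
  have hfrac : IsFractionRing E[X] κ := h.isFractionRing
  -- the ring homomorphism `P ↦ P(τ) + P'(τ) ε` to the dual numbers extends to `κ`
  let θ₀ : E[X] →+* TrivSqZeroExt κ κ :=
    { toFun := fun P => (P.eval₂ σ τ, (derivative P).eval₂ σ τ)
      map_one' := by ext <;> simp
      map_zero' := by ext <;> simp
      map_add' := fun P Q => by
        ext
        · exact eval₂_add _ _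
        · exact (congrArg _ derivative_add).trans (eval₂_add _ _)
      map_mul' := fun P Q => by
        ext
        · exact eval₂_mul _ _
        · refine Eq.trans ?_ (TrivSqZeroExt.snd_mul _ _).symm
          change (derivative (P * Q)).eval₂ σ τ = P.eval₂ σ τ • (derivative Q).eval₂ σ τ +
            MulOpposite.op (Q.eval₂ σ τ) • (derivative P).eval₂ σ τ
          rw [op_smul_eq_smul, smul_eq_mul, smul_eq_mul, derivative_mul, eval₂_add,
            eval₂_mul, eval₂_mul]
          ring }
  have hθ₀ : ∀ y : nonZeroDivisors E[X], IsUnit (θ₀ y) := by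
    intro y
    rw [TrivSqZeroExt.isUnit_iff_isUnit_fst, isUnit_iff_ne_zero]
    exact fun h0 => nonZeroDivisors.ne_zero y.2 ((map_eq_zero_iff _ h.injective).mp h0)
  let θ : κ →+* TrivSqZeroExt κ κ := IsLocalization.lift hθ₀
  have hθ : ∀ P : E[X], θ (P.eval₂ σ τ) = θ₀ P := fun P => IsLocalization.lift_eq hθ₀ P
  have hfst : ∀ z, (θ z).fst = z := by
    intro z
    obtain ⟨α, β, hβ, hz⟩ := h.exists_frac z
    have h1 := congrArg (fun w => (θ w).fst) hz
    simp only [map_mul, TrivSqZeroExt.fst_mul, hθ] at h1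
    refine mul_right_cancel₀ hβ (h1.trans hz.symm)
  let D₀ : κ →ₗ[ℤ] κ := (AddMonoidHom.mk' (fun z => (θ z).snd) (by simp)).toIntLinearMap
  refine ⟨Derivation.mk' D₀ ?_, fun P => ?_⟩
  · intro a b
    change (θ (a * b)).snd = a • (θ b).snd + b • (θ a).snd
    rw [map_mul, TrivSqZeroExt.snd_mul, hfst, hfst, op_smul_eq_smul]
  · change (θ _).snd = _
    rw [hθ]
    rfl

/-- If `da = 0` in `Ω_{O/R}`, then `a` is killed by each derivation of an `O`-algebra `κ` that kills
the image of `R`. -/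
lemma derivation_eq_zero_of_kaehler {R O κ : Type*} [CommRing R] [CommRing O] [Algebra R O]
    [CommRing κ] (D : Derivation ℤ κ κ) (r : O →+* κ)
    (hD : ∀ c : R, D (r (algebraMap R O c)) = 0) {a : O} (ha : KaehlerDifferential.D R O a = 0) :
    D (r a) = 0 := by
  let _ : Module O κ := Module.compHom κ r
  let _ : Module R κ := Module.compHom κ (r.comp (algebraMap R O))
  have hsO : ∀ (w : O) (z : κ), w • z = r w * z := fun _ _ => rfl
  have hsR : ∀ (w : R) (z : κ), w • z = r (algebraMap R O w) * z := fun _ _ => rfl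
  have : IsScalarTower R O κ := ⟨fun x y z => by
    rw [hsO, hsR, hsO, Algebra.smul_def, map_mul, mul_assoc]⟩
  let D₀ : O →ₗ[R] κ :=
    { toFun := fun w => D (r w)
      map_add' := by simp
      map_smul' := fun c w => by
        rw [Algebra.smul_def, map_mul, Derivation.leibniz, hD, smul_zero, add_zero]
        rfl }
  let D₁ : Derivation R O κ := Derivation.mk' D₀ fun x y => by
    change D (r (x * y)) = x • D (r y) + y • D (r x)
    rw [map_mul, Derivation.leibniz]
    rfl
  have h1 := D₁.liftKaehlerDifferential_comp_D a
  rw [ha, map_zero] at h1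
  exact h1.symm

end Differentials

section Algebra

variable {k : Type*} [Field k]

/-- A non-constant rational function is transcendental. -/
lemma injective_eval₂_of_isCoprime [IsAlgClosed k] {κ : Type*} [Field κ] {σ : k →+* κ} {τ φ : κ}
    (h : Function.Injective (eval₂RingHom σ τ)) {F G : k[X]} (hFG : IsCoprime F G)
    (hdeg : 0 < max F.natDegree G.natDegree) (hφ : φ * G.eval₂ σ τ = F.eval₂ σ τ) :
    Function.Injective (eval₂RingHom σ φ) := by
  rw [injective_iff_map_eq_zero]
  intro P hP
  by_contra hP0
  have hs := (IsAlgClosed.splits P).eq_prod_roots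
  rw [hs, map_mul, map_multiset_prod, mul_eq_zero] at hP
  rcases hP with hP | hP
  · rw [coe_eval₂RingHom, eval₂_C, map_eq_zero, leadingCoeff_eq_zero] at hP
    exact hP0 hP
  · rw [Multiset.prod_eq_zero_iff, Multiset.map_map, Multiset.mem_map] at hP
    obtain ⟨c, -, hc⟩ := hP
    have hφc : φ = σ c := by simpa [sub_eq_zero] using hc
    have hF : F = C c * G := by
      apply h
      simp only [coe_eval₂RingHom, eval₂_mul, eval₂_C]
      rw [← hφ, hφc]
    rw [hF] at hFG hdeg
    have hu : IsUnit G := hFG.isUnit_of_dvd' (Dvd.intro_left _ rfl) dvd_rfl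
    rw [isUnit_iff] at hu
    obtain ⟨g, -, rfl⟩ := hu
    rw [← C_mul, natDegree_C, natDegree_C] at hdeg
    exact absurd hdeg (by simp)

lemma exists_pow_eq_of_derivative_eq_zero {p : ℕ} [Fact p.Prime] [CharP k p] [PerfectRing k p]
    {F : k[X]} (hF : derivative F = 0) : ∃ F' : k[X], F = F' ^ p := by
  have h1 := expand_contract p hF (Fact.out : p.Prime).ne_zero
  rw [← h1, polynomial_expand_eq]
  exact ⟨_, rfl⟩

end Algebra

section SpecialFibre

variable {p : ℕ} [Fact p.Prime]

instance : PerfectRing (BaseField p) p := PerfectField.toPerfectRing p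

/-- If the differential of `f` over `k` vanishes, then pulling back along `f` followed by
a `k`-derivation of the residue field at a point gives zero. -/
lemma HasZeroDifferential.derivation_residueFieldMap_eq_zero {k : CommRingCat.{0}}
    {X Y : Scheme.{0}}
    {s : X ⟶ Spec k} {f : X ⟶ Y} (h : HasZeroDifferential s f) (x : X)
    {σ : k →+* X.residueField x}
    (hσ : Spec.map (CommRingCat.ofHom σ) = X.fromSpecResidueField x ≫ s)
    (D : Derivation ℤ (X.residueField x) (X.residueField x)) (hD : ∀ c, D (σ c) = 0)
    (z : Y.residueField (f x)) : D ((f.residueFieldMap x).hom z) = 0 := by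
  obtain ⟨a, rfl⟩ := Scheme.residue_surjective Y (f x) z
  have h1 : (f.residueFieldMap x).hom (Y.residue (f x) a) =
      X.residue x ((f.stalkMap x).hom a) :=
    RingHom.congr_fun (CommRingCat.hom_ext_iff.mp (Scheme.residue_residueFieldMap f x)) a
  refine (congrArg D h1).trans ?_
  let _ : Algebra ((Spec k).presheaf.stalk (s x)) (X.presheaf.stalk x) :=
    (s.stalkMap x).hom.toAlgebra
  refine derivation_eq_zero_of_kaehler D (X.residue x).hom (fun r => ?_) (h x a)
  let g : k ⟶ (Spec k).presheaf.stalk (s x) := Spec.preimage ((Spec k).fromSpecStalk (s x))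
  have hg : Spec.map g = (Spec k).fromSpecStalk (s x) := Spec.map_preimage _
  have hloc : IsLocalizationMap g.hom :=
    isLocalizationMap_of_fromSpecStalk (𝟙 (Spec k)) (𝟙 (Spec k)) (s x) g
      (by rw [Category.comp_id, Category.comp_id, hg])
  have hgσ : g ≫ s.stalkMap x ≫ X.residue x = CommRingCat.ofHom σ := by
    refine Spec.map_injective ?_
    rw [hσ, Spec.map_comp, Spec.map_comp, hg, Category.assoc,
      Scheme.SpecMap_stalkMap_fromSpecStalk]
    rfl
  have hgσ' : ∀ c, X.residue x ((s.stalkMap x).hom (g.hom c)) = σ c := fun c =>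
    RingHom.congr_fun (CommRingCat.hom_ext_iff.mp hgσ) c
  obtain ⟨α, β, hβ, hr⟩ := hloc.1 r
  have h2 : X.residue x ((s.stalkMap x).hom r) * σ β = σ α := by
    rw [← hgσ', ← hgσ', ← hr, map_mul, map_mul]
  have hβ0 : σ β ≠ 0 := by
    rw [← hgσ']
    exact ((hβ.map _).map _).ne_zero
  have h3 := congrArg D h2
  rw [Derivation.leibniz, hD, hD, smul_zero, zero_add, smul_eq_mul] at h3
  exact (mul_eq_zero.mp h3).resolve_left hβ0

/-- On the central fibre, `(F : G)` becomes `(H * P ^ p : H * Q ^ p)`, as its derivative vanishes.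
If this is not constant, it is dominant of degree `p * max (deg P) (deg Q)`. -/
theorem exists_special_forms {U : (P1 (W p)).Opens} (hU : ContainsCentralGenericPoint U)
    (ψ : U.toScheme ⟶ U.toScheme) (h : ψ ≫ openStr U = openStr U)
    (hdiff : HasZeroDifferential (centralFibreStr (openStr U))
      (centralFibreMap (openStr U) (openStr U) ψ h))
    {d : ℕ} (hd : HasDegree (centralFibreMap (openStr U) (openStr U) ψ h) (p * d))
    {n : ℕ} {F G : (W p)[X]} (hF : F.natDegree ≤ n) (hG : G.natDegree ≤ n)
    (hforms : IsGivenBy ψ n F G) :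
    ∃ H P Q : (BaseField p)[X], H ≠ 0 ∧ IsCoprime P Q ∧
      F.map WittVector.constantCoeff = H * P ^ p ∧ G.map WittVector.constantCoeff = H * Q ^ p ∧
      P.natDegree ≤ d ∧ Q.natDegree ≤ d := by
  have hp : p.Prime := Fact.out
  set ψ₀ := centralFibreMap (openStr U) (openStr U) ψ h with hψ₀
  set ι := centralFibreι (openStr U) with hι
  have hcomm : ψ₀ ≫ ι = ι ≫ ψ := pullback.lift_fst _ _ _
  obtain ⟨ξ, hξ, hdeg⟩ := hd
  have hξc := eq_chart_centralPrime U.ι rfl ⟨_, hU.mem⟩ rfl hξ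
  obtain ⟨σ, τ, hc, hd⟩ := exists_isResidueData_centralFibre U.ι hξc
  obtain ⟨σ₀, hσ₀, hd₀⟩ := hd.exists_lift_of_surjective constantCoeff_surjective
  have hev : ∀ P : (W p)[X], P.eval₂ σ τ = (P.map WittVector.constantCoeff).eval₂ σ₀ τ := by
    intro P
    rw [eval₂_map, hσ₀]
  let pt := (centralFibre (openStr U)).fromSpecResidueField ξ
  have hv : HasCoords σ ((pt ≫ ι) ≫ ψ ≫ U.ι) ![F.eval₂ σ τ, G.eval₂ σ τ] := by
    have hloc : @IsLocalRing ((centralFibre (openStr U)).residueField ξ)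
        (CommRingCat.commRing _).toCommSemiring.toSemiring :=
      inferInstanceAs (IsLocalRing
        (IsLocalRing.ResidueField ((centralFibre (openStr U)).presheaf.stalk ξ)))
    have := @hforms ((centralFibre (openStr U)).residueField ξ) _ hloc (pt ≫ ι) σ
      ![τ, 1] (by rw [Category.assoc]; exact hc)
    rwa [formEval_of_eq_one σ hF (by rfl), formEval_of_eq_one σ hG (by rfl)] at this
  rw [hev, hev] at hv
  have hne : F.map WittVector.constantCoeff ≠ 0 ∨ G.map WittVector.constantCoeff ≠ 0 := by
    by_contra! h0
    obtain ⟨i, hi, -⟩ := hv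
    rw [h0.1, h0.2] at hi
    rcases eq_zero_or_eq_one i with rfl | rfl <;> simp at hi
  obtain ⟨F₁, G₁, H, hFG, hHF, hHG⟩ : ∃ F₁ G₁ H : (BaseField p)[X], IsRelPrime F₁ G₁ ∧
      H * F₁ = F.map WittVector.constantCoeff ∧ H * G₁ = G.map WittVector.constantCoeff := by
    rcases hne with h0 | h0
    · exact UniqueFactorizationMonoid.exists_reduced_factors _ h0 _
    · exact UniqueFactorizationMonoid.exists_reduced_factors' _ _ h0
  rw [isRelPrime_iff_isCoprime] at hFG
  have hH0 : H ≠ 0 := by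
    rintro rfl
    rw [zero_mul] at hHF hHG
    exact hne.elim (fun h => h hHF.symm) (fun h => h hHG.symm)
  -- over the perfect field `k`, a polynomial with derivative zero is a `p`-th power
  suffices hs : derivative F₁ = 0 ∧ derivative G₁ = 0 ∧ max F₁.natDegree G₁.natDegree ≤ p * d by
    obtain ⟨hF', hG', hdeg'⟩ := hs
    obtain ⟨P, rfl⟩ := exists_pow_eq_of_derivative_eq_zero (p := p) hF'
    obtain ⟨Q, rfl⟩ := exists_pow_eq_of_derivative_eq_zero (p := p) hG'
    rw [natDegree_pow, natDegree_pow, max_le_iff] at hdeg'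
    exact ⟨H, P, Q, hH0, (IsCoprime.pow_iff hp.pos hp.pos).mp hFG, hHF.symm, hHG.symm,
      Nat.le_of_mul_le_mul_left hdeg'.1 hp.pos, Nat.le_of_mul_le_mul_left hdeg'.2 hp.pos⟩
  by_cases hM : max F₁.natDegree G₁.natDegree = 0
  · rw [Nat.max_eq_zero_iff] at hM
    refine ⟨derivative_of_natDegree_zero hM.1, derivative_of_natDegree_zero hM.2, ?_⟩
    rw [hM.1, hM.2]
    simp
  have hG₁0 : G₁ ≠ 0 := by
    rintro rfl
    rw [isCoprime_zero_right] at hFG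
    exact hM (by rw [natDegree_eq_zero_of_isUnit hFG]; simp)
  have hGτ : G₁.eval₂ σ₀ τ ≠ 0 := by
    intro h0
    exact hG₁0 ((map_eq_zero_iff _ hd₀.injective).mp h0)
  have hHτ : H.eval₂ σ₀ τ ≠ 0 := by
    intro h0
    exact hH0 ((map_eq_zero_iff _ hd₀.injective).mp h0)
  -- `φ` is the image of the affine coordinate under `ψ₀`
  set φ := F₁.eval₂ σ₀ τ / G₁.eval₂ σ₀ τ with hφ
  have hφG : φ * G₁.eval₂ σ₀ τ = F₁.eval₂ σ₀ τ := div_mul_cancel₀ _ hGτ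
  have hφc : HasCoords σ ((pt ≫ ι) ≫ ψ ≫ U.ι) ![φ, 1] := by
    have h1 := hv.smul (c := (H.eval₂ σ₀ τ * G₁.eval₂ σ₀ τ)⁻¹)
      (isUnit_iff_ne_zero.mpr (inv_ne_zero (mul_ne_zero hHτ hGτ)))
    convert h1 using 1
    rw [← hHF, ← hHG, eval₂_mul, eval₂_mul]
    ext k
    rcases eq_zero_or_eq_one k with rfl | rfl
    · simp only [Matrix.cons_val_zero, Pi.smul_apply, smul_eq_mul, hφ]
      field_simp
    · simp only [Matrix.cons_val_one, Matrix.cons_val_zero, Pi.smul_apply, smul_eq_mul]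
      exact (inv_mul_cancel₀ (mul_ne_zero hHτ hGτ)).symm
  have hinj := injective_eval₂_of_isCoprime hd₀.injective hFG (Nat.pos_of_ne_zero hM) hφG
  -- `φ` is transcendental, so `ψ₀` fixes the generic point of the central fibre
  have hψξ : U.ι (ι (ψ₀ ξ)) = chart (W p) 1 (centralPrime p) := by
    let y : Spec ((centralFibre (openStr U)).residueField ξ) :=
      IsLocalRing.closedPoint ((centralFibre (openStr U)).residueField ξ)
    have h1 : ((pt ≫ ι) ≫ ψ ≫ U.ι) y = U.ι (ι (ψ₀ ξ)) := by
      have h2 : (pt ≫ ι) ≫ ψ ≫ U.ι = pt ≫ ψ₀ ≫ ι ≫ U.ι := by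
        rw [Category.assoc, reassoc_of% hcomm]
      rw [h2, Scheme.Hom.comp_apply, Scheme.fromSpecResidueField_apply]
      rfl
    rw [← h1, hφc.eq_point 1 (by simp), point_eq_specMap_chart σ _ 1 0 (by decide) rfl,
      Scheme.Hom.comp_apply]
    congr 1
    refine PrimeSpectrum.ext ?_
    change Ideal.comap (eval₂RingHom σ φ) (IsLocalRing.maximalIdeal _) =
      RingHom.ker (mapRingHom WittVector.constantCoeff)
    ext P
    rw [Ideal.mem_comap, IsLocalRing.mem_maximalIdeal, mem_nonunits_iff, isUnit_iff_ne_zero,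
      not_not, RingHom.mem_ker, coe_eval₂RingHom, ← hσ₀, ← eval₂_map]
    exact map_eq_zero_iff _ hinj
  have hfix : ψ₀ ξ = ξ := by
    have h1 : U.ι (ι (ψ₀ ξ)) = U.ι (ι ξ) := hψξ.trans hξc.symm
    exact (IsClosedImmersion.isClosedEmbedding ι).injective (U.ι.isOpenEmbedding.injective h1)
  have hdom : IsDominant ψ₀ := by
    constructor
    rw [DenseRange, dense_iff_closure_eq, ← Set.univ_subset_iff, ← hξ.def]
    refine closure_mono ?_
    rw [Set.singleton_subset_iff]
    exact ⟨ξ, hfix⟩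
  obtain ⟨σ', τ', hc', hd'⟩ := exists_isResidueData_centralFibre U.ι hψξ
  obtain ⟨σ₀', hσ₀', hd₀'⟩ := hd'.exists_lift_of_surjective constantCoeff_surjective
  let f := (ψ₀.residueFieldMap ξ).hom
  have hw := hc'.specMap f
  rw [CommRingCat.ofHom_hom, Scheme.Hom.SpecMap_residueFieldMap_fromSpecResidueField_assoc,
    ← hι, reassoc_of% hcomm, ← Category.assoc] at hw
  have hf : f.comp σ' = σ :=
    CommRingCat.hom_ext_iff.mp (Spec.map_injective (hw.str.symm.trans hφc.str))
  have hfτ : f τ' = φ := by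
    have := hw.proportional hφc
    simpa using this
  have hf₀ : f.comp σ₀' = σ₀ := by
    refine RingHom.ext fun c => ?_
    obtain ⟨c, rfl⟩ := constantCoeff_surjective c
    have h1 := RingHom.congr_fun hf c
    rw [← hσ₀, ← hσ₀'] at h1
    exact h1
  have hrank := finrank_eq_max_natDegree hd₀' hd₀ f hf₀ hFG hG₁0 (by rw [hfτ, hφG])
  have hle : max F₁.natDegree G₁.natDegree ≤ p * d := by
    rcases hdeg with ⟨-, h1⟩ | ⟨h1, -⟩
    · rw [← hrank, ← h1]
      exact le_rfl
    · exact absurd hdom h1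
  -- `d/dT` kills `φ`, so the Wronskian of `F₁` and `G₁` vanishes
  obtain ⟨D, hD⟩ := hd₀.exists_derivation
  have hDφ : D φ = 0 := by
    rw [← hfτ]
    refine hdiff.derivation_residueFieldMap_eq_zero ξ
      (σ := σ₀) ?_ D (fun c => ?_) τ'
    · rw [← cancel_mono (specKToSpecW p), Category.assoc, ← pullback.condition]
      have h1 := hc.str
      rw [← hσ₀, CommRingCat.ofHom_comp, Spec.map_comp] at h1
      refine h1.symm.trans ?_
      simp only [Category.assoc]
    · have := hD (C c)
      rw [eval₂_C] at this
      rw [this, derivative_C, eval₂_zero]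
  have hwr : wronskian F₁ G₁ = 0 := by
    have h1 := congrArg D hφG
    rw [Derivation.leibniz, hDφ, smul_zero, add_zero, hD, hD, smul_eq_mul] at h1
    apply hd₀.injective
    rw [wronskian, map_zero, map_sub, map_mul, map_mul]
    simp only [coe_eval₂RingHom]
    rw [← h1, ← hφG]
    ring
  exact ⟨(hFG.wronskian_eq_zero_iff.mp hwr).1, (hFG.wronskian_eq_zero_iff.mp hwr).2, hle⟩

end SpecialFibre

/-! ### Forms over the Witt vectors of length two -/

section LengthTwo

variable {p : ℕ} [Fact p.Prime]

lemma residueW₂_comp_truncate :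
    (residueW₂ p).comp (WittVector.truncate 2) = WittVector.constantCoeff :=
  RingHom.ext fun x => WittVector.coeff_truncate x 0

lemma residueW₂_surjective : Function.Surjective (residueW₂ p) := by
  have h := constantCoeff_surjective (p := p)
  rw [← residueW₂_comp_truncate, RingHom.coe_comp] at h
  exact h.of_comp

instance : Nontrivial (W₂ p) := (residueW₂ p).domain_nontrivial

instance : IsLocalRing (W₂ p) :=
  IsLocalRing.of_surjective' (WittVector.truncate 2 : W p →+* W₂ p)
    (WittVector.truncate_surjective p 2 _)

lemma constantCoeff_eq_zero_iff (a : W p) : WittVector.constantCoeff a = 0 ↔ (p : W p) ∣ a := by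
  rw [← Ideal.mem_span_singleton]
  exact (WittVector.mem_span_p_iff_coeff_zero_eq_zero a).symm

lemma truncate_eq_zero_iff (a : W p) :
    (WittVector.truncate 2 a : W₂ p) = 0 ↔ (p : W p) ^ 2 ∣ a := by
  rw [← Ideal.mem_span_singleton, ← RingHom.mem_ker, WittVector.mem_ker_truncate,
    WittVector.mem_span_p_pow_iff_le_coeff_eq_zero]

lemma natCast_ne_zero_W : (p : W p) ≠ 0 := WittVector.p_nonzero p _

lemma natCast_mul_eq_zero_iff (b : W₂ p) : (p : W₂ p) * b = 0 ↔ residueW₂ p b = 0 := by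
  obtain ⟨a, rfl⟩ := WittVector.truncate_surjective p 2 _ b
  rw [← RingHom.comp_apply, residueW₂_comp_truncate, constantCoeff_eq_zero_iff,
    ← map_natCast (WittVector.truncate 2 : W p →+* W₂ p), ← map_mul, truncate_eq_zero_iff, sq,
    mul_dvd_mul_iff_left natCast_ne_zero_W]

lemma residueW₂_eq_zero_iff (b : W₂ p) : residueW₂ p b = 0 ↔ (p : W₂ p) ∣ b := by
  constructor
  · intro h
    obtain ⟨a, rfl⟩ := WittVector.truncate_surjective p 2 _ b
    rw [← RingHom.comp_apply, residueW₂_comp_truncate, constantCoeff_eq_zero_iff] at h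
    rw [← map_natCast (WittVector.truncate 2 : W p →+* W₂ p)]
    exact map_dvd _ h
  · rintro ⟨c, rfl⟩
    rw [map_mul, map_natCast, CharP.cast_eq_zero, zero_mul]

lemma residueW₂_natCast : residueW₂ p (p : W₂ p) = 0 := by
  rw [map_natCast, CharP.cast_eq_zero]

lemma natCast_sq_W₂ : (p : W₂ p) ^ 2 = 0 := by
  rw [sq, natCast_mul_eq_zero_iff, residueW₂_natCast]

/-- `p`-th powers in `W₂(k)` only depend on residues. -/
lemma pow_eq_pow_of_residueW₂_eq {s t : W₂ p} (h : residueW₂ p s = residueW₂ p t) :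
    s ^ p = t ^ p := by
  rw [← sub_eq_zero, ← map_sub, residueW₂_eq_zero_iff] at h
  have := dvd_sub_pow_of_dvd_sub h 1
  rwa [natCast_sq_W₂, pow_one, zero_dvd_iff, sub_eq_zero] at this

end LengthTwo

section Expansion

variable {p : ℕ} [Fact p.Prime]

lemma exists_lift_natDegree_le (P : (BaseField p)[X]) :
    ∃ P' : (W p)[X], P'.map WittVector.constantCoeff = P ∧ P'.natDegree ≤ P.natDegree := by
  obtain ⟨P', h1, h2⟩ := exists_degree_eq_of_mem_lifts
    (show P ∈ lifts (WittVector.constantCoeff : W p →+* BaseField p) from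
      (lifts_iff_coeff_lifts _).mpr fun n => constantCoeff_surjective _)
  exact ⟨P', h1, (natDegree_eq_of_degree_eq h2).le⟩

/-- The forms `F`, `G` of degree `n` are `H * P ^ p` and `H * Q ^ p` modulo `p`, where `H` and
`P`, `Q` have degree at most `m` and `δ`; the corrections are `p * F₂` and `p * G₂`. -/
structure IsFrobeniusExpansion (n m δ : ℕ) (F G H P Q F₂ G₂ : (W p)[X]) : Prop where
  degree_add : m + p * δ = n
  natDegree_H : H.natDegree ≤ m
  natDegree_P : P.natDegree ≤ δ
  natDegree_Q : Q.natDegree ≤ δ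
  natDegree_F₂ : F₂.natDegree ≤ n
  natDegree_G₂ : G₂.natDegree ≤ n
  eq_F : F = H * P ^ p + C (p : W p) * F₂
  eq_G : G = H * Q ^ p + C (p : W p) * G₂

/-- Polynomials over `W(k)` with the same reduction differ by `p` times a polynomial. -/
lemma exists_correction {n : ℕ} {F F' : (W p)[X]} (hF : F.natDegree ≤ n) (hF' : F'.natDegree ≤ n)
    (h : F.map WittVector.constantCoeff = F'.map WittVector.constantCoeff) :
    ∃ F₂ : (W p)[X], F₂.natDegree ≤ n ∧ F = F' + C (p : W p) * F₂ := by
  have h1 : C (p : W p) ∣ F - F' := by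
    rw [C_dvd_iff_dvd_coeff]
    intro i
    rw [← constantCoeff_eq_zero_iff, ← coeff_map, Polynomial.map_sub, h, sub_self, coeff_zero]
  obtain ⟨F₂, h2⟩ := h1
  refine ⟨F₂, ?_, by rw [← h2]; ring⟩
  rw [← natDegree_C_mul (natCast_ne_zero_W (p := p)), ← h2]
  exact (natDegree_sub_le_of_le hF hF').trans (max_self n).le

lemma exists_isFrobeniusExpansion {n δ : ℕ} {F G : (W p)[X]} (hF : F.natDegree ≤ n)
    (hG : G.natDegree ≤ n) {H P Q : (BaseField p)[X]} (hH : H ≠ 0)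
    (hδ : max P.natDegree Q.natDegree = δ) (hPQ : IsCoprime P Q)
    (hFH : F.map WittVector.constantCoeff = H * P ^ p)
    (hGH : G.map WittVector.constantCoeff = H * Q ^ p) :
    ∃ (m : ℕ) (H' P' Q' F₂ G₂ : (W p)[X]), IsFrobeniusExpansion n m δ F G H' P' Q' F₂ G₂ ∧
      H'.map WittVector.constantCoeff = H ∧ P'.map WittVector.constantCoeff = P ∧
      Q'.map WittVector.constantCoeff = Q := by
  obtain ⟨H', hH', hH'd⟩ := exists_lift_natDegree_le H
  obtain ⟨P', hP', hP'd⟩ := exists_lift_natDegree_le P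
  obtain ⟨Q', hQ', hQ'd⟩ := exists_lift_natDegree_le Q
  have key : ∀ {P : (BaseField p)[X]} {F : (W p)[X]}, F.natDegree ≤ n →
      F.map WittVector.constantCoeff = H * P ^ p → P ≠ 0 →
      H.natDegree + p * P.natDegree ≤ n := by
    intro P F hF h h0
    rw [← natDegree_pow, ← natDegree_mul hH (pow_ne_zero _ h0), ← h]
    exact natDegree_map_le.trans hF
  have hdeg : H.natDegree + p * δ ≤ n := by
    by_cases hP0 : P = 0
    · have hQ0 : Q ≠ 0 := by
        rintro rfl
        rw [hP0] at hPQ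
        exact not_isCoprime_zero_zero hPQ
      rw [hP0, natDegree_zero, Nat.zero_max] at hδ
      rw [← hδ]
      exact key hG hGH hQ0
    by_cases hQ0 : Q = 0
    · rw [hQ0, natDegree_zero, Nat.max_zero] at hδ
      rw [← hδ]
      exact key hF hFH hP0
    rcases max_choice P.natDegree Q.natDegree with h | h
    · rw [← hδ, h]
      exact key hF hFH hP0
    · rw [← hδ, h]
      exact key hG hGH hQ0
  have hP'δ : P'.natDegree ≤ δ := hP'd.trans (hδ ▸ le_max_left _ _)
  have hQ'δ : Q'.natDegree ≤ δ := hQ'd.trans (hδ ▸ le_max_right _ _)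
  have hmul : ∀ {P : (W p)[X]}, P.natDegree ≤ δ → (H' * P ^ p).natDegree ≤ n := by
    intro P hP
    refine natDegree_mul_le.trans ((Nat.add_le_add hH'd ?_).trans hdeg)
    exact natDegree_pow_le.trans (Nat.mul_le_mul_left p hP)
  obtain ⟨F₂, hF₂, hFeq⟩ := exists_correction hF (hmul hP'δ)
    (by rw [Polynomial.map_mul, Polynomial.map_pow, hH', hP', hFH])
  obtain ⟨G₂, hG₂, hGeq⟩ := exists_correction hG (hmul hQ'δ)
    (by rw [Polynomial.map_mul, Polynomial.map_pow, hH', hQ', hGH])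
  exact ⟨n - p * δ, H', P', Q', F₂, G₂, ⟨by omega, by omega, hP'δ, hQ'δ, hF₂, hG₂, hFeq, hGeq⟩,
    hH', hP', hQ'⟩

namespace IsFrobeniusExpansion

variable {n m δ : ℕ} {F G H P Q F₂ G₂ : (W p)[X]}

lemma formEval_left (h : IsFrobeniusExpansion n m δ F G H P Q F₂ G₂) {B : Type*} [CommRing B]
    (ρ : W p →+* B) (u : Fin 2 → B) :
    formEval ρ n F u = formEval ρ m H u * formEval ρ δ P u ^ p + p * formEval ρ n F₂ u := by
  rw [h.eq_F, formEval_add, formEval_C_mul, map_natCast, ← h.degree_add,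
    formEval_mul ρ h.natDegree_H (natDegree_pow_le_of_le p h.natDegree_P),
    formEval_pow ρ h.natDegree_P]

lemma symm (h : IsFrobeniusExpansion n m δ F G H P Q F₂ G₂) :
    IsFrobeniusExpansion n m δ G F H Q P G₂ F₂ :=
  ⟨h.1, h.2, h.4, h.3, h.6, h.5, h.8, h.7⟩

lemma formEval_right (h : IsFrobeniusExpansion n m δ F G H P Q F₂ G₂) {B : Type*} [CommRing B]
    (ρ : W p →+* B) (u : Fin 2 → B) :
    formEval ρ n G u = formEval ρ m H u * formEval ρ δ Q u ^ p + p * formEval ρ n G₂ u :=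
  h.symm.formEval_left ρ u

lemma formEval_left_of_charP (h : IsFrobeniusExpansion n m δ F G H P Q F₂ G₂) {k : Type*}
    [CommRing k] [CharP k p] (ρ : W p →+* k) (u : Fin 2 → k) :
    formEval ρ n F u = formEval ρ m H u * formEval ρ δ P u ^ p := by
  rw [h.formEval_left, CharP.cast_eq_zero, zero_mul, add_zero]

lemma formEval_right_of_charP (h : IsFrobeniusExpansion n m δ F G H P Q F₂ G₂) {k : Type*}
    [CommRing k] [CharP k p] (ρ : W p →+* k) (u : Fin 2 → k) :
    formEval ρ n G u = formEval ρ m H u * formEval ρ δ Q u ^ p :=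
  h.symm.formEval_left_of_charP ρ u

/-- The condition for `(F(a) : G(a))` and `(F'(b) : G'(b))` to agree in `ℙ¹(W₂(k))`. As `P(a) ^ p`
and `Q(a) ^ p` only depend on the residue of `a`, it is a condition on the residues of `a`
and `b`. -/
lemma proportional_iff (h : IsFrobeniusExpansion n m δ F G H P Q F₂ G₂)
    {m' ε : ℕ} {F' G' H' P' Q' F₂' G₂' : (W p)[X]}
    (h' : IsFrobeniusExpansion n m' ε F' G' H' P' Q' F₂' G₂') (a b : Fin 2 → W₂ p)
    (ha : formEval WittVector.constantCoeff m H (residueW₂ p ∘ a) ≠ 0)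
    (hb : formEval WittVector.constantCoeff m' H' (residueW₂ p ∘ b) ≠ 0) :
    formEval (WittVector.truncate 2) n F a * formEval (WittVector.truncate 2) n G' b =
      formEval (WittVector.truncate 2) n G a * formEval (WittVector.truncate 2) n F' b ↔
    formEval WittVector.constantCoeff δ P (residueW₂ p ∘ a) *
        formEval WittVector.constantCoeff ε Q' (residueW₂ p ∘ b) =
      formEval WittVector.constantCoeff δ Q (residueW₂ p ∘ a) *
        formEval WittVector.constantCoeff ε P' (residueW₂ p ∘ b) ∧
    formEval WittVector.constantCoeff n F (residueW₂ p ∘ a) *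
        formEval WittVector.constantCoeff n G₂' (residueW₂ p ∘ b) +
      formEval WittVector.constantCoeff n F₂ (residueW₂ p ∘ a) *
        formEval WittVector.constantCoeff n G' (residueW₂ p ∘ b) -
      formEval WittVector.constantCoeff n G (residueW₂ p ∘ a) *
        formEval WittVector.constantCoeff n F₂' (residueW₂ p ∘ b) -
      formEval WittVector.constantCoeff n G₂ (residueW₂ p ∘ a) *
        formEval WittVector.constantCoeff n F' (residueW₂ p ∘ b) = 0 := by
  have hr : ∀ (l : ℕ) (S : (W p)[X]) (c : Fin 2 → W₂ p),
      formEval WittVector.constantCoeff l S (residueW₂ p ∘ c) =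
        residueW₂ p (formEval (WittVector.truncate 2) l S c) := by
    intro l S c
    rw [map_formEval, residueW₂_comp_truncate]
  rw [h.formEval_left_of_charP (k := BaseField p), h.formEval_right_of_charP (k := BaseField p),
    h'.formEval_left_of_charP (k := BaseField p), h'.formEval_right_of_charP (k := BaseField p),
    h.formEval_left, h.formEval_right, h'.formEval_left, h'.formEval_right]
  simp only [hr] at ha hb ⊢
  generalize formEval (WittVector.truncate 2) m H a = c at *
  generalize formEval (WittVector.truncate 2) m' H' b = c' at *
  generalize formEval (WittVector.truncate 2) δ P a = s at *
  generalize formEval (WittVector.truncate 2) δ Q a = t at *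
  generalize formEval (WittVector.truncate 2) ε P' b = s' at *
  generalize formEval (WittVector.truncate 2) ε Q' b = t' at *
  generalize formEval (WittVector.truncate 2) n F₂ a = f at *
  generalize formEval (WittVector.truncate 2) n G₂ a = g at *
  generalize formEval (WittVector.truncate 2) n F₂' b = f' at *
  generalize formEval (WittVector.truncate 2) n G₂' b = g' at *
  have hp2 : (p : W₂ p) ^ 2 = 0 := natCast_sq_W₂
  have hE : residueW₂ p (c * s ^ p * g' + f * (c' * t' ^ p) - c * t ^ p * f' - g * (c' * s' ^ p)) =
      residueW₂ p c * residueW₂ p s ^ p * residueW₂ p g' +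
        residueW₂ p f * (residueW₂ p c' * residueW₂ p t' ^ p) -
        residueW₂ p c * residueW₂ p t ^ p * residueW₂ p f' -
        residueW₂ p g * (residueW₂ p c' * residueW₂ p s' ^ p) := by
    simp only [map_sub, map_add, map_mul, map_pow]
  rw [← hE, ← natCast_mul_eq_zero_iff]
  have hmain : residueW₂ p s * residueW₂ p t' = residueW₂ p t * residueW₂ p s' →
      ((c * s ^ p + p * f) * (c' * t' ^ p + p * g') = (c * t ^ p + p * g) * (c' * s' ^ p + p * f') ↔
      p * (c * s ^ p * g' + f * (c' * t' ^ p) - c * t ^ p * f' - g * (c' * s' ^ p)) = 0) := by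
    intro hC
    have h1 : (s * t') ^ p = (t * s') ^ p :=
      pow_eq_pow_of_residueW₂_eq (by rw [map_mul, map_mul, hC])
    rw [mul_pow, mul_pow] at h1
    constructor
    · intro h2
      linear_combination h2 - c * c' * h1 + (g * f' - f * g') * hp2
    · intro h2
      linear_combination h2 + c * c' * h1 - (g * f' - f * g') * hp2
  refine ⟨fun h0 => ?_, fun h0 => (hmain h0.1).mpr h0.2⟩
  suffices hC : residueW₂ p s * residueW₂ p t' = residueW₂ p t * residueW₂ p s' from
    ⟨hC, (hmain hC).mp h0⟩
  have h1 := congrArg (residueW₂ p) h0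
  simp only [map_add, map_mul, map_pow, residueW₂_natCast, zero_mul, add_zero] at h1
  apply frobenius_inj (BaseField p) p
  rw [frobenius_def, frobenius_def, mul_pow, mul_pow]
  refine mul_left_cancel₀ (mul_ne_zero ha hb) ?_
  linear_combination h1

end IsFrobeniusExpansion

end Expansion

/-! ### Points of length two and the image in the diagonal -/

section LengthTwoPoints

variable {p : ℕ} [Fact p.Prime]

/-- All but finitely many `k`-points of the affine line lift to `W₂(k)`-points of `U`. -/
lemma ContainsCentralGenericPoint.exists_lift {U : (P1 (W p)).Opens}
    (hU : ContainsCentralGenericPoint U) :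
    ∃ g : (BaseField p)[X], g ≠ 0 ∧ ∀ x : BaseField p, g.eval x ≠ 0 →
      ∃ (a : specW₂ p ⟶ U.toScheme) (u : Fin 2 → W₂ p),
        HasCoords (WittVector.truncate 2) (a ≫ U.ι) u ∧ residueW₂ p ∘ u = ![x, 1] := by
  have hopen : IsOpen ((chart (W p) 1) ⁻¹' (U : Set (P1 (W p)))) :=
    U.isOpen.preimage (chart (W p) 1).continuous
  obtain ⟨_, ⟨g, rfl⟩, hg, hgU⟩ :=
    PrimeSpectrum.isTopologicalBasis_basic_opens.exists_subset_of_mem_open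
      (show centralPrime p ∈ _ from hU.mem) hopen
  refine ⟨g.map WittVector.constantCoeff, hg, fun x hx => ?_⟩
  obtain ⟨w, rfl⟩ := residueW₂_surjective x
  -- send the affine coordinate `T` to a lift `w` of `x`
  let ev : (W p)[X] →+* W₂ p := eval₂RingHom (WittVector.truncate 2) w
  have hev : ∀ P : (W p)[X], residueW₂ p (ev P) =
      (P.map WittVector.constantCoeff).eval (residueW₂ p w) := by
    intro P
    rw [coe_eval₂RingHom, hom_eval₂, residueW₂_comp_truncate, Polynomial.eval_map]
  let m : specW₂ p ⟶ P1 (W p) := Spec.map (CommRingCat.ofHom ev) ≫ chart (W p) 1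
  have hrange : Set.range m ⊆ Set.range U.ι := by
    have hcl : m (IsLocalRing.closedPoint (W₂ p)) ∈ U := by
      let q : PrimeSpectrum (W p)[X] :=
        Spec.map (CommRingCat.ofHom ev) (IsLocalRing.closedPoint (W₂ p))
      have hq : q ∈ PrimeSpectrum.basicOpen g := by
        change ¬ (ev g ∈ IsLocalRing.maximalIdeal (W₂ p))
        have hker : (RingHom.ker (residueW₂ p)).IsMaximal :=
          RingHom.ker_isMaximal_of_surjective _ residueW₂_surjective
        rw [← IsLocalRing.eq_maximalIdeal hker, RingHom.mem_ker, hev]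
        exact hx
      exact hgU hq
    have htop := Scheme.preimage_eq_top_of_closedPoint_mem m hcl
    rintro _ ⟨z, rfl⟩
    rw [Scheme.Opens.range_ι]
    have : z ∈ (⊤ : (specW₂ p).Opens) := trivial
    rw [← htop] at this
    exact this
  refine ⟨IsOpenImmersion.lift U.ι m hrange, ev ∘ chartCoord (W p) 1, ?_, ?_⟩
  · rw [IsOpenImmersion.lift_fac]
    have h1 : HasCoords C (chart (W p) 1) (chartCoord (W p) 1) := ⟨1, isUnit_chartCoord 1, rfl⟩
    have h2 := h1.specMap ev
    have h3 : ev.comp C = WittVector.truncate 2 := by ext; simp [ev]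
    rwa [h3] at h2
  · ext k
    rcases eq_zero_or_eq_one k with rfl | rfl <;> simp [chartCoord, ev]

variable {U₁ U₂ : (P1 (W p)).Opens} {ψ₁ : U₁.toScheme ⟶ U₁.toScheme}
  {h₁ : ψ₁ ≫ openStr U₁ = openStr U₁} {ψ₂ : U₂.toScheme ⟶ U₂.toScheme}
  {h₂ : ψ₂ ≫ openStr U₂ = openStr U₂}

lemma prodMap_prodι_fst : prodMap ψ₁ h₁ ψ₂ h₂ ≫ prodι U₁ U₂ ≫ pullback.fst _ _ =
    pullback.fst _ _ ≫ ψ₁ ≫ U₁.ι := by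
  rw [pullback.lift_fst, pullback.lift_fst_assoc, Category.assoc]

lemma prodMap_prodι_snd : prodMap ψ₁ h₁ ψ₂ h₂ ≫ prodι U₁ U₂ ≫ pullback.snd _ _ =
    pullback.snd _ _ ≫ ψ₂ ≫ U₂.ι := by
  rw [pullback.lift_snd, pullback.lift_snd_assoc, Category.assoc]

/-- A `W₂(k)`-point of `U₁ × U₂` whose image lies on the diagonal is a pair of `W₂(k)`-points with
the same image in `ℙ¹`. -/
lemma mem_diagonalImage_iff {c : specK p ⟶ P1xP1 p} : c ∈ diagonalImage ψ₁ h₁ ψ₂ h₂ ↔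
    ∃ (a₁ : specW₂ p ⟶ U₁.toScheme) (a₂ : specW₂ p ⟶ U₂.toScheme),
      a₁ ≫ openStr U₁ = specW₂ToSpecW p ∧ a₂ ≫ openStr U₂ = specW₂ToSpecW p ∧
      a₁ ≫ ψ₁ ≫ U₁.ι = a₂ ≫ ψ₂ ≫ U₂.ι ∧ c = specKToSpecW₂ p ≫ a₁ ≫ ψ₁ ≫ U₁.ι ≫ diag p := by
  constructor
  · rintro ⟨a, ha, ⟨b, hb⟩, rfl⟩
    have hb₁ : b = (a ≫ pullback.fst _ _) ≫ ψ₁ ≫ U₁.ι := by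
      have := congrArg (· ≫ pullback.fst _ _) hb
      simp only [Category.assoc, prodMap_prodι_fst, pullback.diagonal_fst, Category.comp_id] at this
      rw [← this, Category.assoc]
    have hb₂ : b = (a ≫ pullback.snd _ _) ≫ ψ₂ ≫ U₂.ι := by
      have := congrArg (· ≫ pullback.snd _ _) hb
      simp only [Category.assoc, prodMap_prodι_snd, pullback.diagonal_snd, Category.comp_id] at this
      rw [← this, Category.assoc]
    refine ⟨a ≫ pullback.fst _ _, a ≫ pullback.snd _ _, ?_, ?_, hb₁.symm.trans hb₂, ?_⟩
    · rw [Category.assoc]; exact ha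
    · rw [Category.assoc, ← pullback.condition]; exact ha
    · rw [hb, hb₁]
      simp only [Category.assoc]
  · rintro ⟨a₁, a₂, ha₁, ha₂, hab, rfl⟩
    have key : pullback.lift a₁ a₂ (ha₁.trans ha₂.symm) ≫ prodMap ψ₁ h₁ ψ₂ h₂ ≫ prodι U₁ U₂ =
        (a₁ ≫ ψ₁ ≫ U₁.ι) ≫ diag p := by
      refine pullback.hom_ext ?_ ?_
      · simp only [Category.assoc, prodMap_prodι_fst, pullback.diagonal_fst, Category.comp_id]
        rw [pullback.lift_fst_assoc]
      · simp only [Category.assoc, prodMap_prodι_snd, pullback.diagonal_snd, Category.comp_id]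
        rw [pullback.lift_snd_assoc, hab]
    refine ⟨pullback.lift a₁ a₂ (ha₁.trans ha₂.symm), ?_, ⟨_, key⟩, ?_⟩
    · rw [pullback.lift_fst_assoc, ha₁]
    · rw [key]
      simp only [Category.assoc]

lemma HasCoords.ne_zero {A B : Type} [CommRing A] [CommRing B] [Nontrivial B] {ρ : A →+* B}
    {m : Spec (.of B) ⟶ P1 A} {v : Fin 2 → B} (h : HasCoords ρ m v) : v ≠ 0 := by
  rintro rfl
  obtain ⟨i, hi, -⟩ := h
  simp at hi

/-- Coordinates of the reduction of a `W₂(k)`-point. -/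
lemma HasCoords.reduction {a : specW₂ p ⟶ P1 (W p)} {u : Fin 2 → W₂ p}
    (h : HasCoords (WittVector.truncate 2) a u) :
    HasCoords WittVector.constantCoeff (specKToSpecW₂ p ≫ a) (residueW₂ p ∘ u) := by
  have := h.specMap (residueW₂ p)
  rwa [residueW₂_comp_truncate] at this

lemma HasCoords.reduction_formEval {n : ℕ} {F G : (W p)[X]} {u : Fin 2 → W₂ p}
    {a : specW₂ p ⟶ P1 (W p)}
    (h : HasCoords (WittVector.truncate 2) a ![formEval (WittVector.truncate 2) n F u,
      formEval (WittVector.truncate 2) n G u]) :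
    HasCoords WittVector.constantCoeff (specKToSpecW₂ p ≫ a)
      ![formEval WittVector.constantCoeff n F (residueW₂ p ∘ u),
        formEval WittVector.constantCoeff n G (residueW₂ p ∘ u)] := by
  convert h.reduction using 1
  ext k
  rcases eq_zero_or_eq_one k with rfl | rfl <;> simp [map_formEval, residueW₂_comp_truncate]

end LengthTwoPoints

/-! ### Counting by elimination -/

section Counting

variable {p : ℕ} [Fact p.Prime]

/-- Coprime polynomials that are not both constant are linearly independent. -/
lemma sub_ne_zero_of_isCoprime {k : Type*} [Field k] {P Q : k[X]} (h : IsCoprime P Q)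
    (hdeg : 0 < max P.natDegree Q.natDegree) {s t : k} (hst : s ≠ 0 ∨ t ≠ 0) :
    P * C s - Q * C t ≠ 0 := by
  intro h0
  rw [sub_eq_zero] at h0
  have hP : s ≠ 0 → Q ∣ P := fun hs =>
    ((isUnit_C.mpr (isUnit_iff_ne_zero.mpr hs)).dvd_mul_right).mp (h0 ▸ Dvd.intro _ rfl)
  have hQ : t ≠ 0 → P ∣ Q := fun ht =>
    ((isUnit_C.mpr (isUnit_iff_ne_zero.mpr ht)).dvd_mul_right).mp (h0 ▸ Dvd.intro _ rfl)
  rcases hst with hs | ht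
  · have hu : IsUnit Q := h.isUnit_of_dvd' (hP hs) dvd_rfl
    have ht : t ≠ 0 := by
      rintro rfl
      rw [C_0, mul_zero, mul_eq_zero, C_eq_zero] at h0
      rw [h0.resolve_right hs, natDegree_zero, natDegree_eq_zero_of_isUnit hu] at hdeg
      simp at hdeg
    have hu' : IsUnit P := h.isUnit_of_dvd' dvd_rfl (hQ ht)
    rw [natDegree_eq_zero_of_isUnit hu, natDegree_eq_zero_of_isUnit hu'] at hdeg
    simp at hdeg
  · have hu : IsUnit P := h.isUnit_of_dvd' dvd_rfl (hQ ht)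
    have hs : s ≠ 0 := by
      rintro rfl
      rw [C_0, mul_zero, eq_comm, mul_eq_zero, C_eq_zero] at h0
      rw [h0.resolve_right ht, natDegree_zero, natDegree_eq_zero_of_isUnit hu] at hdeg
      simp at hdeg
    have hu' : IsUnit Q := h.isUnit_of_dvd' (hP hs) dvd_rfl
    rw [natDegree_eq_zero_of_isUnit hu, natDegree_eq_zero_of_isUnit hu'] at hdeg
    simp at hdeg

lemma eval_ne_zero_or_of_isCoprime {k : Type*} [Field k] {P Q : k[X]} (h : IsCoprime P Q) (x : k) :
    P.eval x ≠ 0 ∨ Q.eval x ≠ 0 := by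
  by_contra! h0
  obtain ⟨a, b, hab⟩ := h
  have := congrArg (eval x) hab
  simp [h0.1, h0.2] at this

lemma coeff_ne_zero_or_of_max_natDegree {k : Type*} [Field k] {P Q : k[X]} {ε : ℕ}
    (h : max P.natDegree Q.natDegree = ε) (hε : 0 < ε) : P.coeff ε ≠ 0 ∨ Q.coeff ε ≠ 0 := by
  have key : ∀ P : k[X], P.natDegree = ε → P.coeff ε ≠ 0 := by
    rintro P rfl
    rw [coeff_natDegree, leadingCoeff_ne_zero]
    rintro rfl
    simp at hε
  rcases max_choice P.natDegree Q.natDegree with h1 | h1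
  · exact Or.inl (key P (h1.symm.trans h))
  · exact Or.inr (key Q (h1.symm.trans h))

lemma formEval_degree_zero {R S : Type*} [CommRing R] [CommRing S] (ρ : R →+* S) {f : R[X]}
    (hf : f.natDegree ≤ 0) (v : Fin 2 → S) : formEval ρ 0 f v = ρ (f.coeff 0) := by
  rw [eq_C_of_natDegree_le_zero hf, ← mul_one (C (f.coeff 0)), formEval_C_mul]
  simp [formEval]

variable {U₁ U₂ : (P1 (W p)).Opens} {ψ₁ : U₁.toScheme ⟶ U₁.toScheme}
  {h₁ : ψ₁ ≫ openStr U₁ = openStr U₁} {ψ₂ : U₂.toScheme ⟶ U₂.toScheme}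
  {h₂ : ψ₂ ≫ openStr U₂ = openStr U₂} {n m m' δ ε : ℕ}
  {F G H P Q F₂ G₂ F' G' H' P' Q' F₂' G₂' : (W p)[X]}

lemma IsFrobeniusExpansion.formEval_ne_zero (h : IsFrobeniusExpansion n m δ F G H P Q F₂ G₂)
    {b : specK p ⟶ P1 (W p)} {x : Fin 2 → BaseField p}
    (hb : HasCoords WittVector.constantCoeff b ![formEval WittVector.constantCoeff n F x,
      formEval WittVector.constantCoeff n G x]) :
    formEval WittVector.constantCoeff m H x ≠ 0 := by
  intro h0
  refine hb.ne_zero ?_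
  rw [h.formEval_left_of_charP, h.formEval_right_of_charP, h0, zero_mul, zero_mul]
  ext k
  rcases eq_zero_or_eq_one k with rfl | rfl <;> rfl

/-- The factors in the first variable of `F G₂' + F₂ G' - G F₂' - G₂ F'`, modulo `p`. -/
noncomputable def leftCoeffs (F F₂ G G₂ : (W p)[X]) : Fin 4 → (BaseField p)[X] :=
  ![F.map WittVector.constantCoeff, F₂.map WittVector.constantCoeff,
    -(G.map WittVector.constantCoeff), -(G₂.map WittVector.constantCoeff)]

/-- The factors in the second variable of `F G₂' + F₂ G' - G F₂' - G₂ F'`, modulo `p`. -/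
noncomputable def rightCoeffs (F' F₂' G' G₂' : (W p)[X]) : Fin 4 → (BaseField p)[X] :=
  ![G₂'.map WittVector.constantCoeff, G'.map WittVector.constantCoeff,
    F₂'.map WittVector.constantCoeff, F'.map WittVector.constantCoeff]

lemma formEval_map_constantCoeff (l : ℕ) (S : (W p)[X]) (x : Fin 2 → BaseField p) :
    formEval (RingHom.id _) l (S.map WittVector.constantCoeff) x =
      formEval WittVector.constantCoeff l S x := by
  rw [formEval_map, RingHom.id_comp]

lemma sum_leftCoeffs_mul_rightCoeffs (x y : Fin 2 → BaseField p) :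
    ∑ i, formEval (RingHom.id _) n (leftCoeffs F F₂ G G₂ i) x *
      formEval (RingHom.id _) n (rightCoeffs F' F₂' G' G₂' i) y =
    formEval WittVector.constantCoeff n F x * formEval WittVector.constantCoeff n G₂' y +
      formEval WittVector.constantCoeff n F₂ x * formEval WittVector.constantCoeff n G' y -
      formEval WittVector.constantCoeff n G x * formEval WittVector.constantCoeff n F₂' y -
      formEval WittVector.constantCoeff n G₂ x * formEval WittVector.constantCoeff n F' y := by
  have hneg : ∀ S : (BaseField p)[X], formEval (RingHom.id _) n (-S) x =
      - formEval (RingHom.id _) n S x := by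
    intro S
    rw [← zero_sub, formEval_sub, formEval_zero, zero_sub]
  simp only [Fin.sum_univ_four, leftCoeffs, rightCoeffs, Matrix.cons_val]
  rw [hneg, hneg]
  simp only [formEval_map_constantCoeff]
  ring

/-- Homogeneous coordinates of the points that define an element of the image in `Δ₀(k)`. -/
lemma exists_coords_of_mem_diagonalImage (hψ₁ : IsGivenBy ψ₁ n F G) (hψ₂ : IsGivenBy ψ₂ n F' G')
    (hE₁ : IsFrobeniusExpansion n m δ F G H P Q F₂ G₂)
    (hE₂ : IsFrobeniusExpansion n m' ε F' G' H' P' Q' F₂' G₂')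
    {c : specK p ⟶ P1xP1 p} (hc : c ∈ diagonalImage ψ₁ h₁ ψ₂ h₂) :
    ∃ (x y : Fin 2 → BaseField p) (b : specK p ⟶ P1 (W p)), c = b ≫ diag p ∧ x ≠ 0 ∧ y ≠ 0 ∧
      HasCoords WittVector.constantCoeff b ![formEval WittVector.constantCoeff n F x,
        formEval WittVector.constantCoeff n G x] ∧
      HasCoords WittVector.constantCoeff b ![formEval WittVector.constantCoeff n F' y,
        formEval WittVector.constantCoeff n G' y] ∧
      formEval WittVector.constantCoeff δ P x * formEval WittVector.constantCoeff ε Q' y =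
        formEval WittVector.constantCoeff δ Q x * formEval WittVector.constantCoeff ε P' y ∧
      ∑ i, formEval (RingHom.id _) n (leftCoeffs F F₂ G G₂ i) x *
        formEval (RingHom.id _) n (rightCoeffs F' F₂' G' G₂' i) y = 0 := by
  obtain ⟨a₁, a₂, ha₁, ha₂, hab, rfl⟩ := mem_diagonalImage_iff.mp hc
  obtain ⟨u, hu⟩ := exists_hasCoords (WittVector.truncate 2) (a₁ ≫ U₁.ι)
    ((Category.assoc _ _ _).trans ha₁)
  obtain ⟨v, hv⟩ := exists_hasCoords (WittVector.truncate 2) (a₂ ≫ U₂.ι)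
    ((Category.assoc _ _ _).trans ha₂)
  have hu' := hψ₁ _ a₁ _ u hu
  have hv' := hψ₂ _ a₂ _ v hv
  rw [← hab] at hv'
  have hx := hu'.reduction_formEval
  have hy := hv'.reduction_formEval
  have hrel := hu'.proportional hv'
  simp only [Matrix.cons_val_zero, Matrix.cons_val_one] at hrel
  have hCE := (hE₁.proportional_iff hE₂ u v (hE₁.formEval_ne_zero hx)
    (hE₂.formEval_ne_zero hy)).mp hrel
  refine ⟨residueW₂ p ∘ u, residueW₂ p ∘ v, _, ?_, hu.reduction.ne_zero, hv.reduction.ne_zero,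
    hx, hy, hCE.1, ?_⟩
  · simp only [Category.assoc]
  · rw [sum_leftCoeffs_mul_rightCoeffs]
    exact hCE.2

/-- If `(F : G)` is constant on the central fibre, there is at most one point. -/
lemma IsFrobeniusExpansion.eq_of_degree_zero (h : IsFrobeniusExpansion n m 0 F G H P Q F₂ G₂)
    {b b' : specK p ⟶ P1 (W p)} {x x' : Fin 2 → BaseField p}
    (hb : HasCoords WittVector.constantCoeff b ![formEval WittVector.constantCoeff n F x,
      formEval WittVector.constantCoeff n G x])
    (hb' : HasCoords WittVector.constantCoeff b' ![formEval WittVector.constantCoeff n F x',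
      formEval WittVector.constantCoeff n G x']) : b = b' := by
  refine hb.eq_of_proportional hb' ?_
  simp only [Matrix.cons_val_zero, Matrix.cons_val_one]
  simp only [h.formEval_left_of_charP, h.formEval_right_of_charP,
    formEval_degree_zero _ h.natDegree_P, formEval_degree_zero _ h.natDegree_Q]
  ring

lemma natDegree_leftCoeffs_le (hE : IsFrobeniusExpansion n m δ F G H P Q F₂ G₂)
    (hF : F.natDegree ≤ n) (hG : G.natDegree ≤ n) (i : Fin 4) :
    (leftCoeffs F F₂ G G₂ i).natDegree ≤ n := by
  have key : ∀ S : (W p)[X], S.natDegree ≤ n →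
      (S.map (WittVector.constantCoeff : W p →+* BaseField p)).natDegree ≤ n :=
    fun S hS => natDegree_map_le.trans hS
  fin_cases i
  · exact key F hF
  · exact key F₂ hE.natDegree_F₂
  · exact (natDegree_neg _).trans_le (key G hG)
  · exact (natDegree_neg _).trans_le (key G₂ hE.natDegree_G₂)

lemma natDegree_rightCoeffs_le (hE : IsFrobeniusExpansion n m δ F G H P Q F₂ G₂)
    (hF : F.natDegree ≤ n) (hG : G.natDegree ≤ n) (i : Fin 4) :
    (rightCoeffs F F₂ G G₂ i).natDegree ≤ n := by
  have key : ∀ S : (W p)[X], S.natDegree ≤ n →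
      (S.map (WittVector.constantCoeff : W p →+* BaseField p)).natDegree ≤ n :=
    fun S hS => natDegree_map_le.trans hS
  fin_cases i
  · exact key G₂ hE.natDegree_G₂
  · exact key G hG
  · exact key F₂ hE.natDegree_F₂
  · exact key F hF

/-- If the eliminant does not vanish, its degree bounds the number of points. -/
lemma ncard_diagonalImage_le_of_eliminant_ne_zero (hn : 0 < n)
    (hψ₁ : IsGivenBy ψ₁ n F G) (hψ₂ : IsGivenBy ψ₂ n F' G')
    (hF : F.natDegree ≤ n) (hG : G.natDegree ≤ n) (hF' : F'.natDegree ≤ n) (hG' : G'.natDegree ≤ n)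
    (hE₁ : IsFrobeniusExpansion n m δ F G H P Q F₂ G₂)
    (hE₂ : IsFrobeniusExpansion n m' ε F' G' H' P' Q' F₂' G₂')
    (hR : eliminant ε n (P.map (WittVector.constantCoeff : W p →+* BaseField p))
      (Q.map WittVector.constantCoeff) (P'.map WittVector.constantCoeff)
      (Q'.map WittVector.constantCoeff) (leftCoeffs F F₂ G G₂) (rightCoeffs F' F₂' G' G₂') ≠ 0)
    (hfin : (diagonalImage ψ₁ h₁ ψ₂ h₂).Finite) :
    (diagonalImage ψ₁ h₁ ψ₂ h₂).ncard ≤ ε * n + n * δ := by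
  have hdata : ∀ c, ∃ x : Fin 2 → BaseField p, c ∈ diagonalImage ψ₁ h₁ ψ₂ h₂ →
      ∃ (y : Fin 2 → BaseField p) (b : specK p ⟶ P1 (W p)), c = b ≫ diag p ∧ x ≠ 0 ∧ y ≠ 0 ∧
      HasCoords WittVector.constantCoeff b ![formEval WittVector.constantCoeff n F x,
        formEval WittVector.constantCoeff n G x] ∧
      HasCoords WittVector.constantCoeff b ![formEval WittVector.constantCoeff n F' y,
        formEval WittVector.constantCoeff n G' y] ∧
      formEval WittVector.constantCoeff δ P x * formEval WittVector.constantCoeff ε Q' y =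
        formEval WittVector.constantCoeff δ Q x * formEval WittVector.constantCoeff ε P' y ∧
      ∑ i, formEval (RingHom.id _) n (leftCoeffs F F₂ G G₂ i) x *
        formEval (RingHom.id _) n (rightCoeffs F' F₂' G' G₂' i) y = 0 := by
    intro c
    by_cases hc : c ∈ diagonalImage ψ₁ h₁ ψ₂ h₂
    · obtain ⟨x, h⟩ := exists_coords_of_mem_diagonalImage hψ₁ hψ₂ hE₁ hE₂ hc
      exact ⟨x, fun _ => h⟩
    · exact ⟨0, fun h => absurd h hc⟩
  choose x hx using hdata
  have hmap : ∀ {l : ℕ} {S : (W p)[X]}, S.natDegree ≤ l →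
      (S.map (WittVector.constantCoeff : W p →+* BaseField p)).natDegree ≤ l :=
    fun hS => natDegree_map_le.trans hS
  rw [Set.ncard_eq_toFinset_card _ hfin]
  refine card_le_of_formEval_eq_zero _ x (fun c hc => ?_) (fun c hc c' hc' h => ?_)
    (natDegree_eliminant_le (hmap hE₁.natDegree_P) (hmap hE₁.natDegree_Q)
      (natDegree_leftCoeffs_le hE₁ hF hG)) hR (fun c hc => ?_)
  · obtain ⟨y, b, -, h0, -⟩ := hx c (hfin.mem_toFinset.mp hc)
    exact h0
  · -- the first coordinate determines the point
    obtain ⟨y, b, rfl, h0, -, hb, -⟩ := hx c (hfin.mem_toFinset.mp hc)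
    obtain ⟨y', b', rfl, h0', -, hb', -⟩ := hx c' (hfin.mem_toFinset.mp hc')
    have hi : ∃ i, x (b ≫ diag p) i ≠ 0 := Function.ne_iff.mp h0
    obtain ⟨i, hi⟩ := hi
    have hsmul := eq_smul_of_proportional h (isUnit_iff_ne_zero.mpr hi)
    generalize x (b' ≫ diag p) i * _ = l at hsmul
    rw [hsmul, formEval_smul, formEval_smul] at hb'
    rw [hb.eq_of_proportional hb' (by
      simp only [Matrix.cons_val_zero, Matrix.cons_val_one]
      ring)]
  · obtain ⟨y, b, -, h0, hy0, -, -, hC, hsum⟩ := hx c (hfin.mem_toFinset.mp hc)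
    refine formEval_eliminant_eq_zero (hmap hE₁.natDegree_P) (hmap hE₁.natDegree_Q)
      (hmap hE₂.natDegree_P) (hmap hE₂.natDegree_Q) (natDegree_leftCoeffs_le hE₁ hF hG)
      (natDegree_rightCoeffs_le hE₂ hF' hG') hn h0 hy0 ?_ hsum
    simpa only [formEval_map_constantCoeff] using hC

end Counting

section VanishingEliminant

variable {p : ℕ} [Fact p.Prime] {U₁ U₂ : (P1 (W p)).Opens} {ψ₁ : U₁.toScheme ⟶ U₁.toScheme}
  {h₁ : ψ₁ ≫ openStr U₁ = openStr U₁} {ψ₂ : U₂.toScheme ⟶ U₂.toScheme}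
  {h₂ : ψ₂ ≫ openStr U₂ = openStr U₂} {n m m' δ ε : ℕ}
  {F G H P Q F₂ G₂ F' G' H' P' Q' F₂' G₂' : (W p)[X]}

lemma formEval_affine {l : ℕ} {S : (W p)[X]} (hS : S.natDegree ≤ l) (x : BaseField p) :
    formEval WittVector.constantCoeff l S ![x, 1] = (S.map WittVector.constantCoeff).eval x := by
  rw [formEval_of_eq_one _ hS (by rfl), Polynomial.eval_map]
  rfl

lemma formEval_id_affine {k : Type*} [Field k] {l : ℕ} {S : k[X]} (hS : S.natDegree ≤ l) (x : k) :
    formEval (RingHom.id k) l S ![x, 1] = S.eval x := by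
  rw [formEval_of_eq_one _ hS (by rfl)]
  rfl

lemma finite_setOf_eval_eq_zero {k : Type*} [Field k] {f : k[X]} (hf : f ≠ 0) :
    {x | f.eval x = 0}.Finite := by
  classical
  refine f.roots.toFinset.finite_toSet.subset fun x hx => ?_
  rw [Finset.mem_coe, Multiset.mem_toFinset, mem_roots hf]
  exact hx

/-- If the eliminant vanishes, almost every point of the first factor is the first coordinate of
a solution over `W₂(k)`, hence there are infinitely many points. -/
lemma infinite_diagonalImage_of_eliminant_eq_zero
    (hU₁ : ContainsCentralGenericPoint U₁) (hU₂ : ContainsCentralGenericPoint U₂)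
    (hψ₁ : IsGivenBy ψ₁ n F G) (hψ₂ : IsGivenBy ψ₂ n F' G')
    (hF : F.natDegree ≤ n) (hG : G.natDegree ≤ n) (hF' : F'.natDegree ≤ n) (hG' : G'.natDegree ≤ n)
    (hE₁ : IsFrobeniusExpansion n m δ F G H P Q F₂ G₂)
    (hE₂ : IsFrobeniusExpansion n m' ε F' G' H' P' Q' F₂' G₂')
    (hPQ : IsCoprime (P.map (WittVector.constantCoeff : W p →+* BaseField p))
      (Q.map WittVector.constantCoeff))
    (hPQ' : IsCoprime (P'.map (WittVector.constantCoeff : W p →+* BaseField p))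
      (Q'.map WittVector.constantCoeff))
    (hδ : max (P.map (WittVector.constantCoeff : W p →+* BaseField p)).natDegree
      (Q.map (WittVector.constantCoeff : W p →+* BaseField p)).natDegree = δ) (hδ0 : 0 < δ)
    (hε : max (P'.map (WittVector.constantCoeff : W p →+* BaseField p)).natDegree
      (Q'.map (WittVector.constantCoeff : W p →+* BaseField p)).natDegree = ε) (hε0 : 0 < ε)
    (hR : eliminant ε n (P.map (WittVector.constantCoeff : W p →+* BaseField p))
      (Q.map WittVector.constantCoeff) (P'.map WittVector.constantCoeff)
      (Q'.map WittVector.constantCoeff) (leftCoeffs F F₂ G G₂) (rightCoeffs F' F₂' G' G₂') = 0) :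
    (diagonalImage ψ₁ h₁ ψ₂ h₂).Infinite := by
  classical
  intro hfin
  obtain ⟨g₁, hg₁, hlift₁⟩ := hU₁.exists_lift
  obtain ⟨g₂, hg₂, hlift₂⟩ := hU₂.exists_lift
  set Pk := P.map (WittVector.constantCoeff : W p →+* BaseField p) with hPk
  set Qk := Q.map (WittVector.constantCoeff : W p →+* BaseField p) with hQk
  set Pk' := P'.map (WittVector.constantCoeff : W p →+* BaseField p) with hPk'
  set Qk' := Q'.map (WittVector.constantCoeff : W p →+* BaseField p) with hQk'
  have hPkd : Pk.natDegree ≤ δ := hδ ▸ le_max_left _ _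
  have hQkd : Qk.natDegree ≤ δ := hδ ▸ le_max_right _ _
  have hPkd' : Pk'.natDegree ≤ ε := hε ▸ le_max_left _ _
  have hQkd' : Qk'.natDegree ≤ ε := hε ▸ le_max_right _ _
  have hdeg : 0 < max Pk.natDegree Qk.natDegree := hδ ▸ hδ0
  -- the points of the first factor to be avoided: those that do not lift to `U₁`, those for which
  -- the solution in the second factor may be at infinity, and those for which it may fail to lift
  let g : (BaseField p)[X] := g₁ * (Pk * C (Qk'.coeff ε) - Qk * C (Pk'.coeff ε)) *
    ∏ y ∈ g₂.roots.toFinset, (Pk * C (Qk'.eval y) - Qk * C (Pk'.eval y))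
  have hg : g ≠ 0 := by
    refine mul_ne_zero (mul_ne_zero hg₁ ?_) (Finset.prod_ne_zero_iff.mpr fun y _ => ?_)
    · exact sub_ne_zero_of_isCoprime hPQ hdeg (coeff_ne_zero_or_of_max_natDegree hε hε0).symm
    · exact sub_ne_zero_of_isCoprime hPQ hdeg (eval_ne_zero_or_of_isCoprime hPQ' y).symm
  have hpoint : ∀ x : BaseField p, g.eval x ≠ 0 → ∃ b : specK p ⟶ P1 (W p),
      b ≫ diag p ∈ diagonalImage ψ₁ h₁ ψ₂ h₂ ∧
      HasCoords WittVector.constantCoeff b ![formEval WittVector.constantCoeff n F ![x, 1],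
        formEval WittVector.constantCoeff n G ![x, 1]] := by
    intro x hx
    rw [eval_mul, eval_mul, eval_prod] at hx
    have hx₁ : g₁.eval x ≠ 0 := left_ne_zero_of_mul (left_ne_zero_of_mul hx)
    have hx₂ := right_ne_zero_of_mul (left_ne_zero_of_mul hx)
    have hx₃ := Finset.prod_ne_zero_iff.mp (right_ne_zero_of_mul hx)
    rw [eval_sub, eval_mul, eval_mul, eval_C, eval_C] at hx₂
    obtain ⟨y, hC, hsum⟩ := exists_common_zero_of_eliminant_eq_zero hPkd' hQkd'
      (natDegree_rightCoeffs_le hE₂ hF' hG') hR x hx₂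
    have hy : g₂.eval y ≠ 0 := by
      intro hy
      have := hx₃ y (by rw [Multiset.mem_toFinset, mem_roots hg₂]; exact hy)
      rw [eval_sub, eval_mul, eval_mul, eval_C, eval_C] at this
      exact this (sub_eq_zero.mpr hC)
    obtain ⟨a₁, u, hu, hux⟩ := hlift₁ x hx₁
    obtain ⟨a₂, v, hv, hvy⟩ := hlift₂ y hy
    have hu' := hψ₁ _ a₁ _ u hu
    have hv' := hψ₂ _ a₂ _ v hv
    have hrx := hu'.reduction_formEval
    have hry := hv'.reduction_formEval
    have hrel := (hE₁.proportional_iff hE₂ u v (hE₁.formEval_ne_zero hrx)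
      (hE₂.formEval_ne_zero hry)).mpr (by
        rw [hux, hvy, ← sum_leftCoeffs_mul_rightCoeffs, formEval_affine hE₁.natDegree_P,
          formEval_affine hE₁.natDegree_Q, formEval_affine hE₂.natDegree_P,
          formEval_affine hE₂.natDegree_Q]
        refine ⟨hC, ?_⟩
        rw [← hsum]
        refine Finset.sum_congr rfl fun i _ => ?_
        rw [formEval_id_affine (natDegree_leftCoeffs_le hE₁ hF hG i),
          formEval_id_affine (natDegree_rightCoeffs_le hE₂ hF' hG' i)])
    have hab : a₁ ≫ ψ₁ ≫ U₁.ι = a₂ ≫ ψ₂ ≫ U₂.ι := hu'.eq_of_proportional hv' (by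
      simpa only [Matrix.cons_val_zero, Matrix.cons_val_one] using hrel)
    rw [hux] at hrx
    refine ⟨_, mem_diagonalImage_iff.mpr ⟨a₁, a₂, ?_, ?_, hab, ?_⟩, hrx⟩
    · exact (Category.assoc _ _ _).symm.trans hu.str
    · exact (Category.assoc _ _ _).symm.trans hv.str
    · simp only [Category.assoc]
  have : Nonempty (specK p ⟶ P1 (W p)) :=
    ⟨point WittVector.constantCoeff ![0, 1] 1 (by simp)⟩
  choose! b hb using hpoint
  have hS : {x | g.eval x ≠ 0}.Infinite := (finite_setOf_eval_eq_zero hg).infinite_compl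
  -- each point arises from finitely many `x` only, as `P / Q` is not constant
  refine hS (Set.Finite.of_finite_fibers (fun x => b x ≫ diag p) ?_ ?_)
  · refine hfin.subset ?_
    rintro _ ⟨x, hx, rfl⟩
    exact (hb x hx).1
  · rintro _ ⟨x, hx, rfl⟩
    have hne := sub_ne_zero_of_isCoprime hPQ hdeg (eval_ne_zero_or_of_isCoprime hPQ x).symm
    refine (finite_setOf_eval_eq_zero hne).subset ?_
    rintro x' ⟨hx', heq⟩
    have heq' : b x' = b x := by
      have h0 : b x' ≫ diag p = b x ≫ diag p := heq
      have := congrArg (· ≫ pullback.fst _ _) h0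
      simpa only [Category.assoc, pullback.diagonal_fst, Category.comp_id] using this
    have hbx := (hb x hx).2
    have hbx' := (hb x' hx').2
    rw [heq'] at hbx'
    have hprop := hbx'.proportional hbx
    simp only [Matrix.cons_val_zero, Matrix.cons_val_one] at hprop
    have hH := hE₁.formEval_ne_zero hbx
    have hH' := hE₁.formEval_ne_zero hbx'
    rw [hE₁.formEval_left_of_charP, hE₁.formEval_right_of_charP, hE₁.formEval_left_of_charP,
      hE₁.formEval_right_of_charP, formEval_affine hE₁.natDegree_P,
      formEval_affine hE₁.natDegree_P, formEval_affine hE₁.natDegree_Q,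
      formEval_affine hE₁.natDegree_Q] at hprop
    change (Pk * C (Qk.eval x) - Qk * C (Pk.eval x)).eval x' = 0
    rw [eval_sub, eval_mul, eval_mul, eval_C, eval_C, sub_eq_zero]
    apply frobenius_inj (BaseField p) p
    rw [frobenius_def, frobenius_def, mul_pow, mul_pow]
    refine mul_left_cancel₀ (mul_ne_zero hH' hH) ?_
    linear_combination hprop

end VanishingEliminant

end WittLine

open WittLine in
theorem proposition6p3 (p : ℕ) [Fact p.Prime]
    (U₁ U₂ : (P1 (W p)).Opens)
    (hU₁ : ContainsCentralGenericPoint U₁) (hU₂ : ContainsCentralGenericPoint U₂)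
    (ψ₁ : U₁.toScheme ⟶ U₁.toScheme) (h₁ : ψ₁ ≫ openStr U₁ = openStr U₁)
    (ψ₂ : U₂.toScheme ⟶ U₂.toScheme) (h₂ : ψ₂ ≫ openStr U₂ = openStr U₂)
    (hdeg₁ : HasDegree ψ₁ (p ^ 2)) (hdeg₂ : HasDegree ψ₂ (p ^ 2))
    (hdiff₁ : HasZeroDifferential (centralFibreStr (openStr U₁))
      (centralFibreMap (openStr U₁) (openStr U₁) ψ₁ h₁))
    (hdiff₂ : HasZeroDifferential (centralFibreStr (openStr U₂))
      (centralFibreMap (openStr U₂) (openStr U₂) ψ₂ h₂))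
    (d e : ℕ) (hde : 0 < d + e)
    (hd : HasDegree (centralFibreMap (openStr U₁) (openStr U₁) ψ₁ h₁) (p * d))
    (he : HasDegree (centralFibreMap (openStr U₂) (openStr U₂) ψ₂ h₂) (p * e))
    (hY : IsNonsingular (reducedDiagPreimage ψ₁ h₁ ψ₂ h₂))
    (hfin : (diagonalImage ψ₁ h₁ ψ₂ h₂).Finite) :
    (diagonalImage ψ₁ h₁ ψ₂ h₂).ncard ≤ (d + e) * p ^ 2 := by
  have hp : p.Prime := Fact.out
  have hn : 0 < p ^ 2 := pow_pos hp.pos 2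
  obtain ⟨F, G, -, hF, hG, hψ₁⟩ := exists_forms hU₁ ψ₁ h₁ hn hdeg₁
  obtain ⟨F', G', -, hF', hG', hψ₂⟩ := exists_forms hU₂ ψ₂ h₂ hn hdeg₂
  obtain ⟨H₀, P₀, Q₀, hH₀, hPQ, hFH, hGH, hPd, hQd⟩ :=
    exists_special_forms hU₁ ψ₁ h₁ hdiff₁ hd hF hG hψ₁
  obtain ⟨H₀', P₀', Q₀', hH₀', hPQ', hFH', hGH', hPe, hQe⟩ :=
    exists_special_forms hU₂ ψ₂ h₂ hdiff₂ he hF' hG' hψ₂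
  obtain ⟨δ, hδ⟩ : ∃ δ, max P₀.natDegree Q₀.natDegree = δ := ⟨_, rfl⟩
  obtain ⟨ε, hε⟩ : ∃ ε, max P₀'.natDegree Q₀'.natDegree = ε := ⟨_, rfl⟩
  have hδd : δ ≤ d := hδ ▸ max_le hPd hQd
  have hεe : ε ≤ e := hε ▸ max_le hPe hQe
  obtain ⟨m, H, P, Q, F₂, G₂, hE₁, rfl, rfl, rfl⟩ :=
    exists_isFrobeniusExpansion hF hG hH₀ hδ hPQ hFH hGH
  obtain ⟨m', H', P', Q', F₂', G₂', hE₂, rfl, rfl, rfl⟩ :=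
    exists_isFrobeniusExpansion hF' hG' hH₀' hε hPQ' hFH' hGH'
  -- a constant reduction of `ψ₁` or `ψ₂` leaves room for one point only
  have hone : (δ = 0 ∨ ε = 0) → (diagonalImage ψ₁ h₁ ψ₂ h₂).ncard ≤ (d + e) * p ^ 2 := by
    intro h0
    refine le_trans ?_ (Nat.one_le_iff_ne_zero.mpr (mul_pos hde hn).ne')
    rw [Set.ncard_le_one hfin]
    intro c hc c' hc'
    obtain ⟨x, y, b, rfl, -, -, hx, hy, -⟩ :=
      exists_coords_of_mem_diagonalImage hψ₁ hψ₂ hE₁ hE₂ hc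
    obtain ⟨x', y', b', rfl, -, -, hx', hy', -⟩ :=
      exists_coords_of_mem_diagonalImage hψ₁ hψ₂ hE₁ hE₂ hc'
    rcases h0 with rfl | rfl
    · rw [hE₁.eq_of_degree_zero hx hx']
    · rw [hE₂.eq_of_degree_zero hy hy']
  rcases Nat.eq_zero_or_pos δ with hδ0 | hδ0
  · exact hone (Or.inl hδ0)
  rcases Nat.eq_zero_or_pos ε with hε0 | hε0
  · exact hone (Or.inr hε0)
  refine (ncard_diagonalImage_le_of_eliminant_ne_zero hn hψ₁ hψ₂ hF hG hF' hG' hE₁ hE₂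
    (fun hR => infinite_diagonalImage_of_eliminant_eq_zero hU₁ hU₂ hψ₁ hψ₂ hF hG hF' hG' hE₁ hE₂
      hPQ hPQ' hδ hδ0 hε hε0 hR hfin) hfin).trans ?_
  rw [mul_comm (p ^ 2) δ, ← add_mul, add_comm ε δ]
  exact Nat.mul_le_mul_right _ (Nat.add_le_add hδd hεe)
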